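/- All manifolds and Lie groups are smooth, Hausdorff, without boundary, and modelled on real Banach spaces (for instance finite-dimensional). Let a Lie group $G$ with Lie algebra $\mathfrak g$ act smoothly on a manifold $M$. Write $X_M(x)=\frac{d}{dt}|_{t=0}\exp(-tX)\cdot x$, let $\mathcal C^{G}(M)$ be the set of pairs $(\phi,\gamma)$ with $\phi\in G$ and $\gamma\colon[0,1]\to M$ a piecewise smooth curve with $\gamma(1)=\phi\cdot\gamma(0)$, and let $\mathcal C(M)$ be the set of piecewise smooth loops. Write $*$ for concatenation and $\overleftarrow{\zeta}$ for the inverse curve. A $G$-equivariant differential character (of degree 2) on $M$ is a map $\chi\colon\mathcal C^G(M)\to\mathbb R/\mathbb Z$ for which there is a closed $G$-equivariant 2-form $\mathrm{curv}(\chi)+\mu^\chi$ (a $G$-invariant closed 2-form $\mathrm{curv}(\chi)$ and a $G$-invariant continuous linear map $X\mapsto\mu^\chi_X\in C^\infty(M)$ on $\mathfrak g$ with $\iota_{X_M}\mathrm{curv}(\chi)=d\mu^\chi_X$) such that (i) $\chi(\phi'\phi,\gamma*\gamma')=\chi(\phi',\gamma')+\chi(\phi,\gamma)$ if $\gamma(1)=\gamma'(0)$;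 (ii) $\chi(\phi,\overleftarrow{\zeta}*\gamma*(\phi\cdot\zeta))=\chi(\phi,\gamma)$ for every piecewise smooth curve $\zeta$ with $\zeta(0)=\gamma(0)$; (iii) $\chi(e,\gamma)=\int_\sigma\mathrm{curv}(\chi)\bmod\mathbb Z$ if $\gamma=\partial\sigma$ for a smooth singular 2-chain $\sigma$; (iv) $\chi(\exp X,\,s\mapsto\exp(sX)\cdot x)=\mu^\chi_X(x)\bmod\mathbb Z$ for $X\in\mathfrak g$, $x\in M$. The moment $\mu^\chi$ is determined by $\chi$. The set of these characters is $\hat H^2_G(M)$. A differential character of degree 2, an element of $\hat H^2(M)$, is a map $\mathcal C(M)\to\mathbb R/\mathbb Z$ with a closed 2-form as curvature and with properties (i)–(iii) for loops (all group elements equal to $e$). Let $M$ be contractible. (1) Suppose that $G$ acts freely on $M$ and that $\pi\colon M\to M/G$ is a smooth principal $G$-bundle. Then $\pi\circ\gamma$ is a loop for every $(\phi,\gamma)\in\mathcal C^G(M)$, and for every $\chi\in\hat H^2_G(M)$ there is $\underline\chi\in\hat H^2(M/G)$ with $\chi(\phi,\gamma)=\underline\chi(\pi\circ\gamma)$ for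 all $(\phi,\gamma)\in\mathcal C^G(M)$ if and only if $\mu^\chi=0$. (2) Let $H\subset G$ be a normal Lie subgroup, with Lie algebra $\mathfrak h$, that acts freely on $M$ and such that $\pi\colon M\to M/H$ is a smooth principal $H$-bundle. Then $G$ acts smoothly on $M/H$ so that $\pi$ is $G$-equivariant, $(\phi,\pi\circ\gamma)\in\mathcal C^G(M/H)$ for every $(\phi,\gamma)\in\mathcal C^G(M)$, and a character $\chi\in\hat H^2_G(M)$ descends to $M/H$ if and only if $\mu^\chi_X=0$ for all $X\in\mathfrak h$. Here $\chi$ descends to $M/H$ if there is $\underline\chi\in\hat H^2_G(M/H)$ that does not depend on the $H$-part of the group element, that is $\underline\chi(h\phi,\delta)=\underline\chi(\phi,\delta)$ for $h\in H$ and $(\phi,\delta)\in\mathcal C^G(M/H)$, with $\chi(\phi,\gamma)=\underline\chi(\phi,\pi\circ\gamma)$ for all $(\phi,\gamma)\in\mathcal C^G(M)$. -/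

import Mathlib

open scoped Manifold ContDiff

noncomputable section

namespace EquivChar

/-! All manifolds are smooth, without boundary, and modelled on a real normed space `E` (a Banach
space in the theorem) through the trivial model `𝓘(ℝ, E)`. The coefficient group `ℝ/ℤ` is
`UnitAddCircle`. -/

/-! ### Curves -/

/-- A curve `γ : [0,1] → M` is piecewise smooth: it is continuous, and there is a finite set `S` of
break points such that `γ` is smooth on each closed interval with no break point in its interior.
(`Set.IccExtend` only turns `γ` into a function on `ℝ`.) -/
def IsPiecewiseSmooth (E : Type*) {M : Type*} [NormedAddCommGroup E] [NormedSpace ℝ E]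
    [TopologicalSpace M] [ChartedSpace E M] (γ : unitInterval → M) : Prop :=
  Continuous γ ∧ ∃ S : Finset ℝ, ∀ a b : ℝ, 0 ≤ a → a < b → b ≤ 1 →
    Disjoint (Set.Ioo a b) (S : Set ℝ) →
    ContMDiffOn 𝓘(ℝ, ℝ) 𝓘(ℝ, E) ∞ (Set.IccExtend (zero_le_one' ℝ) γ) (Set.Icc a b)

/-- The concatenation `γ * γ'`: first `γ`, then `γ'`, both at double speed. -/
def concat {M : Type*} (γ γ' : unitInterval → M) : unitInterval → M := fun t =>
  if (t : ℝ) ≤ 1 / 2 then γ (Set.projIcc 0 1 zero_le_one (2 * (t : ℝ)))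
  else γ' (Set.projIcc 0 1 zero_le_one (2 * (t : ℝ) - 1))

/-- The inverse curve `t ↦ γ (1 - t)`. -/
def reverse {M : Type*} (γ : unitInterval → M) : unitInterval → M := fun t =>
  γ (unitInterval.symm t)

/-- `𝓒(M)`: the piecewise smooth loops. -/
def Loops (E M : Type*) [NormedAddCommGroup E] [NormedSpace ℝ E]
    [TopologicalSpace M] [ChartedSpace E M] : Set (unitInterval → M) :=
  {γ | IsPiecewiseSmooth E γ ∧ γ 1 = γ 0}

/-- `𝓒^G(M)`: the pairs `(φ, γ)` with `γ` a piecewise smooth curve such that `γ(1) = φ • γ(0)`,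
that is, `γ ∈ 𝓒^φ(M)`. -/
def EquivariantCurves (G E M : Type*) [Group G] [NormedAddCommGroup E] [NormedSpace ℝ E]
    [TopologicalSpace M] [ChartedSpace E M] [MulAction G M] : Set (G × (unitInterval → M)) :=
  {p | IsPiecewiseSmooth E p.2 ∧ p.2 1 = p.1 • p.2 0}

/-! ### Smooth singular 2-chains -/

/-- The standard triangle, with vertices `(0,0)`, `(1,0)`, `(0,1)` in this order. -/
def triangle : Set (ℝ × ℝ) := {p | 0 ≤ p.1 ∧ 0 ≤ p.2 ∧ p.1 + p.2 ≤ 1}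

/-- A smooth singular 2-simplex. Only the values on the triangle matter: the boundary and the
integrals below do not see the others. -/
abbrev SmoothSimplex (E M : Type*) [NormedAddCommGroup E] [NormedSpace ℝ E]
    [TopologicalSpace M] [ChartedSpace E M] : Type _ :=
  {σ : ℝ × ℝ → M // ContMDiffOn 𝓘(ℝ, ℝ × ℝ) 𝓘(ℝ, E) ∞ σ triangle}

/-- `C₂(M)`: the smooth singular 2-chains with integer coefficients. -/
abbrev Chain (E M : Type*) [NormedAddCommGroup E] [NormedSpace ℝ E]
    [TopologicalSpace M] [ChartedSpace E M] : Type _ := SmoothSimplex E M →₀ ℤ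

/-- The boundary of a 2-simplex `[v₀, v₁, v₂]`: the 1-chain `[v₁, v₂] - [v₀, v₂] + [v₀, v₁]` in the
free abelian group on the maps `[0,1] → M`. -/
def simplexBoundary {M : Type*} (σ : ℝ × ℝ → M) : (unitInterval → M) →₀ ℤ :=
  Finsupp.single (fun s : unitInterval => σ (1 - (s : ℝ), (s : ℝ))) 1
    - Finsupp.single (fun s : unitInterval => σ (0, (s : ℝ))) 1
    + Finsupp.single (fun s : unitInterval => σ ((s : ℝ), 0)) 1

/-- The boundary of a 2-chain. -/
def boundary {E M : Type*} [NormedAddCommGroup E] [NormedSpace ℝ E]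
    [TopologicalSpace M] [ChartedSpace E M] (σ : Chain E M) : (unitInterval → M) →₀ ℤ :=
  σ.sum fun s n => n • simplexBoundary s.1

/-- The affinely reparametrized restriction of `γ` to `[a, b]`. -/
def piece {M : Type*} (γ : unitInterval → M) (a b : unitInterval) : unitInterval → M := fun s =>
  γ (Set.projIcc 0 1 zero_le_one ((1 - (s : ℝ)) * (a : ℝ) + (s : ℝ) * (b : ℝ)))

/-- `γ = ∂σ`. A piecewise smooth curve is a smooth singular 1-chain after it is cut at finitely many
points `0 = t₀ < t₁ < ⋯ < tₙ = 1`. -/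
def IsBoundaryOf {E M : Type*} [NormedAddCommGroup E] [NormedSpace ℝ E]
    [TopologicalSpace M] [ChartedSpace E M] (γ : unitInterval → M) (σ : Chain E M) : Prop :=
  ∃ (n : ℕ) (t : Fin (n + 1) → unitInterval), StrictMono t ∧ t 0 = 0 ∧ t (Fin.last n) = 1 ∧
    boundary σ = ∑ i : Fin n, Finsupp.single (piece γ (t i.castSucc) (t i.succ)) 1

/-! ### Differential 2-forms -/

/-- A field of alternating bilinear forms on the tangent spaces, with no smoothness required. -/
abbrev TwoFormField (E M : Type*) [NormedAddCommGroup E] [NormedSpace ℝ E]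
    [TopologicalSpace M] [ChartedSpace E M] : Type _ :=
  ∀ x : M, TangentSpace 𝓘(ℝ, E) x [⋀^Fin 2]→L[ℝ] ℝ

/-- The expression of a 2-form `α` in the chart at `x₀`: its pull-back by the inverse of the chart. -/
def inChart {E M : Type*} [NormedAddCommGroup E] [NormedSpace ℝ E]
    [TopologicalSpace M] [ChartedSpace E M] (α : TwoFormField E M) (x₀ : M) :
    E → E [⋀^Fin 2]→L[ℝ] ℝ := fun y =>
  (α ((extChartAt 𝓘(ℝ, E) x₀).symm y)).compContinuousLinearMap
    (mfderiv 𝓘(ℝ, E) 𝓘(ℝ, E) (extChartAt 𝓘(ℝ, E) x₀).symm y)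

/-- `α` is a smooth 2-form. -/
def IsSmoothForm {E M : Type*} [NormedAddCommGroup E] [NormedSpace ℝ E]
    [TopologicalSpace M] [ChartedSpace E M] (α : TwoFormField E M) : Prop :=
  ∀ x₀ : M, ContDiffOn ℝ ∞ (inChart α x₀) (extChartAt 𝓘(ℝ, E) x₀).target

/-- `dα = 0`. -/
def IsClosedForm {E M : Type*} [NormedAddCommGroup E] [NormedSpace ℝ E]
    [TopologicalSpace M] [ChartedSpace E M] (α : TwoFormField E M) : Prop :=
  ∀ x₀ : M, ∀ y ∈ (extChartAt 𝓘(ℝ, E) x₀).target, extDeriv (inChart α x₀) y = 0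

/-- The integral of a 2-form over a 2-simplex: the integral over the triangle of its pull-back. -/
def integralSimplex {E M : Type*} [NormedAddCommGroup E] [NormedSpace ℝ E]
    [TopologicalSpace M] [ChartedSpace E M] (α : TwoFormField E M) (σ : ℝ × ℝ → M) : ℝ :=
  ∫ p in triangle, α (σ p)
    ![mfderivWithin 𝓘(ℝ, ℝ × ℝ) 𝓘(ℝ, E) σ triangle p ((1, 0) : ℝ × ℝ),
      mfderivWithin 𝓘(ℝ, ℝ × ℝ) 𝓘(ℝ, E) σ triangle p ((0, 1) : ℝ × ℝ)]

/-- The integral of a 2-form over a 2-chain. -/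
def integralChain {E M : Type*} [NormedAddCommGroup E] [NormedSpace ℝ E]
    [TopologicalSpace M] [ChartedSpace E M] (α : TwoFormField E M) (σ : Chain E M) : ℝ :=
  σ.sum fun s n => (n : ℝ) * integralSimplex α s.1

/-! ### Differential characters of degree 2 -/

/-- A differential character of degree 2 on `M`: a map `χ : 𝓒(M) → ℝ/ℤ` for which there is a closed
2-form `curv(χ)`, such that `χ` is additive on loops with the same base point, does not change when
the base point is moved along a curve, and is given on boundaries by the integral of `curv(χ)`. -/
structure DifferentialCharacter (E M : Type*) [NormedAddCommGroup E] [NormedSpace ℝ E]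
    [TopologicalSpace M] [ChartedSpace E M] where
  toFun : Loops E M → UnitAddCircle
  map_concat : ∀ γ γ' δ : Loops E M, γ.1 1 = γ'.1 0 → δ.1 = concat γ.1 γ'.1 →
    toFun δ = toFun γ + toFun γ'
  map_conj : ∀ (γ δ : Loops E M) (ζ : unitInterval → M), IsPiecewiseSmooth E ζ → ζ 0 = γ.1 0 →
    δ.1 = concat (concat (reverse ζ) γ.1) ζ → toFun δ = toFun γ
  exists_curv : ∃ α : TwoFormField E M, IsSmoothForm α ∧ IsClosedForm α ∧
    ∀ (γ : Loops E M) (σ : Chain E M), IsBoundaryOf γ.1 σ →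
      toFun γ = ((integralChain α σ : ℝ) : UnitAddCircle)

/-! ### Equivariant 2-forms -/

/-- The fundamental vector field `X_M(x) = d/dt|₀ exp(-tX) • x`. -/
def fundamentalField {EG G E M : Type*} [NormedAddCommGroup EG] [NormedSpace ℝ EG]
    [TopologicalSpace G] [ChartedSpace EG G] [Group G] [NormedAddCommGroup E] [NormedSpace ℝ E]
    [TopologicalSpace M] [ChartedSpace E M] [MulAction G M]
    (X : GroupLieAlgebra 𝓘(ℝ, EG) G) (x : M) : TangentSpace 𝓘(ℝ, E) x :=
  -(show E from mfderiv 𝓘(ℝ, EG) 𝓘(ℝ, E) (fun g : G => g • x) 1 X)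

/-- The adjoint action of `G` on its Lie algebra. -/
def adjoint {EG G : Type*} [NormedAddCommGroup EG] [NormedSpace ℝ EG]
    [TopologicalSpace G] [ChartedSpace EG G] [Group G]
    (φ : G) (X : GroupLieAlgebra 𝓘(ℝ, EG) G) : GroupLieAlgebra 𝓘(ℝ, EG) G :=
  show EG from mfderiv 𝓘(ℝ, EG) 𝓘(ℝ, EG) (fun g : G => φ * g * φ⁻¹) 1 X

/-- A `G`-equivariant 2-form `ω + μ` in the Cartan model: a `G`-invariant 2-form `ω` and a
`G`-invariant (continuous) linear map `X ↦ μ_X` from the Lie algebra to the smooth functions. -/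
structure EquivariantTwoForm (EG G E M : Type*) [NormedAddCommGroup EG] [NormedSpace ℝ EG]
    [TopologicalSpace G] [ChartedSpace EG G] [Group G] [NormedAddCommGroup E] [NormedSpace ℝ E]
    [TopologicalSpace M] [ChartedSpace E M] [MulAction G M] where
  form : TwoFormField E M
  smooth_form : IsSmoothForm form
  invariant_form : ∀ (φ : G) (x : M) (v w : TangentSpace 𝓘(ℝ, E) x),
    form (φ • x) ![mfderiv 𝓘(ℝ, E) 𝓘(ℝ, E) (fun y : M => φ • y) x v,
      mfderiv 𝓘(ℝ, E) 𝓘(ℝ, E) (fun y : M => φ • y) x w] = form x ![v, w]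
  moment : M → (GroupLieAlgebra 𝓘(ℝ, EG) G →L[ℝ] ℝ)
  smooth_moment : ∀ X : GroupLieAlgebra 𝓘(ℝ, EG) G,
    ContMDiff 𝓘(ℝ, E) 𝓘(ℝ, ℝ) ∞ (fun x : M => moment x X)
  invariant_moment : ∀ (φ : G) (X : GroupLieAlgebra 𝓘(ℝ, EG) G) (x : M),
    moment (φ • x) (adjoint φ X) = moment x X

/-- `D(ω + μ) = 0`, that is, `dω = 0` and `ι_{X_M} ω = d(μ_X)` for every `X`. -/
def EquivariantTwoForm.IsClosed {EG G E M : Type*} [NormedAddCommGroup EG] [NormedSpace ℝ EG]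
    [TopologicalSpace G] [ChartedSpace EG G] [Group G] [NormedAddCommGroup E] [NormedSpace ℝ E]
    [TopologicalSpace M] [ChartedSpace E M] [MulAction G M]
    (ϖ : EquivariantTwoForm EG G E M) : Prop :=
  IsClosedForm ϖ.form ∧
    ∀ (X : GroupLieAlgebra 𝓘(ℝ, EG) G) (x : M) (v : TangentSpace 𝓘(ℝ, E) x),
      ϖ.form x ![fundamentalField X x, v]
        = mfderiv 𝓘(ℝ, E) 𝓘(ℝ, ℝ) (fun y : M => ϖ.moment y X) x v

/-! ### Equivariant differential characters of degree 2 -/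

/-- The homomorphism `dι : 𝔥 → 𝔤` of Lie algebras induced by a smooth homomorphism `ι : H → G`. -/
def lieMap {EH H EG G : Type*} [NormedAddCommGroup EH] [NormedSpace ℝ EH]
    [TopologicalSpace H] [ChartedSpace EH H] [Group H] [NormedAddCommGroup EG] [NormedSpace ℝ EG]
    [TopologicalSpace G] [ChartedSpace EG G] [Group G]
    (ι : H →* G) (Y : GroupLieAlgebra 𝓘(ℝ, EH) H) : GroupLieAlgebra 𝓘(ℝ, EG) G :=
  show EG from mfderiv 𝓘(ℝ, EH) 𝓘(ℝ, EG) ι 1 Y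

/-- `c` is the one-parameter subgroup `t ↦ exp(tX)`. -/
structure IsOneParameterSubgroup {EG G : Type*} [NormedAddCommGroup EG] [NormedSpace ℝ EG]
    [TopologicalSpace G] [ChartedSpace EG G] [Group G]
    (c : ℝ → G) (X : GroupLieAlgebra 𝓘(ℝ, EG) G) : Prop where
  smooth : ContMDiff 𝓘(ℝ, ℝ) 𝓘(ℝ, EG) ∞ c
  map_zero : c 0 = 1
  map_add : ∀ s t : ℝ, c (s + t) = c s * c t
  velocity : (mfderiv 𝓘(ℝ, ℝ) 𝓘(ℝ, EG) c 0 (1 : ℝ) : EG) = X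

/-- The equivariant 2-form `ϖ = ω + μ` is an equivariant curvature of `χ : 𝓒^G(M) → ℝ/ℤ`: it is
closed, `ω` computes `χ(e, γ)` for the loops `γ` that are boundaries, and
`χ(exp X, s ↦ exp(sX) • x) = μ_X(x)`. -/
structure IsEquivariantCurvature {EG G E M : Type*} [NormedAddCommGroup EG] [NormedSpace ℝ EG]
    [TopologicalSpace G] [ChartedSpace EG G] [Group G] [NormedAddCommGroup E] [NormedSpace ℝ E]
    [TopologicalSpace M] [ChartedSpace E M] [MulAction G M]
    (χ : EquivariantCurves G E M → UnitAddCircle) (ϖ : EquivariantTwoForm EG G E M) : Prop where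
  isClosed : ϖ.IsClosed
  map_boundary : ∀ (p : EquivariantCurves G E M) (σ : Chain E M),
    p.1.1 = 1 → IsBoundaryOf p.1.2 σ → χ p = ((integralChain ϖ.form σ : ℝ) : UnitAddCircle)
  map_exp : ∀ (p : EquivariantCurves G E M) (X : GroupLieAlgebra 𝓘(ℝ, EG) G) (c : ℝ → G) (x : M),
    IsOneParameterSubgroup c X → p.1.1 = c 1 → (p.1.2 = fun s : unitInterval => c (s : ℝ) • x) →
      χ p = ((ϖ.moment x X : ℝ) : UnitAddCircle)

/-- A `G`-equivariant differential character (of degree 2) on `M`, an element of `Ĥ²_G(M)`. -/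
structure EquivariantDifferentialCharacter (EG G E M : Type*) [NormedAddCommGroup EG]
    [NormedSpace ℝ EG] [TopologicalSpace G] [ChartedSpace EG G] [Group G]
    [NormedAddCommGroup E] [NormedSpace ℝ E]
    [TopologicalSpace M] [ChartedSpace E M] [MulAction G M] where
  toFun : EquivariantCurves G E M → UnitAddCircle
  /-- `χ(φ'φ, γ * γ') = χ(φ', γ') + χ(φ, γ)` -/
  map_concat : ∀ p p' q : EquivariantCurves G E M, p.1.2 1 = p'.1.2 0 →
    q.1 = (p'.1.1 * p.1.1, concat p.1.2 p'.1.2) → toFun q = toFun p' + toFun p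
  /-- `χ(φ, ζ⁻¹ * γ * (φ • ζ)) = χ(φ, γ)` -/
  map_conj : ∀ (p q : EquivariantCurves G E M) (ζ : unitInterval → M), IsPiecewiseSmooth E ζ →
    ζ 0 = p.1.2 0 →
    q.1 = (p.1.1, concat (concat (reverse ζ) p.1.2) (fun t => p.1.1 • ζ t)) → toFun q = toFun p
  exists_curv : ∃ ϖ : EquivariantTwoForm EG G E M, IsEquivariantCurvature toFun ϖ

namespace EquivariantDifferentialCharacter

variable {EG G E M : Type*} [NormedAddCommGroup EG]
    [NormedSpace ℝ EG] [TopologicalSpace G] [ChartedSpace EG G] [Group G]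
    [NormedAddCommGroup E] [NormedSpace ℝ E]
    [TopologicalSpace M] [ChartedSpace E M] [MulAction G M]

/-- The equivariant curvature `curv_G(χ) = curv(χ) + μ^χ`. It is determined by `χ`. -/
def curv (χ : EquivariantDifferentialCharacter EG G E M) : EquivariantTwoForm EG G E M :=
  Classical.choose χ.exists_curv

/-- The moment `μ^χ` of `χ`, as the function `X ↦ x ↦ μ^χ_X(x)`. -/
def moment (χ : EquivariantDifferentialCharacter EG G E M)
    (X : GroupLieAlgebra 𝓘(ℝ, EG) G) (x : M) : ℝ :=
  χ.curv.moment x X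

end EquivariantDifferentialCharacter

/-! ### Principal bundles -/

/-- Let `H` act on `M` through `ι : H → G`. The map `π : M → B` is a smooth principal `H`-bundle:
it is smooth and invariant, and `B` is covered by open sets `U` with a smooth `H`-equivariant
trivialization `π⁻¹(U) ≅ U × H` over `U`. It follows that `H` acts freely, that the fibres of `π`
are the `H`-orbits, and that `B` is the manifold `M/H`. -/
structure IsPrincipalBundle {G EH H E M EB B : Type*} [Group G]
    [NormedAddCommGroup EH] [NormedSpace ℝ EH] [TopologicalSpace H] [ChartedSpace EH H] [Group H]
    [NormedAddCommGroup E] [NormedSpace ℝ E] [TopologicalSpace M] [ChartedSpace E M]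
    [MulAction G M]
    [NormedAddCommGroup EB] [NormedSpace ℝ EB] [TopologicalSpace B] [ChartedSpace EB B]
    (ι : H →* G) (π : M → B) : Prop where
  smooth : ContMDiff 𝓘(ℝ, E) 𝓘(ℝ, EB) ∞ π
  invariant : ∀ (h : H) (x : M), π (ι h • x) = π x
  locally_trivial : ∀ b : B, ∃ (U : Set B)
    (e : PartialDiffeomorph 𝓘(ℝ, E) (𝓘(ℝ, EB).prod 𝓘(ℝ, EH)) M (B × H) ∞),
    IsOpen U ∧ b ∈ U ∧ e.source = π ⁻¹' U ∧ e.target = U ×ˢ Set.univ ∧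
    (∀ x ∈ e.source, (e x).1 = π x) ∧
    (∀ x ∈ e.source, ∀ h : H, (e (ι h • x)).2 = h * (e x).2)

end EquivChar

end

noncomputable section

namespace EquivChar

section

section Curves

variable {E M : Type*} [NormedAddCommGroup E] [NormedSpace ℝ E]
    [TopologicalSpace M] [ChartedSpace E M]

/-- The affinely reparametrized restriction of `f : ℝ → M` to the segment from `a` to `b`. -/
def seg {M : Type*} (f : ℝ → M) (a b : ℝ) : unitInterval → M := fun s =>
  f ((1 - (s : ℝ)) * a + (s : ℝ) * b)

/-- The extension of a curve to `ℝ` that is constant on both sides. -/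
abbrev ext {M : Type*} (γ : unitInterval → M) : ℝ → M := Set.IccExtend (zero_le_one' ℝ) γ

/-- `f` is smooth on the closed interval `[a, b]`. -/
abbrev SmoothOn (E : Type*) {M : Type*} [NormedAddCommGroup E] [NormedSpace ℝ E]
    [TopologicalSpace M] [ChartedSpace E M] (f : ℝ → M) (a b : ℝ) : Prop :=
  ContMDiffOn 𝓘(ℝ, ℝ) 𝓘(ℝ, E) ∞ f (Set.Icc a b)

/-- `f` is piecewise smooth on `[a, b]`. -/
def PiecewiseSmoothOn (E : Type*) {M : Type*} [NormedAddCommGroup E] [NormedSpace ℝ E]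
    [TopologicalSpace M] [ChartedSpace E M] (f : ℝ → M) (a b : ℝ) : Prop :=
  ∃ S : Finset ℝ, ∀ a' b' : ℝ, a ≤ a' → a' < b' → b' ≤ b →
    Disjoint (Set.Ioo a' b') (S : Set ℝ) → SmoothOn E f a' b'

/-- `f` is smooth on the intervals of a subdivision of `[a, b]`, and `C` is the 1-chain of the
restrictions of `f` to them. -/
inductive SegChain (E : Type*) {M : Type*} [NormedAddCommGroup E] [NormedSpace ℝ E]
    [TopologicalSpace M] [ChartedSpace E M] (f : ℝ → M) :
    ℝ → ℝ → ((unitInterval → M) →₀ ℤ) → Prop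
  | single {a b : ℝ} : a < b → SmoothOn E f a b →
      SegChain E f a b (Finsupp.single (seg f a b) 1)
  | snoc {a b c : ℝ} {C : (unitInterval → M) →₀ ℤ} : SegChain E f a b C → b < c →
      SmoothOn E f b c → SegChain E f a c (C + Finsupp.single (seg f b c) 1)

lemma seg_congr {M : Type*} {f g : ℝ → M} {a b : ℝ} (hab : a ≤ b) (h : Set.EqOn f g (Set.Icc a b)) :
    seg f a b = seg g a b := by
  funext s
  have h0 := s.2.1
  have h1 := s.2.2
  exact h ⟨by nlinarith, by nlinarith⟩

lemma seg_ext {M : Type*} (γ : unitInterval → M) : seg (ext γ) 0 1 = γ := by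
  funext s
  simp [seg, ext]

lemma ext_eqOn {M : Type*} (γ : unitInterval → M) (s : ℝ) (hs : s ∈ Set.Icc (0 : ℝ) 1) :
    ext γ s = γ ⟨s, hs⟩ := Set.IccExtend_of_mem _ _ hs

lemma ext_seg {M : Type*} (f : ℝ → M) (a b : ℝ) :
    Set.EqOn (ext (seg f a b)) (fun s => f ((b - a) * s + a)) (Set.Icc 0 1) := by
  intro s hs
  rw [ext_eqOn _ _ hs]
  simp only [seg]
  congr 1
  ring

lemma seg_zero {M : Type*} (f : ℝ → M) (a b : ℝ) : seg f a b 0 = f a := by simp [seg]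

lemma seg_one {M : Type*} (f : ℝ → M) (a b : ℝ) : seg f a b 1 = f b := by simp [seg]

lemma seg_comp_affine {M : Type*} (f : ℝ → M) (m k a b : ℝ) :
    seg (fun s => f (m * s + k)) a b = seg f (m * a + k) (m * b + k) := by
  funext s
  simp only [seg]
  congr 1
  ring

lemma seg_comp {M : Type*} {N : Type*} (g : M → N) (f : ℝ → M) (a b : ℝ) :
    seg (g ∘ f) a b = g ∘ seg f a b := rfl

lemma piece_eq_seg {M : Type*} (γ : unitInterval → M) (a b : unitInterval) :
    piece γ a b = seg (ext γ) a b := rfl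

namespace SegChain

variable {f g : ℝ → M} {a b c : ℝ} {C C' : (unitInterval → M) →₀ ℤ}

lemma lt (h : SegChain E f a b C) : a < b := by
  induction h with
  | single hab _ => exact hab
  | snoc _ hbc _ ih => exact ih.trans hbc

lemma trans (h : SegChain E f a b C) (h' : SegChain E f b c C') :
    SegChain E f a c (C + C') := by
  induction h' with
  | single hab hs => exact .snoc h hab hs
  | snoc _ hbc hs ih => rw [← add_assoc]; exact .snoc ih hbc hs

lemma congr (h : SegChain E f a b C) (hfg : Set.EqOn f g (Set.Icc a b)) :
    SegChain E g a b C := by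
  induction h with
  | single hab hs =>
    rw [seg_congr hab.le hfg]
    exact .single hab (hs.congr fun x hx => (hfg hx).symm)
  | snoc h hbc hs ih =>
    have hsub : Set.EqOn f g (Set.Icc _ _) := hfg.mono (Set.Icc_subset_Icc_left h.lt.le)
    rw [seg_congr hbc.le hsub]
    exact .snoc (ih (hfg.mono (Set.Icc_subset_Icc_right hbc.le))) hbc
      (hs.congr fun x hx => (hsub hx).symm)

lemma continuousOn (h : SegChain E f a b C) : ContinuousOn f (Set.Icc a b) := by
  induction h with
  | single _ hs => exact hs.continuousOn
  | snoc h hbc hs ih =>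
    rw [← Set.Icc_union_Icc_eq_Icc h.lt.le hbc.le]
    exact ih.union_of_isClosed hs.continuousOn isClosed_Icc isClosed_Icc

end SegChain

lemma SmoothOn.comp_affine {f : ℝ → M} {c d m k a b : ℝ} (h : SmoothOn E f c d)
    (hm : Set.MapsTo (fun s => m * s + k) (Set.Icc a b) (Set.Icc c d)) :
    SmoothOn E (fun s => f (m * s + k)) a b := by
  have : ContMDiff 𝓘(ℝ, ℝ) 𝓘(ℝ, ℝ) ∞ (fun s : ℝ => m * s + k) :=
    ContDiff.contMDiff (by fun_prop)
  exact h.comp this.contMDiffOn hm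

lemma SegChain.comp_affine {f : ℝ → M} {m k a b a' b' : ℝ} {C : (unitInterval → M) →₀ ℤ}
    (h : SegChain E f a b C) (hm : 0 < m) (ha : a = m * a' + k) (hb : b = m * b' + k) :
    SegChain E (fun s => f (m * s + k)) a' b' C := by
  induction h generalizing b' with
  | single hab hs =>
    subst ha hb
    rw [← seg_comp_affine]
    refine .single (by nlinarith) (hs.comp_affine fun x hx => ⟨?_, ?_⟩) <;> nlinarith [hx.1, hx.2]
  | @snoc b _ _ _ hbc hs ih =>
    have hb' : b = m * ((b - k) / m) + k := by field_simp; ring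
    have key := ih (b' := (b - k) / m) hb'
    generalize (b - k) / m = d at *
    subst hb hb'
    rw [← seg_comp_affine]
    refine .snoc key (by nlinarith) (hs.comp_affine fun x hx => ⟨?_, ?_⟩) <;>
      nlinarith [hx.1, hx.2]

namespace PiecewiseSmoothOn

variable {f g : ℝ → M} {a b c : ℝ}

lemma mono {a' b' : ℝ} (h : PiecewiseSmoothOn E f a b) (ha : a ≤ a') (hb : b' ≤ b) :
    PiecewiseSmoothOn E f a' b' := by
  obtain ⟨S, hS⟩ := h
  exact ⟨S, fun x y hx hxy hy => hS x y (ha.trans hx) hxy (hy.trans hb)⟩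

lemma _root_.EquivChar.SmoothOn.piecewiseSmoothOn (h : SmoothOn E f a b) :
    PiecewiseSmoothOn E f a b :=
  ⟨∅, fun _ _ hx _ hy _ => h.mono (Set.Icc_subset_Icc hx hy)⟩

lemma congr (h : PiecewiseSmoothOn E f a b) (hfg : Set.EqOn f g (Set.Icc a b)) :
    PiecewiseSmoothOn E g a b := by
  obtain ⟨S, hS⟩ := h
  exact ⟨S, fun x y hx hxy hy hd => (hS x y hx hxy hy hd).congr fun z hz =>
    (hfg ⟨hx.trans hz.1, hz.2.trans hy⟩).symm⟩

lemma trans (h : PiecewiseSmoothOn E f a b) (h' : PiecewiseSmoothOn E f b c) :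
    PiecewiseSmoothOn E f a c := by
  classical
  obtain ⟨S, hS⟩ := h
  obtain ⟨S', hS'⟩ := h'
  refine ⟨insert b (S ∪ S'), fun x y hx hxy hy hd => ?_⟩
  have hb : b ∉ Set.Ioo x y := fun hb => Set.disjoint_left.1 hd hb (by simp)
  have hd1 : Disjoint (Set.Ioo x y) (S : Set ℝ) := hd.mono_right (by intro z hz; simp_all)
  have hd2 : Disjoint (Set.Ioo x y) (S' : Set ℝ) := hd.mono_right (by intro z hz; simp_all)
  by_cases hyb : y ≤ b
  · exact hS x y hx hxy hyb hd1
  · refine hS' x y ?_ hxy hy hd2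
    by_contra! hlt
    exact hb ⟨hlt, not_le.1 hyb⟩

lemma exists_segChain (h : PiecewiseSmoothOn E f a b) (hab : a < b) :
    ∃ C, SegChain E f a b C := by
  classical
  obtain ⟨S, hS⟩ := h
  induction S using Finset.induction_on generalizing a b with
  | empty => exact ⟨_, .single hab (hS a b le_rfl hab le_rfl (by simp))⟩
  | insert s S _ ih =>
    have aux : ∀ a' b', a ≤ a' → a' < b' → b' ≤ b → s ∉ Set.Ioo a' b' →
        ∃ C, SegChain E f a' b' C := fun a' b' ha hab' hb hs =>
      ih hab' fun x y hx hxy hy hd => hS x y (ha.trans hx) hxy (hy.trans hb) (by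
        rw [Finset.coe_insert, Set.disjoint_insert_right]
        exact ⟨fun h => hs ⟨hx.trans_lt h.1, h.2.trans_le hy⟩, hd⟩)
    by_cases hs : s ∈ Set.Ioo a b
    · obtain ⟨C, hC⟩ := aux a s le_rfl hs.1 hs.2.le (by simp)
      obtain ⟨C', hC'⟩ := aux s b hs.1.le hs.2 le_rfl (by simp)
      exact ⟨_, hC.trans hC'⟩
    · exact aux a b le_rfl hab le_rfl hs

lemma _root_.EquivChar.SegChain.piecewiseSmoothOn {C : (unitInterval → M) →₀ ℤ}
    (h : SegChain E f a b C) : PiecewiseSmoothOn E f a b := by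
  induction h with
  | single _ hs => exact hs.piecewiseSmoothOn
  | snoc _ _ hs ih => exact ih.trans hs.piecewiseSmoothOn

lemma continuousOn (h : PiecewiseSmoothOn E f a b) (hab : a < b) :
    ContinuousOn f (Set.Icc a b) :=
  (h.exists_segChain hab).choose_spec.continuousOn

lemma const (x : M) : PiecewiseSmoothOn E (fun _ : ℝ => x) a b :=
  SmoothOn.piecewiseSmoothOn contMDiffOn_const

lemma comp_affine {c d m k : ℝ} (h : PiecewiseSmoothOn E f c d)
    (hm : Set.MapsTo (fun s => m * s + k) (Set.Icc a b) (Set.Icc c d)) :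
    PiecewiseSmoothOn E (fun s => f (m * s + k)) a b := by
  classical
  rcases eq_or_ne m 0 with rfl | hm0
  · simpa using const (f k)
  obtain ⟨S, hS⟩ := h
  refine ⟨S.image fun s => (s - k) / m, fun x y hx hxy hy hd => ?_⟩
  have hd' : ∀ z ∈ Set.Ioo x y, m * z + k ∉ S := fun z hz hzS =>
    Set.disjoint_left.1 hd hz (by
      simp only [Finset.coe_image, Set.mem_image, Finset.mem_coe]
      exact ⟨_, hzS, by field_simp; ring⟩)
  have hxm := hm ⟨hx, hxy.le.trans hy⟩
  have hym := hm ⟨hx.trans hxy.le, hy⟩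
  have hinv : ∀ z, m * ((z - k) / m) + k = z := fun z => by field_simp; ring
  rcases hm0.lt_or_gt with hneg | hpos
  · refine (hS (m * y + k) (m * x + k) hym.1 (by nlinarith) hxm.2 ?_).comp_affine ?_
    · refine Set.disjoint_left.2 fun z hz hzS => hd' ((z - k) / m) ⟨?_, ?_⟩ (by rwa [hinv])
      · by_contra! h
        have := hinv z
        nlinarith [hz.2]
      · by_contra! h
        have := hinv z
        nlinarith [hz.1]
    · intro z hz
      constructor <;> nlinarith [hz.1, hz.2]
  · refine (hS (m * x + k) (m * y + k) hxm.1 (by nlinarith) hym.2 ?_).comp_affine ?_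
    · refine Set.disjoint_left.2 fun z hz hzS => hd' ((z - k) / m) ⟨?_, ?_⟩ (by rwa [hinv])
      · by_contra! h
        have := hinv z
        nlinarith [hz.1]
      · by_contra! h
        have := hinv z
        nlinarith [hz.2]
    · intro z hz
      constructor <;> nlinarith [hz.1, hz.2]

lemma comp_left {E' M' : Type*} [NormedAddCommGroup E'] [NormedSpace ℝ E']
    [TopologicalSpace M'] [ChartedSpace E' M'] {φ : M → M'} (hφ : ContMDiff 𝓘(ℝ, E) 𝓘(ℝ, E') ∞ φ)
    (h : PiecewiseSmoothOn E f a b) : PiecewiseSmoothOn E' (φ ∘ f) a b := by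
  obtain ⟨S, hS⟩ := h
  exact ⟨S, fun x y hx hxy hy hd => hφ.comp_contMDiffOn (hS x y hx hxy hy hd)⟩

end PiecewiseSmoothOn

lemma isPiecewiseSmooth_iff {γ : unitInterval → M} :
    IsPiecewiseSmooth E γ ↔ PiecewiseSmoothOn E (ext γ) 0 1 := by
  refine ⟨fun ⟨_, S, hS⟩ => ⟨S, hS⟩, fun h => ⟨?_, h⟩⟩
  have := continuousOn_iff_continuous_domRestrict.1 (h.continuousOn zero_lt_one)
  convert this using 1
  funext s
  simp [ext]

lemma PiecewiseSmoothOn.seg {f : ℝ → M} {a b c d : ℝ} (h : PiecewiseSmoothOn E f c d)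
    (ha : a ∈ Set.Icc c d) (hb : b ∈ Set.Icc c d) : IsPiecewiseSmooth E (seg f a b) := by
  rw [isPiecewiseSmooth_iff]
  refine PiecewiseSmoothOn.congr ?_ (ext_seg f a b).symm
  refine h.comp_affine fun s hs => ⟨?_, ?_⟩ <;> nlinarith [ha.1, ha.2, hb.1, hb.2, hs.1, hs.2]

lemma SegChain.ext_seg {f : ℝ → M} {a b : ℝ} {C : (unitInterval → M) →₀ ℤ}
    (h : SegChain E f a b C) : SegChain E (ext (seg f a b)) 0 1 C :=
  (h.comp_affine (m := b - a) (k := a) (sub_pos.2 h.lt) (by ring) (by ring)).congr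
    (EquivChar.ext_seg f a b).symm

lemma IsPiecewiseSmooth.exists_segChain {γ : unitInterval → M} (h : IsPiecewiseSmooth E γ) :
    ∃ C, SegChain E (ext γ) 0 1 C :=
  (isPiecewiseSmooth_iff.1 h).exists_segChain zero_lt_one

lemma SegChain.isPiecewiseSmooth {γ : unitInterval → M} {C : (unitInterval → M) →₀ ℤ}
    (h : SegChain E (ext γ) 0 1 C) : IsPiecewiseSmooth E γ :=
  isPiecewiseSmooth_iff.2 h.piecewiseSmoothOn

lemma IsPiecewiseSmooth.comp_left {E' M' : Type*} [NormedAddCommGroup E'] [NormedSpace ℝ E']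
    [TopologicalSpace M'] [ChartedSpace E' M'] {φ : M → M'} (hφ : ContMDiff 𝓘(ℝ, E) 𝓘(ℝ, E') ∞ φ)
    {γ : unitInterval → M} (h : IsPiecewiseSmooth E γ) : IsPiecewiseSmooth E' (φ ∘ γ) :=
  isPiecewiseSmooth_iff.2 (PiecewiseSmoothOn.comp_left hφ (isPiecewiseSmooth_iff.1 h) :)

lemma concat_zero {M : Type*} (γ γ' : unitInterval → M) : concat γ γ' 0 = γ 0 := by
  simp [concat]

lemma concat_one {M : Type*} (γ γ' : unitInterval → M) : concat γ γ' 1 = γ' 1 := by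
  have h : ¬ ((1 : ℝ) ≤ 1 / 2) := by norm_num
  have h' : (2 * 1 - 1 : ℝ) = 1 := by norm_num
  simp only [concat, Set.Icc.coe_one, if_neg h, h', Set.projIcc_right]
  rfl

lemma reverse_zero {M : Type*} (γ : unitInterval → M) : reverse γ 0 = γ 1 := by simp [reverse]

lemma reverse_one {M : Type*} (γ : unitInterval → M) : reverse γ 1 = γ 0 := by simp [reverse]

lemma ext_concat_left {M : Type*} (γ γ' : unitInterval → M) :
    Set.EqOn (ext (concat γ γ')) (fun s => ext γ (2 * s + 0)) (Set.Icc 0 (1 / 2)) := by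
  intro s hs
  rw [ext_eqOn _ s ⟨hs.1, hs.2.trans (by norm_num)⟩]
  simp only [concat, if_pos hs.2, add_zero]
  rfl

lemma ext_concat_right {M : Type*} {γ γ' : unitInterval → M} (h : γ 1 = γ' 0) :
    Set.EqOn (ext (concat γ γ')) (fun s => ext γ' (2 * s + -1)) (Set.Icc (1 / 2) 1) := by
  intro s hs
  rw [ext_eqOn _ s ⟨le_trans (by norm_num) hs.1, hs.2⟩]
  rcases hs.1.eq_or_lt with rfl | hlt
  · simpa [concat, ext] using h
  · simp only [concat, if_neg (not_le.2 hlt), sub_eq_add_neg]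
    rfl

lemma ext_reverse {M : Type*} (γ : unitInterval → M) :
    Set.EqOn (ext (reverse γ)) (fun s => ext γ (-1 * s + 1)) (Set.Icc 0 1) := by
  intro s hs
  rw [ext_eqOn _ s hs]
  have h : -1 * s + 1 ∈ Set.Icc (0 : ℝ) 1 := ⟨by linarith [hs.2], by linarith [hs.1]⟩
  simp only [ext_eqOn _ _ h, reverse]
  congr 1
  ext
  simp
  ring

lemma SegChain.concat {γ γ' : unitInterval → M} {C C' : (unitInterval → M) →₀ ℤ}
    (h : SegChain E (ext γ) 0 1 C) (h' : SegChain E (ext γ') 0 1 C') (hγ : γ 1 = γ' 0) :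
    SegChain E (ext (concat γ γ')) 0 1 (C + C') := by
  refine SegChain.trans (b := 1 / 2) ?_ ?_
  · exact (h.comp_affine (a' := 0) (b' := 1 / 2) (m := 2) (k := 0) two_pos (by norm_num)
      (by norm_num)).congr (ext_concat_left γ γ').symm
  · exact (h'.comp_affine (a' := 1 / 2) (b' := 1) (m := 2) (k := -1) two_pos (by norm_num)
      (by norm_num)).congr (ext_concat_right hγ).symm

lemma IsPiecewiseSmooth.concat {γ γ' : unitInterval → M} (h : IsPiecewiseSmooth E γ)
    (h' : IsPiecewiseSmooth E γ') (hγ : γ 1 = γ' 0) : IsPiecewiseSmooth E (concat γ γ') := by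
  obtain ⟨C, hC⟩ := h.exists_segChain
  obtain ⟨C', hC'⟩ := h'.exists_segChain
  exact (hC.concat hC' hγ).isPiecewiseSmooth

lemma IsPiecewiseSmooth.reverse {γ : unitInterval → M} (h : IsPiecewiseSmooth E γ) :
    IsPiecewiseSmooth E (reverse γ) := by
  rw [isPiecewiseSmooth_iff] at h ⊢
  refine PiecewiseSmoothOn.congr ?_ (ext_reverse γ).symm
  exact h.comp_affine fun s hs => ⟨by linarith [hs.2], by linarith [hs.1]⟩

lemma IsPiecewiseSmooth.const (x : M) :
    IsPiecewiseSmooth E (fun _ : unitInterval => x) :=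
  isPiecewiseSmooth_iff.2 (PiecewiseSmoothOn.const x)

end Curves

end

section

section Alternating

variable {V : Type*} [AddCommGroup V] [TopologicalSpace V] [Module ℝ V]

lemma alternating_smul_left (α : V [⋀^Fin 2]→L[ℝ] ℝ) (c : ℝ) (v w : V) :
    α ![c • v, w] = c * α ![v, w] := by
  have h : ∀ u, Function.update ![v, w] 0 u = ![u, w] := fun u => by
    ext i; fin_cases i <;> rfl
  rw [← h (c • v), α.map_update_smul, h, smul_eq_mul]

lemma alternating_add_left (α : V [⋀^Fin 2]→L[ℝ] ℝ) (u v w : V) :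
    α ![u + v, w] = α ![u, w] + α ![v, w] := by
  have h : ∀ u, Function.update ![v, w] 0 u = ![u, w] := fun u => by
    ext i; fin_cases i <;> rfl
  rw [← h (u + v), α.map_update_add, h, h]

lemma alternating_add_right (α : V [⋀^Fin 2]→L[ℝ] ℝ) (u v w : V) :
    α ![w, u + v] = α ![w, u] + α ![w, v] := by
  have h : ∀ u, Function.update ![w, v] 1 u = ![w, u] := fun u => by
    ext i; fin_cases i <;> rfl
  rw [← h (u + v), α.map_update_add, h, h]

lemma alternating_smul_right (α : V [⋀^Fin 2]→L[ℝ] ℝ) (c : ℝ) (v w : V) :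
    α ![v, c • w] = c * α ![v, w] := by
  have h : ∀ u, Function.update ![v, w] 1 u = ![v, u] := fun u => by
    ext i; fin_cases i <;> rfl
  rw [← h (c • w), α.map_update_smul, h, smul_eq_mul]

lemma alternating_self (α : V [⋀^Fin 2]→L[ℝ] ℝ) (v : V) : α ![v, v] = 0 :=
  α.map_eq_zero_of_eq ![v, v] (i := 0) (j := 1) rfl (by decide)

lemma alternating_smul_smul (α : V [⋀^Fin 2]→L[ℝ] ℝ) (a b : ℝ) (v : V) :
    α ![a • v, b • v] = 0 := by
  rw [alternating_smul_left, alternating_smul_right, alternating_self, mul_zero, mul_zero]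

lemma alternating_swap (α : V [⋀^Fin 2]→L[ℝ] ℝ) (v w : V) : α ![v, w] = - α ![w, v] := by
  have h := alternating_self α (v + w)
  rw [alternating_add_left, alternating_add_right, alternating_add_right, alternating_self,
    alternating_self] at h
  linarith

end Alternating

lemma convex_triangle : Convex ℝ triangle := by
  intro p hp q hq a b ha hb hab
  obtain ⟨h1, h2, h3⟩ := hp
  obtain ⟨h4, h5, h6⟩ := hq
  refine ⟨?_, ?_, ?_⟩ <;> simp only [Prod.fst_add, Prod.snd_add, Prod.smul_fst, Prod.smul_snd,
    smul_eq_mul]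
  · positivity
  · positivity
  · calc a * p.1 + b * q.1 + (a * p.2 + b * q.2) = a * (p.1 + p.2) + b * (q.1 + q.2) := by ring
      _ ≤ a * 1 + b * 1 := by gcongr
      _ = 1 := by linarith

lemma interior_triangle_nonempty : (interior triangle).Nonempty := by
  refine ⟨(1 / 4, 1 / 4), mem_interior.2 ⟨{p : ℝ × ℝ | 0 < p.1 ∧ 0 < p.2 ∧ p.1 + p.2 < 1},
    fun p hp => ⟨hp.1.le, hp.2.1.le, hp.2.2.le⟩, ?_, by norm_num⟩⟩
  exact (isOpen_lt continuous_const continuous_fst).inter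
    ((isOpen_lt continuous_const continuous_snd).inter
      (isOpen_lt (continuous_fst.add continuous_snd) continuous_const))

lemma uniqueMDiffOn_triangle : UniqueMDiffOn 𝓘(ℝ, ℝ × ℝ) triangle :=
  (uniqueDiffOn_convex convex_triangle interior_triangle_nonempty).uniqueMDiffOn

lemma isCompact_triangle : IsCompact triangle := by
  have hc : IsClosed triangle := (isClosed_le continuous_const continuous_fst).inter
    ((isClosed_le continuous_const continuous_snd).inter
      (isClosed_le (continuous_fst.add continuous_snd) continuous_const))
  refine IsCompact.of_isClosed_subset (isCompact_Icc (a := ((0 : ℝ), (0 : ℝ))) (b := (1, 1))) hc ?_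
  rintro ⟨x, y⟩ ⟨h1, h2, h3⟩
  simp only at h1 h2 h3
  exact ⟨⟨h1, h2⟩, ⟨by simp only; linarith, by simp only; linarith⟩⟩

section Tangent

variable {E E' E'' M M' M'' : Type*} [NormedAddCommGroup E] [NormedSpace ℝ E]
    [TopologicalSpace M] [ChartedSpace E M] [NormedAddCommGroup E'] [NormedSpace ℝ E']
    [TopologicalSpace M'] [ChartedSpace E' M'] [NormedAddCommGroup E''] [NormedSpace ℝ E'']
    [TopologicalSpace M''] [ChartedSpace E'' M'']

variable (E E') in
/-- The derivative of a map of manifolds, as a linear map of the model spaces. -/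
def tderiv (f : M → M') (x : M) : E →L[ℝ] E' := mfderiv 𝓘(ℝ, E) 𝓘(ℝ, E') f x

variable (E E') in
/-- The derivative of a map of manifolds within a set, as a linear map of the model spaces. -/
def tderivWithin (f : M → M') (s : Set M) (x : M) : E →L[ℝ] E' :=
  mfderivWithin 𝓘(ℝ, E) 𝓘(ℝ, E') f s x

/-- The value of a 2-form at a point, as an alternating form on the model space. -/
def TwoFormField.val (α : TwoFormField E M) (x : M) : E [⋀^Fin 2]→L[ℝ] ℝ := α x

lemma integralSimplex_eq (α : TwoFormField E M) (σ : ℝ × ℝ → M) :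
    integralSimplex α σ = ∫ p in triangle, α.val (σ p)
      ![tderivWithin (ℝ × ℝ) E σ triangle p (1, 0), tderivWithin (ℝ × ℝ) E σ triangle p (0, 1)] :=
  rfl

lemma inChart_eq (α : TwoFormField E M) (x₀ : M) (y : E) :
    inChart α x₀ y = (α.val ((extChartAt 𝓘(ℝ, E) x₀).symm y)).compContinuousLinearMap
      (tderiv E E (extChartAt 𝓘(ℝ, E) x₀).symm y) := rfl

lemma tderiv_comp {g : M' → M''} {f : M → M'} {x : M}
    (hg : MDifferentiableAt 𝓘(ℝ, E') 𝓘(ℝ, E'') g (f x))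
    (hf : MDifferentiableAt 𝓘(ℝ, E) 𝓘(ℝ, E') f x) :
    tderiv E E'' (g ∘ f) x = (tderiv E' E'' g (f x)).comp (tderiv E E' f x) :=
  mfderiv_comp x hg hf

lemma tderivWithin_comp {g : M' → M''} {f : M → M'} {s : Set M} {t : Set M'} {x : M}
    (hg : MDifferentiableWithinAt 𝓘(ℝ, E') 𝓘(ℝ, E'') g t (f x))
    (hf : MDifferentiableWithinAt 𝓘(ℝ, E) 𝓘(ℝ, E') f s x) (h : Set.MapsTo f s t)
    (hs : UniqueMDiffWithinAt 𝓘(ℝ, E) s x) :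
    tderivWithin E E'' (g ∘ f) s x = (tderivWithin E' E'' g t (f x)).comp (tderivWithin E E' f s x) :=
  mfderivWithin_comp x hg hf h hs

lemma tderiv_comp_tderivWithin {g : M' → M''} {f : M → M'} {s : Set M} {x : M}
    (hg : MDifferentiableAt 𝓘(ℝ, E') 𝓘(ℝ, E'') g (f x))
    (hf : MDifferentiableWithinAt 𝓘(ℝ, E) 𝓘(ℝ, E') f s x)
    (hs : UniqueMDiffWithinAt 𝓘(ℝ, E) s x) :
    tderivWithin E E'' (g ∘ f) s x = (tderiv E' E'' g (f x)).comp (tderivWithin E E' f s x) :=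
  mfderiv_comp_mfderivWithin x hg hf hs

lemma tderiv_eq_fderiv (f : E → E') (x : E) : tderiv E E' f x = fderiv ℝ f x :=
  mfderiv_eq_fderiv

lemma tderivWithin_eq_fderivWithin (f : E → E') (s : Set E) (x : E) :
    tderivWithin E E' f s x = fderivWithin ℝ f s x :=
  mfderivWithin_eq_fderivWithin

lemma tderiv_id (x : M) : tderiv E E (fun y : M => y) x = ContinuousLinearMap.id ℝ E :=
  mfderiv_id

lemma tderiv_const (c : M') (x : M) : tderiv E E' (fun _ : M => c) x = 0 :=
  mfderiv_const

lemma tderivWithin_const (c : M') (s : Set M) (x : M) :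
    tderivWithin E E' (fun _ : M => c) s x = 0 :=
  mfderivWithin_const

lemma tderiv_congr {f g : M → M'} {x : M} (h : f =ᶠ[nhds x] g) :
    tderiv E E' f x = tderiv E E' g x :=
  h.mfderiv_eq

/-- The derivative of `x ↦ Φ (f x, g x)` is the sum of the two partial derivatives. -/
lemma tderiv_prod {Φ : M × M' → M''} {N F : Type*} [NormedAddCommGroup F] [NormedSpace ℝ F]
    [TopologicalSpace N] [ChartedSpace F N] {f : N → M} {g : N → M'} {x : N}
    (hΦ : MDifferentiableAt (𝓘(ℝ, E).prod 𝓘(ℝ, E')) 𝓘(ℝ, E'') Φ (f x, g x))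
    (hf : MDifferentiableAt 𝓘(ℝ, F) 𝓘(ℝ, E) f x) (hg : MDifferentiableAt 𝓘(ℝ, F) 𝓘(ℝ, E') g x)
    (v : F) :
    tderiv F E'' (fun y => Φ (f y, g y)) x v =
      tderiv E E'' (fun z => Φ (z, g x)) (f x) (tderiv F E f x v) +
      tderiv E' E'' (fun z => Φ (f x, z)) (g x) (tderiv F E' g x v) := by
  have h1 := mfderiv_comp x hΦ (hf.prodMk hg)
  have h2 := mfderiv_prod_eq_add_apply (v := (tderiv F E f x v, tderiv F E' g x v)) hΦ
  have h3 := mfderiv_prodMk hf hg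
  refine (DFunLike.congr_fun h1 v).trans (Eq.trans ?_ h2)
  exact congrArg (mfderiv (𝓘(ℝ, E).prod 𝓘(ℝ, E')) 𝓘(ℝ, E'') Φ (f x, g x))
    (DFunLike.congr_fun h3 v)

end Tangent

section Chains

variable {E M : Type*} [NormedAddCommGroup E] [NormedSpace ℝ E]
    [TopologicalSpace M] [ChartedSpace E M]

/-- The restriction of `f : ℝ → M` to a degenerate triangle with vertices `t₀`, `t₁`, `t₂`. -/
def thinSimplex {M : Type*} (f : ℝ → M) (t₀ t₁ t₂ : ℝ) : ℝ × ℝ → M := fun p =>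
  f (t₀ + p.1 * (t₁ - t₀) + p.2 * (t₂ - t₀))

lemma mapsTo_triangle {a b t₀ t₁ t₂ : ℝ} (h₀ : t₀ ∈ Set.Icc a b) (h₁ : t₁ ∈ Set.Icc a b)
    (h₂ : t₂ ∈ Set.Icc a b) :
    Set.MapsTo (fun p : ℝ × ℝ => t₀ + p.1 * (t₁ - t₀) + p.2 * (t₂ - t₀)) triangle
      (Set.Icc a b) := by
  rintro ⟨x, y⟩ ⟨hx, hy, hxy⟩
  simp only at hx hy hxy
  obtain ⟨h₀, h₀'⟩ := h₀
  obtain ⟨h₁, h₁'⟩ := h₁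
  obtain ⟨h₂, h₂'⟩ := h₂
  constructor <;> simp only <;> nlinarith

lemma contMDiff_affine (t₀ m₁ m₂ : ℝ) :
    ContMDiff 𝓘(ℝ, ℝ × ℝ) 𝓘(ℝ, ℝ) ∞ (fun p : ℝ × ℝ => t₀ + p.1 * m₁ + p.2 * m₂) :=
  ContDiff.contMDiff (by fun_prop)

lemma contMDiffOn_thinSimplex {f : ℝ → M} {a b t₀ t₁ t₂ : ℝ} (hf : SmoothOn E f a b)
    (h₀ : t₀ ∈ Set.Icc a b) (h₁ : t₁ ∈ Set.Icc a b) (h₂ : t₂ ∈ Set.Icc a b) :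
    ContMDiffOn 𝓘(ℝ, ℝ × ℝ) 𝓘(ℝ, E) ∞ (thinSimplex f t₀ t₁ t₂) triangle :=
  hf.comp (contMDiff_affine _ _ _).contMDiffOn (mapsTo_triangle h₀ h₁ h₂)

lemma integralSimplex_const (α : TwoFormField E M) (x : M) :
    integralSimplex α (fun _ => x) = 0 := by
  rw [integralSimplex_eq]
  refine MeasureTheory.integral_eq_zero_of_ae (Filter.Eventually.of_forall fun p => ?_)
  simp only [tderivWithin_const, zero_apply, Pi.zero_apply]
  exact alternating_self _ _

lemma integralSimplex_thinSimplex (α : TwoFormField E M) {f : ℝ → M} {a b t₀ t₁ t₂ : ℝ}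
    (hf : SmoothOn E f a b) (h₀ : t₀ ∈ Set.Icc a b) (h₁ : t₁ ∈ Set.Icc a b)
    (h₂ : t₂ ∈ Set.Icc a b) : integralSimplex α (thinSimplex f t₀ t₁ t₂) = 0 := by
  rw [integralSimplex_eq]
  refine MeasureTheory.setIntegral_eq_zero_of_forall_eq_zero fun p hp => ?_
  set ℓ : ℝ × ℝ → ℝ := fun p => t₀ + p.1 * (t₁ - t₀) + p.2 * (t₂ - t₀) with hℓ
  have hm : Set.MapsTo ℓ triangle (Set.Icc a b) := mapsTo_triangle h₀ h₁ h₂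
  have hcomp : tderivWithin (ℝ × ℝ) E (thinSimplex f t₀ t₁ t₂) triangle p =
      (tderivWithin ℝ E f (Set.Icc a b) (ℓ p)).comp (tderivWithin (ℝ × ℝ) ℝ ℓ triangle p) :=
    tderivWithin_comp ((hf _ (hm hp)).mdifferentiableWithinAt (by simp))
      ((contMDiff_affine t₀ _ _).contMDiffAt.mdifferentiableAt (by simp)).mdifferentiableWithinAt
      hm (uniqueMDiffOn_triangle p hp)
  have key : ∀ v, tderivWithin (ℝ × ℝ) E (thinSimplex f t₀ t₁ t₂) triangle p v =
      (tderivWithin (ℝ × ℝ) ℝ ℓ triangle p v) • tderivWithin ℝ E f (Set.Icc a b) (ℓ p) 1 := by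
    intro v
    rw [hcomp, ← ContinuousLinearMap.map_smul, smul_eq_mul, mul_one]
    rfl
  rw [key, key]
  exact alternating_smul_smul _ _ _ _

lemma boundary_add (σ τ : Chain E M) : boundary (σ + τ) = boundary σ + boundary τ :=
  Finsupp.sum_add_index' (fun _ => zero_smul _ _) (fun _ _ _ => add_smul _ _ _)

lemma boundary_neg (σ : Chain E M) : boundary (-σ) = -boundary σ := by
  have h := boundary_add σ (-σ)
  rw [add_neg_cancel, show boundary (0 : Chain E M) = 0 from Finsupp.sum_zero_index] at h
  exact (neg_eq_of_add_eq_zero_right h.symm).symm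

lemma boundary_single (σ : SmoothSimplex E M) :
    boundary (Finsupp.single σ 1) = simplexBoundary σ.1 := by
  simp [boundary, Finsupp.sum_single_index]

lemma integralChain_add (α : TwoFormField E M) (σ τ : Chain E M) :
    integralChain α (σ + τ) = integralChain α σ + integralChain α τ :=
  Finsupp.sum_add_index' (fun _ => by simp) (fun _ _ _ => by push_cast; ring)

lemma integralChain_neg (α : TwoFormField E M) (σ : Chain E M) :
    integralChain α (-σ) = -integralChain α σ := by
  have h := integralChain_add α σ (-σ)
  rw [add_neg_cancel, show integralChain α (0 : Chain E M) = 0 from Finsupp.sum_zero_index] at h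
  linarith

lemma integralChain_single (α : TwoFormField E M) (σ : SmoothSimplex E M) :
    integralChain α (Finsupp.single σ 1) = integralSimplex α σ.1 := by
  simp [integralChain, Finsupp.sum_single_index]

/-- The 1-chain `C` bounds a smooth 2-chain with integral `r`. -/
def Bounds (α : TwoFormField E M) (C : (unitInterval → M) →₀ ℤ) (r : ℝ) : Prop :=
  ∃ σ : Chain E M, boundary σ = C ∧ integralChain α σ = r

namespace Bounds

variable {α : TwoFormField E M} {C C' : (unitInterval → M) →₀ ℤ} {r r' : ℝ}

lemma add (h : Bounds α C r) (h' : Bounds α C' r') : Bounds α (C + C') (r + r') := by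
  obtain ⟨σ, rfl, rfl⟩ := h
  obtain ⟨τ, rfl, rfl⟩ := h'
  exact ⟨σ + τ, boundary_add _ _, integralChain_add _ _ _⟩

lemma neg (h : Bounds α C r) : Bounds α (-C) (-r) := by
  obtain ⟨σ, rfl, rfl⟩ := h
  exact ⟨-σ, boundary_neg _, integralChain_neg _ _⟩

lemma sub (h : Bounds α C r) (h' : Bounds α C' r') : Bounds α (C - C') (r - r') := by
  rw [sub_eq_add_neg, sub_eq_add_neg]
  exact h.add h'.neg

lemma zero : Bounds α 0 0 :=
  ⟨0, Finsupp.sum_zero_index, Finsupp.sum_zero_index⟩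

lemma simplex {σ : ℝ × ℝ → M} (hσ : ContMDiffOn 𝓘(ℝ, ℝ × ℝ) 𝓘(ℝ, E) ∞ σ triangle) :
    Bounds α (simplexBoundary σ) (integralSimplex α σ) :=
  ⟨Finsupp.single ⟨σ, hσ⟩ 1, boundary_single _, integralChain_single _ _⟩

lemma const (x : M) : Bounds α (Finsupp.single (fun _ => x) 1) 0 := by
  have h := simplex (E := E) (α := α) (σ := fun _ => x) contMDiffOn_const
  rwa [integralSimplex_const, show simplexBoundary (fun _ : ℝ × ℝ => x) =
    Finsupp.single (fun _ => x) 1 by simp [simplexBoundary]] at h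

lemma thin {f : ℝ → M} {a b t₀ t₁ t₂ : ℝ} (hf : SmoothOn E f a b)
    (h₀ : t₀ ∈ Set.Icc a b) (h₁ : t₁ ∈ Set.Icc a b) (h₂ : t₂ ∈ Set.Icc a b) :
    Bounds α (Finsupp.single (seg f t₁ t₂) 1 - Finsupp.single (seg f t₀ t₂) 1
      + Finsupp.single (seg f t₀ t₁) 1) 0 := by
  have h := simplex (α := α) (contMDiffOn_thinSimplex hf h₀ h₁ h₂)
  rw [integralSimplex_thinSimplex α hf h₀ h₁ h₂] at h
  convert h using 1
  simp only [simplexBoundary, thinSimplex]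
  congr 1
  · congr 1
    · congr 1; funext s; simp only [seg]; congr 1; ring
    · congr 1; funext s; simp only [seg]; congr 1; ring
  · congr 1; funext s; simp only [seg]; congr 1; ring

lemma thin_reverse {f : ℝ → M} {a b : ℝ} (hab : a < b) (hf : SmoothOn E f a b) :
    Bounds α (Finsupp.single (seg f a b) 1 + Finsupp.single (seg f b a) 1) 0 := by
  have h := (thin (α := α) hf (t₀ := a) (t₁ := b) (t₂ := a) (by simp [hab.le]) (by simp [hab.le])
    (by simp [hab.le])).add (const (f a))
  have hc : seg f a a = fun _ => f a := by
    funext s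
    simp only [seg]
    congr 1
    ring
  rw [hc, add_zero] at h
  convert h using 1
  abel

end Bounds

lemma SegChain.exists_neg {f : ℝ → M} {a b : ℝ} {C : (unitInterval → M) →₀ ℤ}
    (α : TwoFormField E M) (h : SegChain E f a b C) :
    ∃ C', SegChain E (fun s => f (-1 * s + 1)) (1 - b) (1 - a) C' ∧ Bounds α (C + C') 0 := by
  have base : ∀ {a b : ℝ}, a < b → SmoothOn E f a b → SegChain E (fun s => f (-1 * s + 1))
      (1 - b) (1 - a) (Finsupp.single (seg f b a) 1) := by
    intro a b hab hs
    have : seg f b a = seg (fun s => f (-1 * s + 1)) (1 - b) (1 - a) := by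
      rw [seg_comp_affine]; congr 1 <;> ring
    rw [this]
    exact .single (by linarith) (hs.comp_affine fun x hx => ⟨by linarith [hx.2], by linarith [hx.1]⟩)
  induction h with
  | single hab hs => exact ⟨_, base hab hs, Bounds.thin_reverse hab hs⟩
  | snoc _ hbc hs ih =>
    obtain ⟨C', hC', hB⟩ := ih
    refine ⟨_, (base hbc hs).trans hC', ?_⟩
    have := hB.add (Bounds.thin_reverse (α := α) hbc hs)
    rw [add_zero] at this
    convert this using 1
    abel

lemma SegChain.exists_reverse {γ : unitInterval → M} {C : (unitInterval → M) →₀ ℤ}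
    (α : TwoFormField E M) (h : SegChain E (ext γ) 0 1 C) :
    ∃ C', SegChain E (ext (reverse γ)) 0 1 C' ∧ Bounds α (C + C') 0 := by
  obtain ⟨C', hC', hB⟩ := h.exists_neg α
  rw [sub_self, sub_zero] at hC'
  exact ⟨C', hC'.congr (ext_reverse γ).symm, hB⟩

lemma SegChain.exists_partition {γ : unitInterval → M} {a b : ℝ} {C : (unitInterval → M) →₀ ℤ}
    (h : SegChain E (ext γ) a b C) (ha : 0 ≤ a) (hb : b ≤ 1) :
    ∃ (n : ℕ) (t : Fin (n + 1) → unitInterval), StrictMono t ∧ (t 0 : ℝ) = a ∧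
      (t (Fin.last n) : ℝ) = b ∧
      C = ∑ i : Fin n, Finsupp.single (piece γ (t i.castSucc) (t i.succ)) 1 := by
  induction h with
  | @single b hab hs =>
    refine ⟨1, ![⟨a, ha, hab.le.trans hb⟩, ⟨b, ha.trans hab.le, hb⟩], ?_, rfl, rfl, ?_⟩
    · rw [Fin.strictMono_iff_lt_succ]
      intro i
      fin_cases i
      exact hab
    · simp [piece_eq_seg]
  | @snoc b c C h hbc hs ih =>
    obtain ⟨n, t, ht, h0, h1, rfl⟩ := ih (hbc.le.trans hb)
    have hc : 0 ≤ c := ha.trans (h.lt.trans hbc).le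
    refine ⟨n + 1, Fin.snoc (α := fun _ => unitInterval) t ⟨c, hc, hb⟩, ?_, ?_, ?_, ?_⟩
    · rw [Fin.strictMono_iff_lt_succ]
      intro i
      induction i using Fin.lastCases with
      | last =>
        rw [Fin.succ_last, Fin.snoc_last, Fin.snoc_castSucc, ← Subtype.coe_lt_coe, h1]
        exact hbc
      | cast i =>
        rw [Fin.succ_castSucc, Fin.snoc_castSucc, Fin.snoc_castSucc]
        exact ht i.castSucc_lt_succ
    · rw [← Fin.castSucc_zero, Fin.snoc_castSucc, h0]
    · rw [Fin.snoc_last]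
    · rw [Fin.sum_univ_castSucc]
      congr 1
      · refine Finset.sum_congr rfl fun i _ => ?_
        rw [Fin.succ_castSucc, Fin.snoc_castSucc, Fin.snoc_castSucc]
      · rw [Fin.succ_last, Fin.snoc_last, Fin.snoc_castSucc, piece_eq_seg, h1]

lemma SegChain.isBoundaryOf {γ : unitInterval → M} {C : (unitInterval → M) →₀ ℤ}
    (h : SegChain E (ext γ) 0 1 C) {σ : Chain E M} (hσ : boundary σ = C) : IsBoundaryOf γ σ := by
  obtain ⟨n, t, ht, h0, h1, rfl⟩ := h.exists_partition le_rfl le_rfl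
  exact ⟨n, t, ht, Subtype.ext h0, Subtype.ext h1, hσ⟩

end Chains

end

section

/-- A trivialization of an equivariant differential character: a function `hol` on curves that is
additive under subdivision, with "transition functions" `trans`. -/
structure HolonomyData (G E M : Type*) [Group G] [NormedAddCommGroup E] [NormedSpace ℝ E]
    [TopologicalSpace M] [ChartedSpace E M] [MulAction G M] where
  hol : (unitInterval → M) → UnitAddCircle
  trans : G → M → UnitAddCircle
  form : TwoFormField E M
  hol_split : ∀ (f : ℝ → M) (a b c : ℝ), a ≤ b → b ≤ c → a < c → PiecewiseSmoothOn E f a c →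
    hol (seg f a c) = hol (seg f a b) + hol (seg f b c)
  hol_const : ∀ x : M, hol (fun _ => x) = 0
  hol_reverse : ∀ γ, IsPiecewiseSmooth E γ → hol (reverse γ) = -hol γ
  hol_simplex : ∀ σ : ℝ × ℝ → M, ContMDiffOn 𝓘(ℝ, ℝ × ℝ) 𝓘(ℝ, E) ∞ σ triangle →
    hol (fun s => σ (1 - (s : ℝ), (s : ℝ))) - hol (fun s => σ (0, (s : ℝ)))
      + hol (fun s => σ ((s : ℝ), 0)) = ((integralSimplex form σ : ℝ) : UnitAddCircle)
  hol_smul : ∀ (φ : G) (γ : unitInterval → M), IsPiecewiseSmooth E γ →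
    hol (fun s => φ • γ s) = hol γ + trans φ (γ 0) - trans φ (γ 1)
  trans_mul : ∀ (φ' φ : G) (x : M), trans (φ' * φ) x = trans φ' (φ • x) + trans φ x

section Basic

variable {M : Type*}

lemma reverse_reverse (γ : unitInterval → M) : reverse (reverse γ) = γ := by
  funext s
  simp [reverse]

lemma seg_zero_half_concat (γ γ' : unitInterval → M) :
    seg (ext (concat γ γ')) 0 (1 / 2) = γ := by
  rw [seg_congr (by norm_num) (ext_concat_left γ γ'), seg_comp_affine]
  norm_num [seg_ext]

lemma seg_half_one_concat {γ γ' : unitInterval → M} (h : γ 1 = γ' 0) :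
    seg (ext (concat γ γ')) (1 / 2) 1 = γ' := by
  rw [seg_congr (by norm_num) (ext_concat_right h), seg_comp_affine]
  norm_num [seg_ext]

end Basic

namespace EquivariantDifferentialCharacter

variable {EG G E M : Type*} [NormedAddCommGroup EG]
    [NormedSpace ℝ EG] [TopologicalSpace G] [ChartedSpace EG G] [Group G]
    [NormedAddCommGroup E] [NormedSpace ℝ E]
    [TopologicalSpace M] [ChartedSpace E M] [MulAction G M]

lemma curv_spec (χ : EquivariantDifferentialCharacter EG G E M) :
    IsEquivariantCurvature χ.toFun χ.curv := Classical.choose_spec χ.exists_curv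

open Classical in
/-- The value of `χ` on `(φ, γ)`, zero if `(φ, γ)` is not in `𝓒^G(M)`. -/
def ev (χ : EquivariantDifferentialCharacter EG G E M) (φ : G) (γ : unitInterval → M) :
    UnitAddCircle :=
  if h : (φ, γ) ∈ EquivariantCurves G E M then χ.toFun ⟨(φ, γ), h⟩ else 0

variable (χ : EquivariantDifferentialCharacter EG G E M)

lemma ev_eq (p : EquivariantCurves G E M) : χ.ev p.1.1 p.1.2 = χ.toFun p := dif_pos p.2

lemma ev_concat {φ φ' : G} {γ γ' : unitInterval → M} (hγ : IsPiecewiseSmooth E γ)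
    (hγ' : IsPiecewiseSmooth E γ') (h : γ 1 = φ • γ 0) (h' : γ' 1 = φ' • γ' 0)
    (hc : γ 1 = γ' 0) : χ.ev (φ' * φ) (concat γ γ') = χ.ev φ' γ' + χ.ev φ γ := by
  have hm : (φ' * φ, concat γ γ') ∈ EquivariantCurves G E M :=
    ⟨hγ.concat hγ' hc, by
      change concat γ γ' 1 = (φ' * φ) • concat γ γ' 0
      rw [concat_one, concat_zero, h', ← hc, h, mul_smul]⟩
  have := χ.map_concat ⟨(φ, γ), hγ, h⟩ ⟨(φ', γ'), hγ', h'⟩ ⟨_, hm⟩ hc rfl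
  rwa [← ev_eq, ← ev_eq, ← ev_eq] at this

lemma ev_bounds {γ : unitInterval → M} {C : (unitInterval → M) →₀ ℤ} {r : ℝ}
    (hC : SegChain E (ext γ) 0 1 C) (hγ : γ 1 = γ 0) (hB : Bounds χ.curv.form C r) :
    χ.ev 1 γ = (r : UnitAddCircle) := by
  obtain ⟨σ, hσ, rfl⟩ := hB
  have hm : ((1 : G), γ) ∈ EquivariantCurves G E M :=
    ⟨hC.isPiecewiseSmooth, by simpa using hγ⟩
  rw [← χ.curv_spec.map_boundary ⟨_, hm⟩ σ rfl (hC.isBoundaryOf hσ), ← ev_eq]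

/-- Two curves with the same end points and group element: the values of `χ` differ by the integral
of the curvature over any 2-chain between them. -/
lemma ev_sub_ev {φ : G} {γ γ' : unitInterval → M} {C C' : (unitInterval → M) →₀ ℤ} {r : ℝ}
    (hC : SegChain E (ext γ) 0 1 C) (hC' : SegChain E (ext γ') 0 1 C') (h0 : γ 0 = γ' 0)
    (h1 : γ 1 = γ' 1) (hφ : γ 1 = φ • γ 0) (hB : Bounds χ.curv.form (C - C') r) :
    χ.ev φ γ - χ.ev φ γ' = (r : UnitAddCircle) := by
  obtain ⟨D, hD, hBD⟩ := hC'.exists_reverse χ.curv.form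
  have hr : reverse γ' 1 = φ⁻¹ • reverse γ' 0 := by
    rw [reverse_one, reverse_zero, ← h0, ← h1, hφ, inv_smul_smul]
  have e1 := χ.ev_concat hC.isPiecewiseSmooth hD.isPiecewiseSmooth hφ hr
    (by rw [h1, reverse_zero])
  have e2 := χ.ev_concat hC'.isPiecewiseSmooth hD.isPiecewiseSmooth (by rw [← h0, ← h1, hφ]) hr
    (by rw [reverse_zero])
  rw [inv_mul_cancel] at e1 e2
  rw [χ.ev_bounds (r := r) (hC.concat hD (by rw [h1, reverse_zero]))
    (by rw [concat_one, concat_zero, reverse_one, h0])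
    (by convert hB.add hBD using 1 <;> abel)] at e1
  rw [χ.ev_bounds (r := 0) (hC'.concat hD (by rw [reverse_zero]))
    (by rw [concat_one, concat_zero, reverse_one]) hBD] at e2
  have e3 : χ.ev φ γ = r - χ.ev φ⁻¹ (reverse γ') := by rw [e1]; abel
  have e4 : χ.ev φ γ' = (0 : ℝ) - χ.ev φ⁻¹ (reverse γ') := by rw [e2]; abel
  rw [e3, e4]
  simp

section Hol

variable {x₀ : M} (ζ : M → unitInterval → M)

/-- The value of `χ` on the loop obtained from `γ` by joining its end points to a base point. -/
def hol (γ : unitInterval → M) : UnitAddCircle :=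
  χ.ev 1 (concat (concat (ζ (γ 0)) γ) (reverse (ζ (γ 1))))

variable {ζ} (hζ : ∀ x, IsPiecewiseSmooth E (ζ x)) (hζ0 : ∀ x, ζ x 0 = x₀) (hζ1 : ∀ x, ζ x 1 = x)

include hζ hζ0 hζ1

lemma hol_of_bounds {γ γ₁ γ₂ : unitInterval → M} {C C₁ C₂ : (unitInterval → M) →₀ ℤ} {r : ℝ}
    (hC : SegChain E (ext γ) 0 1 C) (hC₁ : SegChain E (ext γ₁) 0 1 C₁)
    (hC₂ : SegChain E (ext γ₂) 0 1 C₂) (h0 : γ 0 = γ₁ 0) (h12 : γ₁ 1 = γ₂ 0) (h1 : γ 1 = γ₂ 1)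
    (hB : Bounds χ.curv.form (C - C₁ - C₂) r) :
    χ.hol ζ γ = χ.hol ζ γ₁ + χ.hol ζ γ₂ + (r : UnitAddCircle) := by
  choose Z hZ using fun x => (hζ x).exists_segChain
  choose Z' hZ' hBZ using fun x => (hZ x).exists_reverse χ.curv.form
  have loop : ∀ {δ : unitInterval → M} {D}, SegChain E (ext δ) 0 1 D →
      SegChain E (ext (concat (concat (ζ (δ 0)) δ) (reverse (ζ (δ 1))))) 0 1
        (Z (δ 0) + D + Z' (δ 1)) := fun hD =>
    ((hZ _).concat hD (hζ1 _)).concat (hZ' _) (by rw [concat_one, reverse_zero, hζ1])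
  have l0 : ∀ δ : unitInterval → M,
      concat (concat (ζ (δ 0)) δ) (reverse (ζ (δ 1))) 0 = x₀ := fun δ => by
    rw [concat_zero, concat_zero, hζ0]
  have l1 : ∀ δ : unitInterval → M,
      concat (concat (ζ (δ 0)) δ) (reverse (ζ (δ 1))) 1 = x₀ := fun δ => by
    rw [concat_one, reverse_one, hζ0]
  have e := χ.ev_concat (φ := 1) (φ' := 1) (loop hC₁).isPiecewiseSmooth (loop hC₂).isPiecewiseSmooth
    (by rw [l0, l1, one_smul]) (by rw [l0, l1, one_smul]) (by rw [l0, l1])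
  rw [one_mul] at e
  have k := χ.ev_sub_ev (φ := 1) (r := r) (loop hC) ((loop hC₁).concat (loop hC₂) (by rw [l0, l1]))
    (by rw [l0, concat_zero, l0]) (by rw [l1, concat_one, l1]) (by rw [l0, l1, one_smul]) (by
      have := hB.sub (hBZ (γ₁ 1))
      rw [sub_zero] at this
      convert this using 1
      rw [h0, h1, h12]
      abel)
  rw [e] at k
  simp only [hol]
  rw [← k]
  abel

lemma hol_const (x : M) : χ.hol ζ (fun _ => x) = 0 := by
  have hC : SegChain E (ext fun _ : unitInterval => x) 0 1 (Finsupp.single (fun _ => x) 1) := by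
    have := SegChain.single (E := E) (f := ext fun _ : unitInterval => x) zero_lt_one
      contMDiffOn_const
    rwa [seg_ext] at this
  have := χ.hol_of_bounds hζ hζ0 hζ1 (r := 0) hC hC hC rfl rfl rfl (by
    have := (Bounds.const (α := χ.curv.form) x).neg
    rw [neg_zero] at this
    convert this using 1
    abel)
  simpa using this

lemma hol_concat {γ₁ γ₂ : unitInterval → M} (h₁ : IsPiecewiseSmooth E γ₁)
    (h₂ : IsPiecewiseSmooth E γ₂) (h12 : γ₁ 1 = γ₂ 0) :
    χ.hol ζ (concat γ₁ γ₂) = χ.hol ζ γ₁ + χ.hol ζ γ₂ := by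
  obtain ⟨C₁, hC₁⟩ := h₁.exists_segChain
  obtain ⟨C₂, hC₂⟩ := h₂.exists_segChain
  have := χ.hol_of_bounds hζ hζ0 hζ1 (r := 0) (hC₁.concat hC₂ h12) hC₁ hC₂ (concat_zero _ _) h12
    (concat_one _ _) (by
      have := Bounds.zero (α := χ.curv.form)
      convert this using 1
      abel)
  simpa using this

lemma hol_reverse {γ : unitInterval → M} (h : IsPiecewiseSmooth E γ) :
    χ.hol ζ (reverse γ) = -χ.hol ζ γ := by
  obtain ⟨C, hC⟩ := h.exists_segChain
  obtain ⟨C', hC', hB⟩ := hC.exists_reverse χ.curv.form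
  have hc : SegChain E (ext fun _ : unitInterval => γ 0) 0 1 (Finsupp.single (fun _ => γ 0) 1) := by
    have := SegChain.single (E := E) (f := ext fun _ : unitInterval => γ 0) zero_lt_one
      contMDiffOn_const
    rwa [seg_ext] at this
  have := χ.hol_of_bounds hζ hζ0 hζ1 (r := 0) hc hC hC' rfl (reverse_zero _).symm
    (reverse_one _).symm (by
      have := (Bounds.const (α := χ.curv.form) (γ 0)).sub hB
      rw [sub_zero] at this
      convert this using 1
      abel)
  rw [χ.hol_const hζ hζ0 hζ1] at this
  rw [eq_neg_iff_add_eq_zero, add_comm]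
  simpa using this.symm

lemma hol_split {f : ℝ → M} {a b c : ℝ} (hab : a ≤ b) (hbc : b ≤ c) (hac : a < c)
    (hf : PiecewiseSmoothOn E f a c) :
    χ.hol ζ (seg f a c) = χ.hol ζ (seg f a b) + χ.hol ζ (seg f b c) := by
  have hcon : ∀ a, seg f a a = fun _ => f a := fun a => by
    funext s
    simp only [seg]
    congr 1
    ring
  rcases hab.eq_or_lt with rfl | hab
  · rw [hcon, χ.hol_const hζ hζ0 hζ1, zero_add]
  rcases hbc.eq_or_lt with rfl | hbc
  · rw [hcon, χ.hol_const hζ hζ0 hζ1, add_zero]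
  obtain ⟨C₁, hC₁⟩ := (hf.mono le_rfl hbc.le).exists_segChain hab
  obtain ⟨C₂, hC₂⟩ := (hf.mono hab.le le_rfl).exists_segChain hbc
  have := χ.hol_of_bounds hζ hζ0 hζ1 (r := 0) (hC₁.trans hC₂).ext_seg hC₁.ext_seg hC₂.ext_seg
    (by rw [seg_zero, seg_zero]) (by rw [seg_zero, seg_one]) (by rw [seg_one, seg_one]) (by
      have := Bounds.zero (α := χ.curv.form)
      convert this using 1
      abel)
  simpa using this

lemma hol_simplex {σ : ℝ × ℝ → M} (hσ : ContMDiffOn 𝓘(ℝ, ℝ × ℝ) 𝓘(ℝ, E) ∞ σ triangle) :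
    χ.hol ζ (fun s => σ (1 - (s : ℝ), (s : ℝ))) - χ.hol ζ (fun s => σ (0, (s : ℝ)))
      + χ.hol ζ (fun s => σ ((s : ℝ), 0)) =
      ((integralSimplex χ.curv.form σ : ℝ) : UnitAddCircle) := by
  have edge : ∀ {u v w z : ℝ}, Set.MapsTo (fun s : ℝ => (u + s * v, w + s * z)) (Set.Icc 0 1)
      triangle → SegChain E (ext fun s : unitInterval => σ (u + (s : ℝ) * v, w + (s : ℝ) * z)) 0 1
        (Finsupp.single (fun s : unitInterval => σ (u + (s : ℝ) * v, w + (s : ℝ) * z)) 1) := by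
    intro u v w z hm
    have hs : SmoothOn E (fun s : ℝ => σ (u + s * v, w + s * z)) 0 1 :=
      hσ.comp (ContDiff.contMDiff (𝕜 := ℝ) (n := ∞)
        (f := fun s : ℝ => (u + s * v, w + s * z)) (by fun_prop)).contMDiffOn hm
    have h1 : (fun s : unitInterval => σ (u + (s : ℝ) * v, w + (s : ℝ) * z)) =
        seg (fun s : ℝ => σ (u + s * v, w + s * z)) 0 1 := by
      funext s
      simp [seg]
    rw [h1]
    exact (SegChain.single zero_lt_one hs).ext_seg
  have h12 := edge (u := 1) (v := -1) (w := 0) (z := 1) fun s hs => by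
    refine ⟨?_, ?_, ?_⟩ <;> simp only <;> linarith [hs.1, hs.2]
  have h02 := edge (u := 0) (v := 0) (w := 0) (z := 1) fun s hs => by
    refine ⟨?_, ?_, ?_⟩ <;> simp only <;> linarith [hs.1, hs.2]
  have h01 := edge (u := 0) (v := 1) (w := 0) (z := 0) fun s hs => by
    refine ⟨?_, ?_, ?_⟩ <;> simp only <;> linarith [hs.1, hs.2]
  simp only [mul_neg, mul_one, ← sub_eq_add_neg, zero_add, mul_zero, add_zero] at h12 h02 h01
  have := χ.hol_of_bounds hζ hζ0 hζ1 (r := -integralSimplex χ.curv.form σ) h02 h01 h12 (by simp)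
    (by simp) (by simp) (by
      convert (Bounds.simplex (α := χ.curv.form) hσ).neg using 1
      simp only [simplexBoundary]
      abel)
  rw [this, AddCircle.coe_neg]
  abel

end Hol

lemma ev_conj {φ : G} {γ ζ : unitInterval → M} (hγ : IsPiecewiseSmooth E γ)
    (hζ : IsPiecewiseSmooth E ζ) (h : γ 1 = φ • γ 0) (h0 : ζ 0 = γ 0)
    (hφ : ContMDiff 𝓘(ℝ, E) 𝓘(ℝ, E) ∞ (fun x : M => φ • x)) :
    χ.ev φ (concat (concat (reverse ζ) γ) (fun t => φ • ζ t)) = χ.ev φ γ := by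
  have hφζ : IsPiecewiseSmooth E (fun t => φ • ζ t) := hζ.comp_left hφ
  have hm : (φ, concat (concat (reverse ζ) γ) (fun t => φ • ζ t)) ∈ EquivariantCurves G E M :=
    ⟨(hζ.reverse.concat hγ (by rw [reverse_one, h0])).concat hφζ (by rw [concat_one, h, h0]), by
      change concat (concat (reverse ζ) γ) (fun t => φ • ζ t) 1 =
        φ • concat (concat (reverse ζ) γ) (fun t => φ • ζ t) 0
      rw [concat_one, concat_zero, concat_zero, reverse_zero]⟩
  have := χ.map_conj ⟨(φ, γ), hγ, h⟩ ⟨_, hm⟩ ζ hζ h0 rfl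
  rwa [← ev_eq, ← ev_eq] at this

section Hol

variable {x₀ : M} {ζ : M → unitInterval → M} (hζ : ∀ x, IsPiecewiseSmooth E (ζ x))
  (hζ0 : ∀ x, ζ x 0 = x₀) (hζ1 : ∀ x, ζ x 1 = x)

include hζ hζ1 in
lemma hol_loop {γ : unitInterval → M} (hγ : IsPiecewiseSmooth E γ) (h : γ 1 = γ 0) :
    χ.hol ζ γ = χ.ev 1 γ := by
  have := χ.ev_conj (φ := 1) hγ (hζ (γ 0)).reverse (by rwa [one_smul])
    (by rw [reverse_zero, hζ1]) (by simp only [one_smul]; exact contMDiff_id)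
  simp only [reverse_reverse, one_smul] at this
  rw [← this, hol, h]

variable (ζ) in
/-- The difference between `χ` and `hol`. -/
def trans (φ : G) (x : M) : UnitAddCircle :=
  χ.ev φ (concat (reverse (ζ x)) (ζ (φ • x))) - χ.hol ζ (concat (reverse (ζ x)) (ζ (φ • x)))

include hζ hζ0 hζ1

lemma ev_eq_hol_add_trans {φ : G} {γ : unitInterval → M} (hγ : IsPiecewiseSmooth E γ)
    (h : γ 1 = φ • γ 0) : χ.ev φ γ = χ.hol ζ γ + χ.trans ζ φ (γ 0) := by
  set η := concat (reverse (ζ (γ 0))) (ζ (φ • γ 0)) with hη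
  have hηs : IsPiecewiseSmooth E η :=
    (hζ _).reverse.concat (hζ _) (by rw [reverse_one, hζ0, hζ0])
  have η0 : η 0 = γ 0 := by rw [hη, concat_zero, reverse_zero, hζ1]
  have η1 : η 1 = γ 1 := by rw [hη, concat_one, hζ1, h]
  have hr : reverse η 1 = φ⁻¹ • reverse η 0 := by
    rw [reverse_one, reverse_zero, η0, η1, h, inv_smul_smul]
  have e1 := χ.ev_concat hγ hηs.reverse h hr (by rw [reverse_zero, η1])
  have e2 := χ.ev_concat hηs hηs.reverse (by rw [η1, η0, h]) hr (by rw [reverse_zero])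
  have e3 := χ.hol_concat hζ hζ0 hζ1 hγ hηs.reverse (by rw [reverse_zero, η1])
  rw [χ.hol_reverse hζ hζ0 hζ1 hηs, χ.hol_loop hζ hζ1
    (hγ.concat hηs.reverse (by rw [reverse_zero, η1]))
    (by rw [concat_one, concat_zero, reverse_one, η0])] at e3
  obtain ⟨C, hC⟩ := hηs.exists_segChain
  obtain ⟨C', hC', hB⟩ := hC.exists_reverse χ.curv.form
  rw [inv_mul_cancel] at e1 e2
  rw [χ.ev_bounds (hC.concat hC' (by rw [reverse_zero]))
    (by rw [concat_one, concat_zero, reverse_one]) hB] at e2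
  rw [e1] at e3
  have e4 : χ.ev φ⁻¹ (reverse η) = -χ.ev φ η := by
    rw [eq_neg_iff_add_eq_zero, ← e2, AddCircle.coe_zero]
  rw [e4] at e3
  rw [trans, ← hη]
  have : χ.ev φ γ = (-χ.ev φ η + χ.ev φ γ) + χ.ev φ η := by abel
  rw [this, e3]
  abel

lemma trans_mul (φ' φ : G) (x : M) :
    χ.trans ζ (φ' * φ) x = χ.trans ζ φ' (φ • x) + χ.trans ζ φ x := by
  have conn : ∀ x y, ∃ γ : unitInterval → M, IsPiecewiseSmooth E γ ∧ γ 0 = x ∧ γ 1 = y :=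
    fun x y => ⟨concat (reverse (ζ x)) (ζ y),
      (hζ _).reverse.concat (hζ _) (by rw [reverse_one, hζ0, hζ0]),
      by rw [concat_zero, reverse_zero, hζ1], by rw [concat_one, hζ1]⟩
  obtain ⟨γ, hγ, hγ0, hγ1⟩ := conn x (φ • x)
  obtain ⟨γ', hγ', hγ0', hγ1'⟩ := conn (φ • x) (φ' • φ • x)
  have hc : γ 1 = γ' 0 := by rw [hγ1, hγ0']
  have e := χ.ev_concat hγ hγ' (by rw [hγ0, hγ1]) (by rw [hγ0', hγ1']) hc
  rw [χ.ev_eq_hol_add_trans hζ hζ0 hζ1 (hγ.concat hγ' hc)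
      (by rw [concat_one, concat_zero, hγ0, hγ1', mul_smul]),
    χ.ev_eq_hol_add_trans hζ hζ0 hζ1 hγ (by rw [hγ0, hγ1]),
    χ.ev_eq_hol_add_trans hζ hζ0 hζ1 hγ' (by rw [hγ0', hγ1']),
    χ.hol_concat hζ hζ0 hζ1 hγ hγ' hc, concat_zero, hγ0, hγ0'] at e
  have : χ.trans ζ (φ' * φ) x = (χ.hol ζ γ + χ.hol ζ γ' + χ.trans ζ (φ' * φ) x)
    - χ.hol ζ γ - χ.hol ζ γ' := by abel
  rw [this, e]
  abel

lemma hol_smul {φ : G} {γ : unitInterval → M} (hγ : IsPiecewiseSmooth E γ)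
    (hφ : ContMDiff 𝓘(ℝ, E) 𝓘(ℝ, E) ∞ (fun x : M => φ • x)) :
    χ.hol ζ (fun s => φ • γ s) = χ.hol ζ γ + χ.trans ζ φ (γ 0) - χ.trans ζ φ (γ 1) := by
  have hφγ : IsPiecewiseSmooth E (fun t => φ • γ t) := hγ.comp_left hφ
  obtain ⟨η, hη, hη0, hη1⟩ :
      ∃ η : unitInterval → M, IsPiecewiseSmooth E η ∧ η 0 = γ 0 ∧ η 1 = φ • γ 0 :=
    ⟨concat (reverse (ζ (γ 0))) (ζ (φ • γ 0)),
      (hζ _).reverse.concat (hζ _) (by rw [reverse_one, hζ0, hζ0]),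
      by rw [concat_zero, reverse_zero, hζ1], by rw [concat_one, hζ1]⟩
  have hr : reverse γ 1 = η 0 := by rw [reverse_one, hη0]
  have hr' : concat (reverse γ) η 1 = φ • γ 0 := by rw [concat_one, hη1]
  have e := χ.ev_conj hη hγ (by rw [hη0, hη1]) hη0.symm hφ
  rw [χ.ev_eq_hol_add_trans hζ hζ0 hζ1 hη (by rw [hη0, hη1]),
    χ.ev_eq_hol_add_trans hζ hζ0 hζ1 ((hγ.reverse.concat hη hr).concat hφγ hr')
      (by rw [concat_one, concat_zero, concat_zero, reverse_zero]),
    χ.hol_concat hζ hζ0 hζ1 (hγ.reverse.concat hη hr) hφγ hr',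
    χ.hol_concat hζ hζ0 hζ1 hγ.reverse hη hr, χ.hol_reverse hζ hζ0 hζ1 hγ, concat_zero,
    concat_zero, reverse_zero, hη0] at e
  have : χ.hol ζ (fun s => φ • γ s) = (-χ.hol ζ γ + χ.hol ζ η + χ.hol ζ (fun s => φ • γ s) +
    χ.trans ζ φ (γ 1)) + χ.hol ζ γ - χ.hol ζ η - χ.trans ζ φ (γ 1) := by abel
  rw [this, e]
  abel

end Hol

/-- On a piecewise smoothly connected manifold, every character has a trivialization. -/
lemma exists_holonomyData
    (hφ : ∀ φ : G, ContMDiff 𝓘(ℝ, E) 𝓘(ℝ, E) ∞ (fun x : M => φ • x)) (x₀ : M)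
    (hconn : ∀ x : M, ∃ γ : unitInterval → M, IsPiecewiseSmooth E γ ∧ γ 0 = x₀ ∧ γ 1 = x) :
    ∃ T : HolonomyData G E M, T.form = χ.curv.form ∧
      ∀ (φ : G) (γ : unitInterval → M), IsPiecewiseSmooth E γ → γ 1 = φ • γ 0 →
        χ.ev φ γ = T.hol γ + T.trans φ (γ 0) := by
  choose ζ hζ hζ0 hζ1 using hconn
  exact ⟨{
    hol := χ.hol ζ
    trans := χ.trans ζ
    form := χ.curv.form
    hol_split := fun f a b c hab hbc hac hf => χ.hol_split hζ hζ0 hζ1 hab hbc hac hf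
    hol_const := χ.hol_const hζ hζ0 hζ1
    hol_reverse := fun γ hγ => χ.hol_reverse hζ hζ0 hζ1 hγ
    hol_simplex := fun σ hσ => χ.hol_simplex hζ hζ0 hζ1 hσ
    hol_smul := fun φ γ hγ => χ.hol_smul hζ hζ0 hζ1 hγ (hφ φ)
    trans_mul := χ.trans_mul hζ hζ0 hζ1 }, rfl,
    fun φ γ hγ h => χ.ev_eq_hol_add_trans hζ hζ0 hζ1 hγ h⟩

end EquivariantDifferentialCharacter

section Connected

variable {E M : Type*} [NormedAddCommGroup E] [NormedSpace ℝ E] [TopologicalSpace M]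
  [ChartedSpace E M] [IsManifold 𝓘(ℝ, E) ∞ M]

/-- A point has a neighbourhood of points joined to it by smooth curves. -/
lemma eventually_exists_isPiecewiseSmooth (x : M) :
    ∀ᶠ y in nhds x, ∃ γ : unitInterval → M, IsPiecewiseSmooth E γ ∧ γ 0 = x ∧ γ 1 = y := by
  obtain ⟨r, hr, hball⟩ := Metric.isOpen_iff.1 (isOpen_extChartAt_target (I := 𝓘(ℝ, E)) x)
    (extChartAt 𝓘(ℝ, E) x x) (mem_extChartAt_target x)
  filter_upwards [extChartAt_source_mem_nhds (I := 𝓘(ℝ, E)) x,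
    (continuousAt_extChartAt (I := 𝓘(ℝ, E)) x).preimage_mem_nhds (Metric.ball_mem_nhds _ hr)]
    with y hy hyr
  set c := extChartAt 𝓘(ℝ, E) x
  have hmem : ∀ s ∈ Set.Icc (0 : ℝ) 1, c x + s • (c y - c x) ∈ c.target := fun s hs =>
    hball ((convex_ball (c x) r).add_smul_sub_mem (Metric.mem_ball_self hr) hyr hs)
  have hs : SmoothOn E (fun s : ℝ => c.symm (c x + s • (c y - c x))) 0 1 :=
    (contMDiffOn_extChartAt_symm x).comp (ContDiff.contMDiff (𝕜 := ℝ) (n := ∞)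
      (f := fun s : ℝ => c x + s • (c y - c x)) (by fun_prop)).contMDiffOn hmem
  refine ⟨_, hs.piecewiseSmoothOn.seg (a := 0) (b := 1) (by simp) (by simp), ?_, ?_⟩
  · rw [seg_zero]
    simpa using c.left_inv (mem_extChartAt_source x)
  · rw [seg_one]
    simpa using c.left_inv hy

lemma exists_isPiecewiseSmooth [ConnectedSpace M] (x y : M) :
    ∃ γ : unitInterval → M, IsPiecewiseSmooth E γ ∧ γ 0 = x ∧ γ 1 = y := by
  let S : Set M := {y | ∃ γ : unitInterval → M, IsPiecewiseSmooth E γ ∧ γ 0 = x ∧ γ 1 = y}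
  have hS : IsClopen S := by
    constructor
    · rw [isClosed_iff_frequently]
      intro y hy
      obtain ⟨z, ⟨γ, hγ, hγ0, hγ1⟩, δ, hδ, hδ0, hδ1⟩ :=
        (hy.and_eventually (eventually_exists_isPiecewiseSmooth (E := E) y)).exists
      exact ⟨concat γ (reverse δ), hγ.concat hδ.reverse (by rw [reverse_zero, hγ1, hδ1]),
        by rw [concat_zero, hγ0], by rw [concat_one, reverse_one, hδ0]⟩
    · rw [isOpen_iff_eventually]
      rintro y ⟨γ, hγ, hγ0, hγ1⟩
      filter_upwards [eventually_exists_isPiecewiseSmooth (E := E) y] with z ⟨δ, hδ, hδ0, hδ1⟩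
      exact ⟨concat γ δ, hγ.concat hδ (by rw [hγ1, hδ0]), by rw [concat_zero, hγ0],
        by rw [concat_one, hδ1]⟩
  have : S = Set.univ := hS.eq_univ ⟨x, fun _ => x, IsPiecewiseSmooth.const x, rfl, rfl⟩
  have hy : y ∈ S := this ▸ Set.mem_univ y
  exact hy

end Connected

end

section

lemma PiecewiseSmoothOn.comp_left_of_mapsTo {E E' M M' : Type*} [NormedAddCommGroup E]
    [NormedSpace ℝ E] [TopologicalSpace M] [ChartedSpace E M] [NormedAddCommGroup E']
    [NormedSpace ℝ E'] [TopologicalSpace M'] [ChartedSpace E' M'] {φ : M → M'} {U : Set M}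
    {f : ℝ → M} {a b : ℝ} (hφ : ContMDiffOn 𝓘(ℝ, E) 𝓘(ℝ, E') ∞ φ U)
    (h : PiecewiseSmoothOn E f a b) (hU : Set.MapsTo f (Set.Icc a b) U) :
    PiecewiseSmoothOn E' (φ ∘ f) a b := by
  obtain ⟨S, hS⟩ := h
  exact ⟨S, fun x y hx hxy hy hd => hφ.comp (hS x y hx hxy hy hd) fun z hz =>
    hU ⟨hx.trans hz.1, hz.2.trans hy⟩⟩

/-- A local section `σ` of the bundle `π` over `U`, and the map `k : π⁻¹(U) → H` that compares points
with the section. -/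
structure LocalSection {G EH H E M EB B : Type*} [Group G]
    [NormedAddCommGroup EH] [NormedSpace ℝ EH] [TopologicalSpace H] [ChartedSpace EH H] [Group H]
    [NormedAddCommGroup E] [NormedSpace ℝ E] [TopologicalSpace M] [ChartedSpace E M]
    [MulAction G M]
    [NormedAddCommGroup EB] [NormedSpace ℝ EB] [TopologicalSpace B] [ChartedSpace EB B]
    (ι : H →* G) (π : M → B) (U : Set B) (σ : B → M) (k : M → H) : Prop where
  isOpen : IsOpen U
  smooth_section : ContMDiffOn 𝓘(ℝ, EB) 𝓘(ℝ, E) ∞ σ U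
  smooth_fiber : ContMDiffOn 𝓘(ℝ, E) 𝓘(ℝ, EH) ∞ k (π ⁻¹' U)
  proj_section : ∀ b ∈ U, π (σ b) = b
  smul_section : ∀ x, π x ∈ U → ι (k x) • σ (π x) = x
  fiber_smul : ∀ (h : H) (x : M), π x ∈ U → k (ι h • x) = h * k x

namespace IsPrincipalBundle

variable {G EH H E M EB B : Type*} [Group G]
    [NormedAddCommGroup EH] [NormedSpace ℝ EH] [TopologicalSpace H] [ChartedSpace EH H] [Group H]
    [NormedAddCommGroup E] [NormedSpace ℝ E] [TopologicalSpace M] [ChartedSpace E M]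
    [MulAction G M]
    [NormedAddCommGroup EB] [NormedSpace ℝ EB] [TopologicalSpace B] [ChartedSpace EB B]
    {ι : H →* G} {π : M → B}

lemma exists_localSection (hπ : IsPrincipalBundle (EH := EH) (E := E) (EB := EB) ι π) (b : B) :
    ∃ U σ k, b ∈ U ∧ LocalSection (EH := EH) (E := E) (EB := EB) ι π U σ k := by
  obtain ⟨U, e, hU, hb, hs, ht, h1, h2⟩ := hπ.locally_trivial b
  have hinv : ∀ b ∈ U, ∀ h : H, e.symm (b, h) ∈ e.source ∧ e (e.symm (b, h)) = (b, h) :=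
    fun b hb h => by
      have hm : (b, h) ∈ e.target := by rw [ht]; exact ⟨hb, trivial⟩
      exact ⟨e.toPartialEquiv.map_target hm, e.toPartialEquiv.right_inv hm⟩
  refine ⟨U, fun b => e.symm (b, 1), fun x => (e x).2, hb, hU, ?_, ?_, ?_, ?_, ?_⟩
  · exact e.symm.contMDiffOn_toFun.comp (s := U)
      ((contMDiff_id.prodMk contMDiff_const).contMDiffOn) fun b hb => by
        change (b, 1) ∈ e.target
        rw [ht]; exact ⟨hb, trivial⟩
  · rw [← hs]
    exact contMDiff_snd.comp_contMDiffOn e.contMDiffOn_toFun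
  · intro b hb
    obtain ⟨hm, he⟩ := hinv b hb 1
    rw [← h1 _ hm, he]
  · intro x hx
    have hxs : x ∈ e.source := by rw [hs]; exact hx
    obtain ⟨hm, he⟩ := hinv (π x) hx 1
    have hm' : ι (e x).2 • e.symm (π x, 1) ∈ e.source := by
      rw [hs, Set.mem_preimage, hπ.invariant, ← h1 _ hm, he]
      exact hx
    refine e.toPartialEquiv.injOn hm' hxs (Prod.ext ?_ ?_)
    · refine (h1 _ hm').trans ?_
      rw [hπ.invariant, ← h1 _ hm, he]
      exact (h1 _ hxs).symm
    · refine (h2 _ hm _).trans ?_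
      rw [he, mul_one]
  · intro h x hx
    exact h2 x (by rw [hs]; exact hx) h

variable (hπ : IsPrincipalBundle (EH := EH) (E := E) (EB := EB) ι π)

include hπ

lemma surjective : Function.Surjective π := fun b => by
  obtain ⟨U, σ, k, hb, h⟩ := hπ.exists_localSection b
  exact ⟨σ b, h.proj_section b hb⟩

lemma exists_smul_eq {x x' : M} (h : π x = π x') : ∃ g : H, x' = ι g • x := by
  obtain ⟨U, σ, k, hb, hs⟩ := hπ.exists_localSection (π x)
  refine ⟨k x' * (k x)⁻¹, ?_⟩
  have h1 := hs.smul_section x hb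
  have h2 := hs.smul_section x' (h ▸ hb)
  rw [map_mul, map_inv, mul_smul, ← h2, inv_smul_eq_iff.2 h1.symm, h2, h]
  exact h2.symm

lemma eq_one_of_smul_eq {x : M} {g : H} (h : ι g • x = x) : g = 1 := by
  obtain ⟨U, σ, k, hb, hs⟩ := hπ.exists_localSection (π x)
  have := hs.fiber_smul g x hb
  rw [h] at this
  exact (mul_eq_right.1 this.symm)

section Smooth

variable [LieGroup 𝓘(ℝ, EH) ∞ H]

/-- Two smooth curves with the same projection differ by a smooth curve in the structure group. -/
lemma exists_smooth_smul_eq {f f' : ℝ → M} {a b : ℝ} (hf : SmoothOn E f a b)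
    (hf' : SmoothOn E f' a b) (h : ∀ t ∈ Set.Icc a b, π (f t) = π (f' t)) :
    ∃ g : ℝ → H, SmoothOn EH g a b ∧ ∀ t ∈ Set.Icc a b, f' t = ι (g t) • f t := by
  have hex : ∀ t, ∃ g : H, t ∈ Set.Icc a b → f' t = ι g • f t := fun t => by
    by_cases ht : t ∈ Set.Icc a b
    · obtain ⟨g, hg⟩ := hπ.exists_smul_eq (h t ht)
      exact ⟨g, fun _ => hg⟩
    · exact ⟨1, fun h => absurd h ht⟩
  choose g hg using hex
  refine ⟨g, fun t ht => ?_, hg⟩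
  obtain ⟨U, σ, k, hb, hs⟩ := hπ.exists_localSection (π (f t))
  have hopen : IsOpen (π ⁻¹' U) := hs.isOpen.preimage hπ.smooth.continuous
  have h1 : ContMDiffWithinAt 𝓘(ℝ, ℝ) 𝓘(ℝ, EH) ∞ (k ∘ f) (Set.Icc a b) t :=
    ((hs.smooth_fiber _ hb).contMDiffAt (hopen.mem_nhds hb)).comp_contMDiffWithinAt t (hf t ht)
  have hb' : f' t ∈ π ⁻¹' U := by rw [Set.mem_preimage, ← h t ht]; exact hb
  have h2 : ContMDiffWithinAt 𝓘(ℝ, ℝ) 𝓘(ℝ, EH) ∞ (k ∘ f') (Set.Icc a b) t :=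
    ((hs.smooth_fiber _ hb').contMDiffAt (hopen.mem_nhds hb')).comp_contMDiffWithinAt t (hf' t ht)
  have key : ∀ s ∈ Set.Icc a b, f s ∈ π ⁻¹' U → g s = k (f' s) * (k (f s))⁻¹ := fun s hs' hsU => by
    rw [hg s hs', hs.fiber_smul _ _ hsU, mul_inv_cancel_right]
  refine (h2.mul h1.inv).congr_of_eventuallyEq ?_ (key t ht hb)
  filter_upwards [self_mem_nhdsWithin,
    (hf.continuousOn t ht).preimage_mem_nhdsWithin (hopen.mem_nhds hb)] with s hs1 hs2
  exact key s hs1 hs2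

end Smooth

/-- Piecewise smooth curves lift to the total space. -/
lemma exists_lift (hφ : ∀ φ : G, ContMDiff 𝓘(ℝ, E) 𝓘(ℝ, E) ∞ (fun x : M => φ • x))
    {c : ℝ → B} {a b : ℝ} (hab : a < b) (hc : PiecewiseSmoothOn EB c a b) {x : M} (hx : π x = c a) :
    ∃ f : ℝ → M, PiecewiseSmoothOn E f a b ∧ f a = x ∧ ∀ t ∈ Set.Icc a b, π (f t) = c t := by
  choose U σ k hU hs using hπ.exists_localSection
  have hcont := continuousOn_iff_continuous_domRestrict.1 (hc.continuousOn hab)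
  obtain ⟨t, ht0, htm, ⟨n, hn⟩, hsub⟩ := exists_monotone_Icc_subset_open_cover_Icc hab.le
    (c := fun i : B => (Set.Icc a b).domRestrict c ⁻¹' (U i))
    (fun i => (hs i).isOpen.preimage hcont)
    (fun s _ => Set.mem_iUnion.2 ⟨c s, hU (c s)⟩)
  suffices H : ∀ m, ∃ f : ℝ → M, PiecewiseSmoothOn E f a (t m) ∧ f a = x ∧
      ∀ s ∈ Set.Icc a (t m : ℝ), π (f s) = c s by
    have := H n
    rwa [hn n le_rfl] at this
  intro m
  induction m with
  | zero =>
    refine ⟨fun _ => x, PiecewiseSmoothOn.const x, rfl, fun s hs => ?_⟩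
    rw [ht0] at hs
    rw [hx, le_antisymm hs.2 hs.1]
  | succ m ih =>
    obtain ⟨f, hf, hfa, hfc⟩ := ih
    obtain ⟨i, hi⟩ := hsub m
    have hle : (t m : ℝ) ≤ t (m + 1) := htm (Nat.le_succ m)
    have hat : a ≤ t m := (t m).2.1
    have hiU : Set.MapsTo c (Set.Icc (t m : ℝ) (t (m + 1))) (U i) := fun s hs' =>
      hi (a := ⟨s, hat.trans hs'.1, hs'.2.trans (t (m + 1)).2.2⟩) ⟨hs'.1, hs'.2⟩
    have hm : (t m : ℝ) ∈ Set.Icc (t m : ℝ) (t (m + 1)) := ⟨le_rfl, hle⟩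
    obtain ⟨g, hg⟩ := hπ.exists_smul_eq (x := σ i (c (t m))) (x' := f (t m)) (by
      rw [(hs i).proj_section _ (hiU hm), hfc _ ⟨hat, le_rfl⟩])
    set f₂ : ℝ → M := fun s => ι g • σ i (c s) with hf₂
    have hf₂s : PiecewiseSmoothOn E f₂ (t m) (t (m + 1)) :=
      ((hφ (ι g)).comp_contMDiffOn (hs i).smooth_section |> fun h =>
        PiecewiseSmoothOn.comp_left_of_mapsTo h (hc.mono hat (t (m + 1)).2.2) hiU)
    have e1 : Set.EqOn f (fun s => if s ≤ t m then f s else f₂ s) (Set.Icc a (t m)) :=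
      fun s hs => (if_pos hs.2).symm
    have e2 : Set.EqOn f₂ (fun s => if s ≤ t m then f s else f₂ s) (Set.Icc (t m) (t (m + 1))) := by
      intro s hs
      rcases hs.1.eq_or_lt with rfl | hlt
      · simp only [le_refl, if_true]
        exact hg.symm
      · exact (if_neg (not_le.2 hlt)).symm
    refine ⟨fun s => if s ≤ t m then f s else f₂ s, (hf.congr e1).trans (hf₂s.congr e2), ?_, ?_⟩
    · rw [← e1 ⟨le_rfl, hat⟩, hfa]
    · intro s hs'
      rcases le_total s (t m) with hle | hle
      · rw [← e1 ⟨hs'.1, hle⟩, hfc s ⟨hs'.1, hle⟩]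
      · rw [← e2 ⟨hle, hs'.2⟩, hf₂]
        simp only
        rw [hπ.invariant, (hs i).proj_section _ (hiU ⟨hle, hs'.2⟩)]

end IsPrincipalBundle

end

section

section PullbackSmooth

variable {E F : Type*} [NormedAddCommGroup E] [NormedSpace ℝ E] [NormedAddCommGroup F]
  [NormedSpace ℝ F]

/-- An alternating form of degree 2 as a bilinear form. -/
def toBilin (E : Type*) [NormedAddCommGroup E] [NormedSpace ℝ E] :
    (E [⋀^Fin 2]→L[ℝ] ℝ) →L[ℝ] E →L[ℝ] E →L[ℝ] ℝ :=
  (ContinuousLinearMap.compL ℝ E (E [⋀^Fin 1]→L[ℝ] ℝ) (E →L[ℝ] ℝ)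
    (ContinuousAlternatingMap.ofSubsingletonLIE (𝕜 := ℝ) (E := E) (F := ℝ)
      (0 : Fin 1)).symm.toContinuousLinearEquiv.toContinuousLinearMap).comp
    (ContinuousAlternatingMap.curryLeftLI (𝕜 := ℝ) (E := E) (F := ℝ) (n := 1)).toContinuousLinearMap

lemma toBilin_apply (α : E [⋀^Fin 2]→L[ℝ] ℝ) (v w : E) : toBilin E α v w = α ![v, w] := by
  change α (Matrix.vecCons v fun _ => w) = α ![v, w]
  congr 1
  ext i
  fin_cases i <;> rfl

/-- The antisymmetrization of a bilinear form. -/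
def antisymm (E : Type*) [NormedAddCommGroup E] [NormedSpace ℝ E] :
    (E →L[ℝ] E →L[ℝ] ℝ) →L[ℝ] (E [⋀^Fin 2]→L[ℝ] ℝ) :=
  (ContinuousAlternatingMap.alternatizeUncurryFinCLM ℝ E ℝ).comp
    (ContinuousLinearMap.compL ℝ E (E →L[ℝ] ℝ) (E [⋀^Fin 1]→L[ℝ] ℝ)
      (ContinuousAlternatingMap.ofSubsingletonLIE (𝕜 := ℝ) (E := E) (F := ℝ)
        (0 : Fin 1)).toContinuousLinearEquiv.toContinuousLinearMap)

lemma antisymm_apply (b : E →L[ℝ] E →L[ℝ] ℝ) (v : Fin 2 → E) :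
    antisymm E b v = b (v 0) (v 1) - b (v 1) (v 0) := by
  change ContinuousAlternatingMap.alternatizeUncurryFin _ v = _
  rw [ContinuousAlternatingMap.alternatizeUncurryFin_apply, Fin.sum_univ_two]
  simp only [Fin.val_zero, pow_zero, one_smul, Fin.val_one, pow_one, neg_smul, sub_eq_add_neg]
  rfl

lemma vec_two_eq {V : Type*} (v : Fin 2 → V) : v = ![v 0, v 1] := by
  ext i
  fin_cases i <;> rfl

lemma compContinuousLinearMap_eq (α : F [⋀^Fin 2]→L[ℝ] ℝ) (L : E →L[ℝ] F) :
    α.compContinuousLinearMap L = (1 / 2 : ℝ) • antisymm E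
      (((ContinuousLinearMap.compL ℝ E F ℝ).flip L).comp ((toBilin F α).comp L)) := by
  ext v
  rw [ContinuousAlternatingMap.smul_apply, antisymm_apply]
  change α (L ∘ v) = (1 / 2 : ℝ) • (toBilin F α (L (v 0)) (L (v 1)) -
    toBilin F α (L (v 1)) (L (v 0)))
  rw [toBilin_apply, toBilin_apply, alternating_swap α (L (v 1)), vec_two_eq (L ∘ v)]
  simp only [Function.comp_apply, smul_eq_mul]
  ring

lemma contDiffAt_compContinuousLinearMap {V : Type*} [NormedAddCommGroup V] [NormedSpace ℝ V]
    {A : V → F [⋀^Fin 2]→L[ℝ] ℝ} {L : V → E →L[ℝ] F} {x : V} {n : ℕ∞}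
    (hA : ContDiffAt ℝ n A x) (hL : ContDiffAt ℝ n L x) :
    ContDiffAt ℝ n (fun y => (A y).compContinuousLinearMap (L y)) x := by
  have h₁ : ContDiff ℝ n (antisymm E) := ContinuousLinearMap.contDiff (𝕜 := ℝ)
    (E := E →L[ℝ] E →L[ℝ] ℝ) (F := E [⋀^Fin 2]→L[ℝ] ℝ) (antisymm E)
  have h₂ : ContDiff ℝ n (toBilin F) := ContinuousLinearMap.contDiff (𝕜 := ℝ)
    (E := F [⋀^Fin 2]→L[ℝ] ℝ) (F := F →L[ℝ] F →L[ℝ] ℝ) (toBilin F)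
  simp only [compContinuousLinearMap_eq]
  refine ContDiffAt.const_smul (1 / 2 : ℝ) (h₁.contDiffAt.comp x ?_)
  exact (((ContinuousLinearMap.compL ℝ E F ℝ).flip).contDiff.contDiffAt.comp x hL).clm_comp
    ((h₂.contDiffAt.comp x hA).clm_comp hL)

end PullbackSmooth

section Pullback

variable {E M EB B : Type*} [NormedAddCommGroup E] [NormedSpace ℝ E]
    [TopologicalSpace M] [ChartedSpace E M] [IsManifold 𝓘(ℝ, E) ∞ M]
    [NormedAddCommGroup EB] [NormedSpace ℝ EB]
    [TopologicalSpace B] [ChartedSpace EB B] [IsManifold 𝓘(ℝ, EB) ∞ B]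

/-- The expression in charts of the pull-back of a 2-form by a smooth map. -/
lemma inChart_pullback {α : TwoFormField E M} {β : TwoFormField EB B} {F : B → M} {U : Set B}
    (hU : IsOpen U) (hF : ContMDiffOn 𝓘(ℝ, EB) 𝓘(ℝ, E) ∞ F U)
    (hβ : ∀ b ∈ U, β.val b = (α.val (F b)).compContinuousLinearMap (tderiv EB E F b))
    (b₀ : B) {y : EB} (hy : y ∈ (extChartAt 𝓘(ℝ, EB) b₀).target)
    (hyU : (extChartAt 𝓘(ℝ, EB) b₀).symm y ∈ U) :
    ∃ (x₁ : M) (f : EB → E), ContDiffAt ℝ ∞ f y ∧ f y ∈ (extChartAt 𝓘(ℝ, E) x₁).target ∧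
      inChart β b₀ =ᶠ[nhds y]
        fun y' => (inChart α x₁ (f y')).compContinuousLinearMap (fderiv ℝ f y') := by
  set c := extChartAt 𝓘(ℝ, EB) b₀ with hc
  set x₁ := F (c.symm y) with hx₁
  set d := extChartAt 𝓘(ℝ, E) x₁ with hd
  have hcs : ContMDiffOn 𝓘(ℝ, EB) 𝓘(ℝ, EB) ∞ c.symm c.target := contMDiffOn_extChartAt_symm b₀
  have hco : IsOpen c.target := isOpen_extChartAt_target b₀
  set V : Set EB := c.target ∩ c.symm ⁻¹' (U ∩ F ⁻¹' d.source) with hV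
  have hds : IsOpen d.source := isOpen_extChartAt_source x₁
  have hVo : IsOpen V := hcs.continuousOn.isOpen_inter_preimage hco
    (hF.continuousOn.isOpen_inter_preimage hU hds)
  have hyV : y ∈ V := ⟨hy, hyU, mem_extChartAt_source x₁⟩
  have h1 : ∀ y' ∈ V, ContMDiffAt 𝓘(ℝ, EB) 𝓘(ℝ, EB) ∞ c.symm y' := fun y' h =>
    (hcs y' h.1).contMDiffAt (hco.mem_nhds h.1)
  have h2 : ∀ y' ∈ V, ContMDiffAt 𝓘(ℝ, EB) 𝓘(ℝ, E) ∞ F (c.symm y') := fun y' h =>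
    (hF _ h.2.1).contMDiffAt (hU.mem_nhds h.2.1)
  have hdc : ∀ y' ∈ V, F (c.symm y') ∈ (chartAt E x₁).source := fun y' h => by
    have h' : F (c.symm y') ∈ d.source := h.2.2
    rwa [hd, extChartAt_source] at h'
  have h3 : ∀ y' ∈ V, ContMDiffAt 𝓘(ℝ, E) 𝓘(ℝ, E) ∞ d (F (c.symm y')) := fun y' h =>
    (contMDiffOn_extChartAt (x := x₁) _ (hdc y' h)).contMDiffAt
      ((chartAt E x₁).open_source.mem_nhds (hdc y' h))
  have hdt : ∀ y' ∈ V, d (F (c.symm y')) ∈ d.target := fun y' h => d.map_source h.2.2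
  have h4 : ∀ y' ∈ V, ContMDiffAt 𝓘(ℝ, E) 𝓘(ℝ, E) ∞ d.symm (d (F (c.symm y'))) := fun y' h =>
    (contMDiffOn_extChartAt_symm x₁ _ (hdt y' h)).contMDiffAt
      ((isOpen_extChartAt_target x₁).mem_nhds (hdt y' h))
  have hf : ∀ y' ∈ V, ContMDiffAt 𝓘(ℝ, EB) 𝓘(ℝ, E) ∞ (fun y => d (F (c.symm y))) y' :=
    fun y' h => (h3 y' h).comp y' ((h2 y' h).comp y' (h1 y' h))
  refine ⟨x₁, fun y => d (F (c.symm y)), (hf y hyV).contDiffAt, hdt y hyV, ?_⟩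
  filter_upwards [hVo.mem_nhds hyV] with y' hy'
  have e1 : tderiv EB E (d.symm ∘ fun y => d (F (c.symm y))) y' =
      (tderiv E E d.symm (d (F (c.symm y')))).comp (tderiv EB E (fun y => d (F (c.symm y))) y') :=
    tderiv_comp ((h4 y' hy').mdifferentiableAt (by simp)) ((hf y' hy').mdifferentiableAt (by simp))
  have e2 : tderiv EB E (F ∘ c.symm) y' =
      (tderiv EB E F (c.symm y')).comp (tderiv EB EB c.symm y') :=
    tderiv_comp ((h2 y' hy').mdifferentiableAt (by simp)) ((h1 y' hy').mdifferentiableAt (by simp))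
  have e3 : tderiv EB E (d.symm ∘ fun y => d (F (c.symm y))) y' = tderiv EB E (F ∘ c.symm) y' := by
    refine tderiv_congr ?_
    filter_upwards [hVo.mem_nhds hy'] with z hz
    exact d.left_inv hz.2.2
  rw [inChart_eq, inChart_eq, ← hc, ← hd, hβ _ hy'.2.1, d.left_inv hy'.2.2, ← tderiv_eq_fderiv]
  ext v
  simp only [ContinuousAlternatingMap.compContinuousLinearMap_apply]
  congr 1
  funext i
  exact (DFunLike.congr_fun (e2.symm.trans (e3.symm.trans e1)) (v i))

/-- A form that is locally a pull-back of a smooth closed form is smooth and closed. -/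
lemma isSmoothForm_isClosedForm_of_pullback {α : TwoFormField E M} {β : TwoFormField EB B}
    (hα : IsSmoothForm α) (hα' : IsClosedForm α)
    (h : ∀ b : B, ∃ U, IsOpen U ∧ b ∈ U ∧ ∃ F : B → M, ContMDiffOn 𝓘(ℝ, EB) 𝓘(ℝ, E) ∞ F U ∧
      ∀ b ∈ U, β.val b = (α.val (F b)).compContinuousLinearMap (tderiv EB E F b)) :
    IsSmoothForm β ∧ IsClosedForm β := by
  have key : ∀ (b₀ : B) (y : EB), y ∈ (extChartAt 𝓘(ℝ, EB) b₀).target →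
      ContDiffAt ℝ ∞ (inChart β b₀) y ∧ extDeriv (inChart β b₀) y = 0 := by
    intro b₀ y hy
    obtain ⟨U, hU, hbU, F, hF, hβ⟩ := h ((extChartAt 𝓘(ℝ, EB) b₀).symm y)
    obtain ⟨x₁, f, hf, hfy, heq⟩ := inChart_pullback hU hF hβ b₀ hy hbU
    have hA : ContDiffAt ℝ ∞ (inChart α x₁) (f y) :=
      (hα x₁ _ hfy).contDiffAt ((isOpen_extChartAt_target x₁).mem_nhds hfy)
    refine ⟨(contDiffAt_compContinuousLinearMap (n := ⊤) (hA.comp y hf)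
      (hf.fderiv_right (by simp))).congr_of_eventuallyEq heq, ?_⟩
    rw [heq.extDeriv_eq, extDeriv_pullback (r := ∞) (hA.differentiableAt (by simp)) hf
      (by simp only [minSmoothness_of_isRCLikeNormedField]; exact ENat.LEInfty.out), hα' x₁ _ hfy]
    ext v
    rfl
  exact ⟨fun b₀ y hy => (key b₀ y hy).1.contDiffWithinAt, fun b₀ y hy => (key b₀ y hy).2⟩

end Pullback

end

section

set_option linter.unusedSectionVars false

section

variable (EG : Type*) {G : Type*} (E : Type*) {M : Type*} [NormedAddCommGroup EG]
    [NormedSpace ℝ EG] [TopologicalSpace G] [ChartedSpace EG G] [Group G]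
    [NormedAddCommGroup E] [NormedSpace ℝ E] [TopologicalSpace M] [ChartedSpace E M]
    [MulAction G M] [ContMDiffSMul 𝓘(ℝ, EG) 𝓘(ℝ, E) ∞ G M]

include EG in
lemma contMDiff_smul_right (φ : G) : ContMDiff 𝓘(ℝ, E) 𝓘(ℝ, E) ∞ (fun x : M => φ • x) :=
  (contMDiff_smul (I := 𝓘(ℝ, EG)) (I' := 𝓘(ℝ, E)) (n := ∞)).comp
    (contMDiff_const.prodMk contMDiff_id)

lemma contMDiff_smul_left (x : M) : ContMDiff 𝓘(ℝ, EG) 𝓘(ℝ, E) ∞ (fun g : G => g • x) :=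
  (contMDiff_smul (I := 𝓘(ℝ, EG)) (I' := 𝓘(ℝ, E)) (n := ∞)).comp
    (contMDiff_id.prodMk contMDiff_const)

end

section Descent

variable {EG G EH H E M EB B : Type*}
    [NormedAddCommGroup EG] [NormedSpace ℝ EG] [TopologicalSpace G] [ChartedSpace EG G] [Group G]
    [NormedAddCommGroup EH] [NormedSpace ℝ EH] [TopologicalSpace H] [ChartedSpace EH H] [Group H]
    [LieGroup 𝓘(ℝ, EH) ∞ H]
    [NormedAddCommGroup E] [NormedSpace ℝ E] [TopologicalSpace M] [ChartedSpace E M]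
    [IsManifold 𝓘(ℝ, E) ∞ M]
    [MulAction G M] [ContMDiffSMul 𝓘(ℝ, EG) 𝓘(ℝ, E) ∞ G M]
    [NormedAddCommGroup EB] [NormedSpace ℝ EB] [TopologicalSpace B] [ChartedSpace EB B]
    [IsManifold 𝓘(ℝ, EB) ∞ B]
    {ι : H →* G} {π : M → B}

variable (hι : ContMDiff 𝓘(ℝ, EH) 𝓘(ℝ, EG) ∞ ι)

include hι

variable (E M) in
/-- The action of `H` through `ι` is smooth. -/
lemma contMDiff_hom_smul :
    ContMDiff (𝓘(ℝ, EH).prod 𝓘(ℝ, E)) 𝓘(ℝ, E) ∞ (fun p : H × M => ι p.1 • p.2) :=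
  (contMDiff_smul (I := 𝓘(ℝ, EG)) (I' := 𝓘(ℝ, E)) (n := ∞)).comp
    ((hι.comp contMDiff_fst).prodMk contMDiff_snd)

lemma contMDiff_hom_smul_left (x : M) :
    ContMDiff 𝓘(ℝ, EH) 𝓘(ℝ, E) ∞ (fun h : H => ι h • x) :=
  (contMDiff_smul_left EG E x).comp hι

lemma tderiv_orbit (x : M) (Y : GroupLieAlgebra 𝓘(ℝ, EH) H) :
    (tderiv EH E (fun h : H => ι h • x) 1 Y : E) =
      -(fundamentalField (lieMap ι Y : GroupLieAlgebra 𝓘(ℝ, EG) G) x : E) := by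
  have h := tderiv_comp (g := fun g : G => g • x) (f := ι) (x := (1 : H))
    ((contMDiff_smul_left EG E x).mdifferentiableAt (by simp)) (hι.mdifferentiableAt (by simp))
  rw [map_one] at h
  refine (DFunLike.congr_fun h Y).trans ?_
  exact (neg_neg (tderiv EG E (fun g : G => g • x) 1 (tderiv EH EG ι 1 Y))).symm

variable {ϖ : EquivariantTwoForm EG G E M} (hϖ : ϖ.IsClosed)
    (hμ : ∀ (Y : GroupLieAlgebra 𝓘(ℝ, EH) H) (x : M), ϖ.moment x (lieMap ι Y) = 0)

include hϖ hμ

lemma val_orbit_one (x : M) (Y : EH) (v : E) :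
    ϖ.form.val x ![tderiv EH E (fun h : H => ι h • x) 1 Y, v] = 0 := by
  have h1 := hϖ.2 (lieMap ι (Y : GroupLieAlgebra 𝓘(ℝ, EH) H)) x v
  have h2 : (fun y : M => ϖ.moment y (lieMap ι (Y : GroupLieAlgebra 𝓘(ℝ, EH) H))) =
      fun _ => (0 : ℝ) := funext fun y => hμ Y y
  rw [h2] at h1
  have h3 : ϖ.form.val x ![(fundamentalField (lieMap ι (Y : GroupLieAlgebra 𝓘(ℝ, EH) H) :
      GroupLieAlgebra 𝓘(ℝ, EG) G) x : E), v] = 0 := by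
    refine Eq.trans h1 ?_
    exact DFunLike.congr_fun (tderiv_const (E := E) (E' := ℝ) (0 : ℝ) x) v
  obtain ⟨F, hF0, hF⟩ : ∃ F : E, ϖ.form.val x ![F, v] = 0 ∧
      tderiv EH E (fun h : H => ι h • x) 1 Y = -F := ⟨_, h3, tderiv_orbit hι x Y⟩
  rw [hF, ← neg_one_smul ℝ F, alternating_smul_left, hF0, mul_zero]

lemma val_orbit (h₀ : H) (y : M) (w : EH) (v : E) :
    ϖ.form.val (ι h₀ • y) ![tderiv EH E (fun h : H => ι h • y) h₀ w, v] = 0 := by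
  have hm : MDifferentiableAt 𝓘(ℝ, EH) 𝓘(ℝ, EH) (fun h : H => h * h₀⁻¹) h₀ :=
    (contMDiff_id.mul contMDiff_const).mdifferentiableAt (n := ∞) (by simp)
  have h := tderiv_comp (g := fun h : H => ι h • ι h₀ • y) (f := fun h : H => h * h₀⁻¹) (x := h₀)
    ((contMDiff_hom_smul_left (E := E) hι _).mdifferentiableAt (by simp)) hm
  have e : (fun h : H => ι h • ι h₀ • y) ∘ (fun h : H => h * h₀⁻¹) = fun h => ι h • y := by
    funext h
    simp [← mul_smul, ← map_mul]
  rw [e, mul_inv_cancel] at h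
  rw [h]
  exact val_orbit_one hι hϖ hμ _ _ _

variable {U : Set B} {σ : B → M} {k : M → H}
    (hπ : IsPrincipalBundle (EH := EH) (E := E) (EB := EB) ι π)
    (hs : LocalSection (EH := EH) (E := E) (EB := EB) ι π U σ k)

include hπ hs

/-- If the moment vanishes on the Lie algebra of `H`, then the form is the pull-back of its
restriction to a local section. -/
lemma val_eq_section {x : M} (hx : π x ∈ U) (v w : E) :
    ϖ.form.val x ![v, w] = ϖ.form.val (σ (π x))
      ![tderiv EB E σ (π x) (tderiv E EB π x v), tderiv EB E σ (π x) (tderiv E EB π x w)] := by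
  have hUo : IsOpen (π ⁻¹' U) := hs.isOpen.preimage hπ.smooth.continuous
  have hk : MDifferentiableAt 𝓘(ℝ, E) 𝓘(ℝ, EH) k x :=
    ((hs.smooth_fiber x hx).contMDiffAt (hUo.mem_nhds hx)).mdifferentiableAt (by simp)
  have hσ : MDifferentiableAt 𝓘(ℝ, EB) 𝓘(ℝ, E) σ (π x) :=
    ((hs.smooth_section _ hx).contMDiffAt (hs.isOpen.mem_nhds hx)).mdifferentiableAt (by simp)
  have hπx : MDifferentiableAt 𝓘(ℝ, E) 𝓘(ℝ, EB) π x := hπ.smooth.mdifferentiableAt (by simp)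
  have dec : ∀ v : E, v = tderiv EH E (fun h : H => ι h • σ (π x)) (k x) (tderiv E EH k x v) +
      tderiv E E (fun y : M => ι (k x) • y) (σ (π x))
        (tderiv EB E σ (π x) (tderiv E EB π x v)) := by
    intro v
    have h1 := tderiv_prod (Φ := fun p : H × M => ι p.1 • p.2) (f := k) (g := σ ∘ π) (x := x)
      ((contMDiff_hom_smul E M hι).mdifferentiableAt (by simp)) hk (hσ.comp x hπx) v
    rw [tderiv_comp hσ hπx] at h1
    refine Eq.trans ?_ h1
    have h2 : (fun y => ι (k y) • (σ ∘ π) y) =ᶠ[nhds x] fun y => y := by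
      filter_upwards [hUo.mem_nhds hx] with y hy
      exact hs.smul_section y hy
    rw [tderiv_congr h2, tderiv_id]
    rfl
  have inv := ϖ.invariant_form (ι (k x)) (σ (π x))
    (tderiv EB E σ (π x) (tderiv E EB π x v)) (tderiv EB E σ (π x) (tderiv E EB π x w))
  have inv' : ϖ.form.val (ι (k x) • σ (π x))
      ![tderiv E E (fun y : M => ι (k x) • y) (σ (π x)) (tderiv EB E σ (π x) (tderiv E EB π x v)),
        tderiv E E (fun y : M => ι (k x) • y) (σ (π x)) (tderiv EB E σ (π x) (tderiv E EB π x w))] =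
      ϖ.form.val (σ (π x))
      ![tderiv EB E σ (π x) (tderiv E EB π x v), tderiv EB E σ (π x) (tderiv E EB π x w)] := inv
  have hval : ∀ v w : E, ϖ.form.val x ![v, w] = ϖ.form.val (ι (k x) • σ (π x)) ![v, w] := by
    intro v w
    rw [hs.smul_section x hx]
  rw [← inv', hval]
  conv_lhs => rw [dec v]
  rw [alternating_add_left, val_orbit hι hϖ hμ, zero_add]
  conv_lhs => rw [dec w]
  rw [alternating_add_right, alternating_swap _ _ (tderiv EH E _ _ _), val_orbit hι hϖ hμ, neg_zero,
    zero_add]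

omit hs

/-- If the moment vanishes on the Lie algebra of `H`, then the form descends to the base. -/
theorem exists_form_of_moment_eq_zero :
    ∃ β : TwoFormField EB B, IsSmoothForm β ∧ IsClosedForm β ∧
      ∀ (x : M) (v w : E),
        ϖ.form.val x ![v, w] = β.val (π x) ![tderiv E EB π x v, tderiv E EB π x w] := by
  choose U σ k hb hs using hπ.exists_localSection
  let β : TwoFormField EB B := fun b =>
    ((ϖ.form.val (σ b b)).compContinuousLinearMap (tderiv EB E (σ b) b) : EB [⋀^Fin 2]→L[ℝ] ℝ)
  have hβ : ∀ (x : M) (v w : E),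
      ϖ.form.val x ![v, w] = β.val (π x) ![tderiv E EB π x v, tderiv E EB π x w] := by
    intro x v w
    rw [val_eq_section hι hϖ hμ hπ (hs (π x)) (hb (π x))]
    change _ = ϖ.form.val (σ (π x) (π x)) (tderiv EB E (σ (π x)) (π x) ∘ _)
    rw [vec_two_eq (_ ∘ _)]
    rfl
  obtain ⟨h1, h2⟩ := isSmoothForm_isClosedForm_of_pullback (β := β) ϖ.smooth_form hϖ.1 fun b => by
    refine ⟨U b, (hs b).isOpen, hb b, σ b, (hs b).smooth_section, fun b' hb' => ?_⟩
    have hσ : MDifferentiableAt 𝓘(ℝ, EB) 𝓘(ℝ, E) (σ b) b' :=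
      (((hs b).smooth_section _ hb').contMDiffAt
        ((hs b).isOpen.mem_nhds hb')).mdifferentiableAt (by simp)
    have hd := tderiv_comp (g := π) (f := σ b) (x := b')
      (hπ.smooth.mdifferentiableAt (by simp)) hσ
    have hid : tderiv EB EB (π ∘ σ b) b' = ContinuousLinearMap.id ℝ EB := by
      rw [← tderiv_id b']
      refine tderiv_congr ?_
      filter_upwards [(hs b).isOpen.mem_nhds hb'] with z hz
      exact (hs b).proj_section z hz
    rw [hid] at hd
    have hd' : ∀ u, tderiv E EB π (σ b b') (tderiv EB E (σ b) b' u) = u := fun u =>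
      (DFunLike.congr_fun hd u).symm
    ext u
    change _ = ϖ.form.val (σ b b') (tderiv EB E (σ b) b' ∘ u)
    rw [vec_two_eq (_ ∘ u), vec_two_eq u]
    simp only [Function.comp_apply, Matrix.cons_val_zero, Matrix.cons_val_one]
    rw [hβ, hd', hd', (hs b).proj_section b' hb']
  exact ⟨β, h1, h2, hβ⟩

end Descent

/-- The integral of a pull-back form over a simplex is the integral over the image. -/
lemma integralSimplex_pullback {E M EB B : Type*} [NormedAddCommGroup E] [NormedSpace ℝ E]
    [TopologicalSpace M] [ChartedSpace E M] [NormedAddCommGroup EB] [NormedSpace ℝ EB]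
    [TopologicalSpace B] [ChartedSpace EB B] {π : M → B} (hπ : ContMDiff 𝓘(ℝ, E) 𝓘(ℝ, EB) ∞ π)
    {α : TwoFormField E M} {β : TwoFormField EB B}
    (h : ∀ (x : M) (v w : E),
      α.val x ![v, w] = β.val (π x) ![tderiv E EB π x v, tderiv E EB π x w])
    {σ : ℝ × ℝ → M} (hσ : ContMDiffOn 𝓘(ℝ, ℝ × ℝ) 𝓘(ℝ, E) ∞ σ triangle) :
    integralSimplex α σ = integralSimplex β (π ∘ σ) := by
  rw [integralSimplex_eq, integralSimplex_eq]
  refine MeasureTheory.setIntegral_congr_fun isCompact_triangle.measurableSet fun p hp => ?_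
  rw [h, tderiv_comp_tderivWithin (hπ.mdifferentiableAt (by simp))
    ((hσ p hp).mdifferentiableWithinAt (by simp)) (uniqueMDiffOn_triangle p hp)]
  rfl

end

section

/-! ### Flow lines of the constant-coefficient combinations of a frame -/

section Frame

set_option linter.unusedSectionVars false

open Set Metric

variable {F : Type*} [NormedAddCommGroup F] [NormedSpace ℝ F] [CompleteSpace F]

/-- `y` solves `y' = A(y) X` on `[-2, 2]`, starts at `y₀`, and stays in the ball of radius `ρ`. -/
def IsFlowLine (A : F → F →L[ℝ] F) (y₀ : F) (ρ : ℝ) (X : F) (y : ℝ → F) : Prop :=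
  y 0 = y₀ ∧ ∀ t ∈ Icc (-2 : ℝ) 2, y t ∈ closedBall y₀ ρ ∧
    HasDerivWithinAt y (A (y t) X) (Icc (-2) 2) t

/-- A frame which is close to the identity and Lipschitz on a ball. -/
structure IsFrameOn (A : F → F →L[ℝ] F) (y₀ : F) (r : ℝ) (K : NNReal) : Prop where
  pos : 0 < r
  norm_sub_le : ∀ y ∈ closedBall y₀ r, ‖A y - ContinuousLinearMap.id ℝ F‖ ≤ 1 / 4
  lipschitz : LipschitzOnWith K A (closedBall y₀ r)

theorem exists_isFrameOn {A : F → F →L[ℝ] F} {y₀ : F} (hA : ContDiffAt ℝ ∞ A y₀)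
    (h₀ : A y₀ = ContinuousLinearMap.id ℝ F) {V : Set F} (hV : V ∈ nhds y₀) :
    ∃ r K, IsFrameOn A y₀ r K ∧ closedBall y₀ r ⊆ V := by
  obtain ⟨K, t, ht, hK⟩ := (hA.of_le (m := 1) (by simp)).exists_lipschitzOnWith
  have h1 : {y | ‖A y - ContinuousLinearMap.id ℝ F‖ < 1 / 4} ∈ nhds y₀ := by
    have : ContinuousAt (fun y => ‖A y - ContinuousLinearMap.id ℝ F‖) y₀ :=
      (hA.continuousAt.sub continuousAt_const).norm
    exact this.preimage_mem_nhds (Iio_mem_nhds (by simp [h₀]))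
  obtain ⟨ε, hε, hsub⟩ := Metric.mem_nhds_iff.1 (Filter.inter_mem (Filter.inter_mem ht h1) hV)
  have hs := (closedBall_subset_ball (x := y₀) (half_lt_self hε)).trans hsub
  exact ⟨ε / 2, K, ⟨half_pos hε, fun y hy => le_of_lt (hs hy).1.2,
    hK.mono fun y hy => (hs hy).1.1⟩, fun y hy => (hs hy).2⟩

theorem IsFrameOn.exists_isFlowLine {A : F → F →L[ℝ] F} {y₀ : F} {r : ℝ} {K : NNReal}
    (h : IsFrameOn A y₀ r K) {ρ : ℝ} (hρr : ρ ≤ r) {X : F} (hX : 4 * ‖X‖ ≤ ρ) :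
    ∃ y, IsFlowLine A y₀ ρ X y := by
  have hρ : 0 ≤ ρ := by linarith [norm_nonneg X]
  lift ρ to NNReal using hρ
  have hsub : closedBall y₀ ρ ⊆ closedBall y₀ r := closedBall_subset_closedBall hρr
  have hb : ∀ x ∈ closedBall y₀ ρ, ‖A x X‖ ≤ 2 * ‖X‖ := fun x hx => by
    have h1 : ‖A x X - X‖ ≤ 1 / 4 * ‖X‖ :=
      (by simpa using (A x - ContinuousLinearMap.id ℝ F).le_opNorm X : ‖A x X - X‖ ≤ _).trans
        (mul_le_mul_of_nonneg_right (h.norm_sub_le x (hsub hx)) (norm_nonneg _))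
    have h2 := norm_sub_norm_le (A x X) X
    linarith [norm_nonneg X]
  have hl : LipschitzOnWith (K * ‖X‖₊) (fun x => A x X) (closedBall y₀ ρ) := by
    refine LipschitzOnWith.of_dist_le_mul fun x hx y hy => ?_
    rw [dist_eq_norm, ← sub_apply]
    refine ((A x - A y).le_opNorm X).trans ?_
    have := h.lipschitz.dist_le_mul x (hsub hx) y (hsub hy)
    rw [dist_eq_norm] at this
    calc _ ≤ (K * dist x y) * ‖X‖ := mul_le_mul_of_nonneg_right this (norm_nonneg _)
      _ = _ := by push_cast; ring
  let t₀ : Icc (-2 : ℝ) 2 := ⟨0, by norm_num, by norm_num⟩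
  have hPL : IsPicardLindelof (fun _ : ℝ => fun x => A x X) t₀ y₀ ρ 0 (2 * ‖X‖₊)
      (K * ‖X‖₊) := by
    refine IsPicardLindelof.of_time_independent hb hl ?_
    simp [t₀]
    linarith
  obtain ⟨α, hα⟩ := ODE.FunSpace.exists_isFixedPt_next hPL (x := y₀) (by simp)
  rw [ODE.FunSpace.isFixedPt_next_iff] at hα
  have hmem : ∀ t, α.compProj t ∈ closedBall y₀ ρ := fun t =>
    α.compProj_mem_closedBall hPL.mul_max_le
  refine ⟨α.compProj, ?_, fun t ht => ⟨hmem t, ?_⟩⟩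
  · have := hα t₀
    rw [ODE.picard_apply₀] at this
    exact (ODE.FunSpace.compProj_val (t := t₀)).trans this
  · have hd := ODE.hasDerivWithinAt_picard_Icc (f := fun _ : ℝ => fun x => A x X)
      (u := closedBall y₀ ρ) t₀.2 (hl.continuousOn.comp continuousOn_snd fun p hp => hp.2)
      α.continuous_compProj.continuousOn (fun t _ => hmem t) y₀ ht
    refine hd.congr (fun s hs => ?_) ?_
    · rw [ODE.FunSpace.compProj_of_mem hs, hα]
    · rw [ODE.FunSpace.compProj_of_mem ht, hα]

theorem IsFlowLine.contDiffOn {A : F → F →L[ℝ] F} {y₀ : F} {ρ : ℝ} {X : F} {y : ℝ → F}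
    (hA : ContDiffOn ℝ ∞ A (closedBall y₀ ρ)) (h : IsFlowLine A y₀ ρ X y) :
    ContDiffOn ℝ ∞ y (Icc (-2) 2) := by
  refine ODE.contDiffOn_enat_Icc_of_hasDerivWithinAt (f := fun _ : ℝ => fun x => A x X)
    (u := closedBall y₀ ρ) ?_ (fun t ht => (h.2 t ht).2) fun t ht => (h.2 t ht).1
  exact (hA.clm_apply contDiffOn_const).comp contDiffOn_snd fun p hp => hp.2

theorem IsFrameOn.norm_flowLine_sub_le {A : F → F →L[ℝ] F} {y₀ : F} {r : ℝ} {K : NNReal}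
    (h : IsFrameOn A y₀ r K) {X₁ X₂ : F} {y₁ y₂ : ℝ → F} (h₁ : IsFlowLine A y₀ r X₁ y₁)
    (h₂ : IsFlowLine A y₀ r X₂ y₂) (hX : K * ‖X₂‖ ≤ 1 / 8) :
    ‖y₁ 1 - y₂ 1 - (X₁ - X₂)‖ ≤ 1 / 2 * ‖X₁ - X₂‖ := by
  have hsub : Icc (0 : ℝ) 1 ⊆ Icc (-2) 2 := Icc_subset_Icc (by norm_num) (by norm_num)
  have hc : ContinuousOn (fun t => ‖y₁ t - y₂ t‖) (Icc 0 1) := fun t ht =>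
    (((h₁.2 t (hsub ht)).2.continuousWithinAt.sub
      (h₂.2 t (hsub ht)).2.continuousWithinAt).norm).mono hsub
  obtain ⟨t₀, ht₀, hmax⟩ := isCompact_Icc.exists_isMaxOn ⟨0, by norm_num⟩ hc
  set D := ‖y₁ t₀ - y₂ t₀‖ with hD
  set d := ‖X₁ - X₂‖ with hd
  have hw : ∀ t ∈ Icc (0 : ℝ) 1, ‖y₁ t - y₂ t - t • (X₁ - X₂)‖ ≤ (1 / 4 * d + 1 / 8 * D) * t := by
    have hder : ∀ t ∈ Icc (0 : ℝ) 1, HasDerivWithinAt (fun t => y₁ t - y₂ t - t • (X₁ - X₂))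
        (A (y₁ t) X₁ - A (y₂ t) X₂ - (1 : ℝ) • (X₁ - X₂)) (Icc 0 1) t := fun t ht =>
      (((h₁.2 t (hsub ht)).2.sub (h₂.2 t (hsub ht)).2).mono hsub).sub
        ((hasDerivWithinAt_id t _).smul_const _)
    have hbound : ∀ t ∈ Ico (0 : ℝ) 1,
        ‖A (y₁ t) X₁ - A (y₂ t) X₂ - (1 : ℝ) • (X₁ - X₂)‖ ≤ 1 / 4 * d + 1 / 8 * D := fun t ht => by
      have ht' := Ico_subset_Icc_self ht
      have e : A (y₁ t) X₁ - A (y₂ t) X₂ - (1 : ℝ) • (X₁ - X₂)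
          = (A (y₁ t) - ContinuousLinearMap.id ℝ F) (X₁ - X₂) + (A (y₁ t) - A (y₂ t)) X₂ := by
        simp; abel
      rw [e]
      refine (norm_add_le _ _).trans (add_le_add ?_ ?_)
      · exact (ContinuousLinearMap.le_opNorm _ _).trans (mul_le_mul_of_nonneg_right
          (h.norm_sub_le _ (h₁.2 t (hsub ht')).1) (norm_nonneg _))
      · have hl := h.lipschitz.dist_le_mul _ (h₁.2 t (hsub ht')).1 _ (h₂.2 t (hsub ht')).1
        rw [dist_eq_norm, dist_eq_norm] at hl
        have hm : ‖y₁ t - y₂ t‖ ≤ D := hmax ht'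
        calc _ ≤ ‖A (y₁ t) - A (y₂ t)‖ * ‖X₂‖ := ContinuousLinearMap.le_opNorm _ _
          _ ≤ (K * ‖y₁ t - y₂ t‖) * ‖X₂‖ := mul_le_mul_of_nonneg_right hl (norm_nonneg _)
          _ = (K * ‖X₂‖) * ‖y₁ t - y₂ t‖ := by ring
          _ ≤ 1 / 8 * D := mul_le_mul hX hm (norm_nonneg _) (by norm_num)
    intro t ht
    have := norm_image_sub_le_of_norm_deriv_le_segment' hder hbound t ht
    simpa [h₁.1, h₂.1] using this
  have hd0 : 0 ≤ d := norm_nonneg _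
  have hD0 : 0 ≤ D := norm_nonneg _
  have hDd : D ≤ 10 / 7 * d := by
    have h1 := hw t₀ ht₀
    have h2 := norm_sub_norm_le (y₁ t₀ - y₂ t₀) (t₀ • (X₁ - X₂))
    rw [norm_smul, Real.norm_of_nonneg ht₀.1] at h2
    have h3 : (1 / 4 * d + 1 / 8 * D) * t₀ ≤ 1 / 4 * d + 1 / 8 * D :=
      mul_le_of_le_one_right (by positivity) ht₀.2
    have h4 : t₀ * d ≤ d := mul_le_of_le_one_left hd0 ht₀.2
    linarith
  have := hw 1 (by norm_num)
  rw [one_smul] at this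
  linarith

theorem IsFrameOn.exists_flowLine_eq {A : F → F →L[ℝ] F} {y₀ : F} {r : ℝ} {K : NNReal}
    (h : IsFrameOn A y₀ r K) {ρ : ℝ} (hρ : 0 < ρ) (hρr : ρ ≤ r) :
    ∀ᶠ z in nhds y₀, ∃ X y, 4 * ‖X‖ ≤ ρ ∧ IsFlowLine A y₀ ρ X y ∧ y 1 = z := by
  set s : ℝ := min (ρ / 4) (1 / (8 * (K + 1))) with hs
  have hK : (0 : ℝ) ≤ K := K.2
  have hs0 : 0 < s := lt_min (by positivity) (by positivity)
  have hs1 : ∀ X ∈ closedBall (0 : F) s, 4 * ‖X‖ ≤ ρ := fun X hX => by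
    have : ‖X‖ ≤ s := by simpa using hX
    linarith [min_le_left (ρ / 4) (1 / (8 * ((K : ℝ) + 1)))]
  have hs2 : ∀ X ∈ closedBall (0 : F) s, K * ‖X‖ ≤ 1 / 8 := fun X hX => by
    have h1 : ‖X‖ ≤ 1 / (8 * ((K : ℝ) + 1)) := (by simpa using hX : ‖X‖ ≤ s).trans (min_le_right _ _)
    calc K * ‖X‖ ≤ K * (1 / (8 * ((K : ℝ) + 1))) := mul_le_mul_of_nonneg_left h1 hK
      _ ≤ 1 / 8 := by rw [mul_one_div, div_le_div_iff₀ (by positivity) (by norm_num)]; linarith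
  have hex : ∀ X : F, ∃ y, X ∈ closedBall (0 : F) s → IsFlowLine A y₀ ρ X y := fun X => by
    by_cases hX : X ∈ closedBall (0 : F) s
    · obtain ⟨y, hy⟩ := h.exists_isFlowLine hρr (hs1 X hX)
      exact ⟨y, fun _ => hy⟩
    · exact ⟨0, fun h => absurd h hX⟩
  choose y hy using hex
  have hmono : ∀ {X y}, IsFlowLine A y₀ ρ X y → IsFlowLine A y₀ r X y := fun hy =>
    ⟨hy.1, fun t ht => ⟨closedBall_subset_closedBall hρr (hy.2 t ht).1, (hy.2 t ht).2⟩⟩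
  have happ : ApproximatesLinearOn (fun X => y X 1) (ContinuousLinearMap.id ℝ F)
      (closedBall (0 : F) s) (1 / 2) := fun X₁ h₁ X₂ h₂ => by
    simpa using h.norm_flowLine_sub_le (hmono (hy X₁ h₁)) (hmono (hy X₂ h₂)) (hs2 X₂ h₂)
  let inv : (ContinuousLinearMap.id ℝ F).NonlinearRightInverse :=
    { toFun := id, nnnorm := 1, bound' := fun y => by simp, right_inv' := fun y => rfl }
  have hsurj := happ.surjOn_closedBall_of_nonlinearRightInverse inv hs0.le subset_rfl
  have h00 : (0 : F) ∈ closedBall (0 : F) s := mem_closedBall_self hs0.le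
  have hy0 : y 0 1 = y₀ := by
    have hc : IsFlowLine A y₀ ρ 0 fun _ => y₀ :=
      ⟨rfl, fun t _ => ⟨mem_closedBall_self hρ.le, by simpa using hasDerivWithinAt_const _ _ _⟩⟩
    have := h.norm_flowLine_sub_le (hmono (hy 0 h00)) (hmono hc) (by simp)
    simpa [sub_eq_zero] using this
  rw [hy0] at hsurj
  have hball : closedBall y₀ ((((inv.nnnorm : NNReal) : ℝ)⁻¹ - ((1 / 2 : NNReal) : ℝ)) * s)
      ∈ nhds y₀ := closedBall_mem_nhds _ (mul_pos (by simp [inv]; norm_num) hs0)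
  filter_upwards [hball] with z hz
  obtain ⟨X, hX, rfl⟩ := hsurj hz
  exact ⟨X, y X, hs1 X hX, hy X hX, rfl⟩

end Frame

end

section

/-! ### One-parameter subgroups -/

section OneParameter

set_option linter.unusedSectionVars false

open Set Metric

variable {EG G : Type*} [NormedAddCommGroup EG] [NormedSpace ℝ EG]
  [TopologicalSpace G] [ChartedSpace EG G] [Group G] [LieGroup 𝓘(ℝ, EG) ∞ G]

lemma hasMFDerivAt_curve_iff {E M : Type*} [NormedAddCommGroup E] [NormedSpace ℝ E]
    [TopologicalSpace M] [ChartedSpace E M] {γ : ℝ → M} {t : ℝ} {w : TangentSpace 𝓘(ℝ, E) (γ t)} :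
    HasMFDerivAt 𝓘(ℝ, ℝ) 𝓘(ℝ, E) γ t ((1 : ℝ →L[ℝ] ℝ).smulRight w) ↔
      MDifferentiableAt 𝓘(ℝ, ℝ) 𝓘(ℝ, E) γ t ∧ tderiv ℝ E γ t 1 = (w : E) := by
  constructor
  · intro h
    refine ⟨h.mdifferentiableAt, ?_⟩
    have : tderiv ℝ E γ t 1 = (1 : ℝ) • (w : E) := DFunLike.congr_fun h.mfderiv (1 : ℝ)
    rwa [one_smul] at this
  · rintro ⟨h, h'⟩
    have := h.hasMFDerivAt
    have e : tderiv ℝ E γ t = ((1 : ℝ →L[ℝ] ℝ).smulRight (w : E) : ℝ →L[ℝ] E) := by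
      ext
      rw [h']
      exact (one_smul ℝ (w : E)).symm
    exact e ▸ this

variable (EG G) in
/-- The chart at the identity. -/
abbrev oneChart : PartialEquiv G EG := extChartAt 𝓘(ℝ, EG) (1 : G)

variable (EG G) in
/-- The differential at the identity of left translation by `c⁻¹(y)`, in the chart `c` at the
identity. -/
def leftFrame (y : EG) : EG →L[ℝ] EG :=
  fderiv ℝ (fun z => oneChart EG G ((oneChart EG G).symm y * (oneChart EG G).symm z))
    (oneChart EG G 1)

lemma contMDiffAt_oneChart_symm {y : EG} (hy : y ∈ (oneChart EG G).target) :
    ContMDiffAt 𝓘(ℝ, EG) 𝓘(ℝ, EG) ∞ (oneChart EG G).symm y :=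
  have : IsManifold 𝓘(ℝ, EG) ∞ G := ContMDiffMul.toIsManifold
  (contMDiffOn_extChartAt_symm 1).contMDiffAt
    ((isOpen_extChartAt_target (1 : G)).mem_nhds hy)

lemma contMDiffAt_oneChart {g : G} (hg : g ∈ (oneChart EG G).source) :
    ContMDiffAt 𝓘(ℝ, EG) 𝓘(ℝ, EG) ∞ (oneChart EG G) g :=
  have : IsManifold 𝓘(ℝ, EG) ∞ G := ContMDiffMul.toIsManifold
  contMDiffAt_extChartAt' (by simpa using hg)

lemma oneChart_symm_one : (oneChart EG G).symm (oneChart EG G 1) = 1 := extChartAt_to_inv _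

lemma contMDiff_mul_left' (g : G) : ContMDiff 𝓘(ℝ, EG) 𝓘(ℝ, EG) ∞ (fun h : G => g * h) :=
  contMDiff_const.mul contMDiff_id

lemma contDiffAt_mul_oneChart {y : EG} (hy : y ∈ (oneChart EG G).target) :
    ContDiffAt ℝ ∞ (Function.uncurry fun y z =>
      oneChart EG G ((oneChart EG G).symm y * (oneChart EG G).symm z)) (y, oneChart EG G 1) := by
  rw [← contMDiffAt_iff_contDiffAt]
  have h1 : ContMDiffAt 𝓘(ℝ, EG × EG) 𝓘(ℝ, EG) ∞
      (fun p : EG × EG => (oneChart EG G).symm p.1) (y, oneChart EG G 1) :=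
    ContMDiffAt.comp (g := (oneChart EG G).symm) (y, oneChart EG G 1)
      (contMDiffAt_oneChart_symm hy) contDiff_fst.contMDiff.contMDiffAt
  have h2 : ContMDiffAt 𝓘(ℝ, EG × EG) 𝓘(ℝ, EG) ∞
      (fun p : EG × EG => (oneChart EG G).symm p.2) (y, oneChart EG G 1) :=
    ContMDiffAt.comp (g := (oneChart EG G).symm) (y, oneChart EG G 1)
      (contMDiffAt_oneChart_symm (mem_extChartAt_target _)) contDiff_snd.contMDiff.contMDiffAt
  refine ContMDiffAt.comp (g := oneChart EG G) (y, oneChart EG G 1) (contMDiffAt_oneChart ?_)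
    (h1.mul h2)
  simp only [oneChart_symm_one, mul_one]
  exact (oneChart EG G).map_target hy

lemma contDiffAt_leftFrame {y : EG} (hy : y ∈ (oneChart EG G).target) :
    ContDiffAt ℝ ∞ (leftFrame EG G) y :=
  ContDiffAt.fderiv (contDiffAt_mul_oneChart hy) contDiffAt_const (by simp)

lemma leftFrame_one : leftFrame EG G (oneChart EG G 1) = ContinuousLinearMap.id ℝ EG := by
  have : (fun z => oneChart EG G ((oneChart EG G).symm (oneChart EG G 1) *
      (oneChart EG G).symm z)) =ᶠ[nhds (oneChart EG G 1)] fun z => z := by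
    filter_upwards [(isOpen_extChartAt_target (1 : G)).mem_nhds (mem_extChartAt_target _)] with z hz
    rw [oneChart_symm_one, one_mul]
    exact (oneChart EG G).right_inv hz
  rw [leftFrame, this.fderiv_eq]
  exact fderiv_id

lemma tderiv_symm_leftFrame {y : EG} (hy : y ∈ (oneChart EG G).target) (X : EG) :
    tderiv EG EG (oneChart EG G).symm y (leftFrame EG G y X) =
      tderiv EG EG (fun h : G => (oneChart EG G).symm y * h) 1
        (tderiv EG EG (oneChart EG G).symm (oneChart EG G 1) X) := by
  set c := oneChart EG G
  set m : EG → EG := fun z => c (c.symm y * c.symm z)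
  have h0 : c 1 ∈ c.target := mem_extChartAt_target _
  have hms : c.symm y * c.symm (c 1) ∈ c.source := by
    rw [oneChart_symm_one, mul_one]; exact c.map_target hy
  have hsymm : MDifferentiableAt 𝓘(ℝ, EG) 𝓘(ℝ, EG) c.symm (c 1) :=
    (contMDiffAt_oneChart_symm h0).mdifferentiableAt (by simp)
  have hm1 : ContMDiffAt 𝓘(ℝ, EG) 𝓘(ℝ, EG) ∞ (fun z => c.symm y * c.symm z) (c 1) :=
    ((contMDiff_mul_left' (c.symm y)).contMDiffAt).comp (c 1) (contMDiffAt_oneChart_symm h0)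
  have hm : MDifferentiableAt 𝓘(ℝ, EG) 𝓘(ℝ, EG) m (c 1) :=
    (ContMDiffAt.comp (g := c) (c 1) (contMDiffAt_oneChart hms) hm1).mdifferentiableAt (by simp)
  have hmy : m (c 1) = y := by
    simp only [m, c, oneChart_symm_one, mul_one]; exact c.right_inv hy
  have e1 := tderiv_comp (g := c.symm) (f := m) (x := c 1)
    (by rw [hmy]; exact (contMDiffAt_oneChart_symm hy).mdifferentiableAt (by simp)) hm
  have e2 := tderiv_comp (g := fun h : G => c.symm y * h) (f := c.symm) (x := c 1)
    ((contMDiff_mul_left' (c.symm y)).mdifferentiableAt (by simp)) hsymm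
  have e3 : c.symm ∘ m =ᶠ[nhds (c 1)] (fun h : G => c.symm y * h) ∘ c.symm := by
    have : ∀ᶠ z in nhds (c 1), c.symm y * c.symm z ∈ c.source :=
      hm1.continuousAt.preimage_mem_nhds ((isOpen_extChartAt_source (1 : G)).mem_nhds hms)
    filter_upwards [this] with z hz
    exact c.left_inv hz
  rw [tderiv_congr e3, e2, hmy, oneChart_symm_one] at e1
  have := DFunLike.congr_fun e1 X
  rw [tderiv_eq_fderiv] at this
  exact this.symm

lemma IsOneParameterSubgroup.scale {γ : ℝ → G} {X : GroupLieAlgebra 𝓘(ℝ, EG) G}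
    (h : IsOneParameterSubgroup γ X) (a : ℝ) :
    IsOneParameterSubgroup (fun t => γ (a * t)) (a • X) where
  smooth := h.smooth.comp ((contDiff_const.mul contDiff_id).contMDiff)
  map_zero := by simp [h.map_zero]
  map_add s t := by rw [mul_add, h.map_add]
  velocity := by
    have h2 : HasDerivAt (fun t : ℝ => a * t) a 0 := by
      simpa using (hasDerivAt_id (0 : ℝ)).const_mul a
    have h1 := tderiv_comp (E := ℝ) (E' := ℝ) (E'' := EG) (g := γ) (f := fun t : ℝ => a * t)
      (x := (0 : ℝ)) (h.smooth.mdifferentiableAt (by simp))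
      h2.differentiableAt.mdifferentiableAt
    have h3 : tderiv ℝ ℝ (fun t : ℝ => a * t) 0 (1 : ℝ) = a • (1 : ℝ) := by
      rw [tderiv_eq_fderiv, fderiv_apply_one_eq_deriv, h2.deriv, smul_eq_mul, mul_one]
    have h4 : tderiv ℝ EG γ 0 1 = (X : EG) := h.velocity
    refine (DFunLike.congr_fun h1 (1 : ℝ)).trans ?_
    rw [ContinuousLinearMap.comp_apply, h3, map_smul, mul_zero, h4]
    rfl

variable [CompleteSpace EG] [T2Space G]

/-- A flow line of the left-invariant frame in the chart at the identity is part of a one-parameter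
subgroup. -/
theorem exists_isOneParameterSubgroup_of_flowLine {ρ : ℝ} {X : EG} {y : ℝ → EG}
    (hρ : closedBall (oneChart EG G 1) ρ ⊆ (oneChart EG G).target)
    (hy : IsFlowLine (leftFrame EG G) (oneChart EG G 1) ρ X y) :
    ∃ γ : ℝ → G, IsOneParameterSubgroup γ
        (tderiv EG EG (oneChart EG G).symm (oneChart EG G 1) X : GroupLieAlgebra 𝓘(ℝ, EG) G) ∧
      ∀ t ∈ Ioo (-2 : ℝ) 2, γ t = (oneChart EG G).symm (y t) := by
  have : LieGroup 𝓘(ℝ, EG) (minSmoothness ℝ 3) G :=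
    LieGroup.of_le (m := minSmoothness ℝ 3) (n := ∞) (by
      rw [minSmoothness_of_isRCLikeNormedField]; exact ENat.LEInfty.out)
  have : IsManifold 𝓘(ℝ, EG) ∞ G := ContMDiffMul.toIsManifold
  have : IsManifold 𝓘(ℝ, EG) 1 G := IsManifold.of_le (n := ∞) (by simp)
  set c := oneChart EG G
  let Z : GroupLieAlgebra 𝓘(ℝ, EG) G := tderiv EG EG c.symm (c 1) X
  have hv : ContMDiff 𝓘(ℝ, EG) 𝓘(ℝ, EG).tangent 1
      (fun g : G => (⟨g, mulInvariantVectorField Z g⟩ : TangentBundle 𝓘(ℝ, EG) G)) :=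
    (contMDiff_mulInvariantVectorField Z).of_le (by
      rw [minSmoothness_of_isRCLikeNormedField]; norm_num)
  have hIoo : Ioo (-2 : ℝ) 2 ⊆ Icc (-2) 2 := Ioo_subset_Icc_self
  have htar : ∀ t ∈ Ioo (-2 : ℝ) 2, y t ∈ c.target := fun t ht => hρ (hy.2 t (hIoo ht)).1
  have hder : ∀ t ∈ Ioo (-2 : ℝ) 2, HasDerivAt y (leftFrame EG G (y t) X) t := fun t ht =>
    (hy.2 t (hIoo ht)).2.hasDerivAt (Icc_mem_nhds ht.1 ht.2)
  have hysmooth : ∀ t ∈ Ioo (-2 : ℝ) 2, ContDiffAt ℝ ∞ y t := fun t ht =>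
    (hy.contDiffOn fun z hz => (contDiffAt_leftFrame (hρ hz)).contDiffWithinAt).contDiffAt
      (Icc_mem_nhds ht.1 ht.2)
  have hsmooth₀ : ∀ t ∈ Ioo (-2 : ℝ) 2, ContMDiffAt 𝓘(ℝ, ℝ) 𝓘(ℝ, EG) ∞ (c.symm ∘ y) t :=
    fun t ht => (contMDiffAt_oneChart_symm (htar t ht)).comp t (hysmooth t ht).contMDiffAt
  have hloc : ∀ g : G, IsMIntegralCurveOn (I := 𝓘(ℝ, EG)) (fun t => g * c.symm (y t))
      (mulInvariantVectorField Z) (Ioo (-2) 2) := by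
    intro g t ht
    refine HasMFDerivAt.hasMFDerivWithinAt (hasMFDerivAt_curve_iff.2 ⟨?_, ?_⟩)
    · exact (((contMDiff_mul_left' g).contMDiffAt).comp t (hsmooth₀ t ht)).mdifferentiableAt
        (by simp)
    · have e1 := tderiv_comp (g := fun h : G => g * h) (f := c.symm ∘ y) (x := t)
        ((contMDiff_mul_left' g).mdifferentiableAt (by simp))
        ((hsmooth₀ t ht).mdifferentiableAt (by simp))
      have e2 := tderiv_comp (g := c.symm) (f := y) (x := t)
        ((contMDiffAt_oneChart_symm (htar t ht)).mdifferentiableAt (by simp))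
        ((hysmooth t ht).contMDiffAt.mdifferentiableAt (by simp))
      have e3 : tderiv ℝ EG y t 1 = leftFrame EG G (y t) X := by
        rw [tderiv_eq_fderiv, fderiv_apply_one_eq_deriv, (hder t ht).deriv]
      have e4 := tderiv_comp (E := EG) (E' := EG) (E'' := EG) (g := fun h : G => g * h)
        (f := fun h : G => c.symm (y t) * h) (x := (1 : G))
        ((contMDiff_mul_left' g).mdifferentiableAt (by simp))
        ((contMDiff_mul_left' (c.symm (y t))).mdifferentiableAt (by simp))
      refine (DFunLike.congr_fun e1 (1 : ℝ)).trans ?_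
      rw [e2, ContinuousLinearMap.comp_apply, ContinuousLinearMap.comp_apply, e3,
        tderiv_symm_leftFrame (htar t ht)]
      have e5 : (fun h : G => g * h) ∘ (fun h : G => c.symm (y t) * h) =
          fun h : G => g * c.symm (y t) * h := funext fun h => (mul_assoc _ _ _).symm
      rw [e5, mul_one] at e4
      exact (DFunLike.congr_fun e4 _).symm
  have hy0 : c.symm (y 0) = 1 := by rw [hy.1, oneChart_symm_one]
  obtain ⟨γ, hγ0, hγ⟩ := exists_isMIntegralCurve_of_isMIntegralCurveOn hv two_pos
    (fun g => ⟨fun t => g * c.symm (y t), by simp [hy0], hloc g⟩) (1 : G)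
  have heq : ∀ t ∈ Ioo (-2 : ℝ) 2, γ t = c.symm (y t) := by
    have h1 := hloc 1
    simp only [one_mul] at h1
    exact isMIntegralCurveOn_Ioo_eqOn_of_contMDiff_boundaryless (t₀ := 0) (by norm_num) hv
      (hγ.isMIntegralCurveOn _) h1 (by rw [hγ0, hy0])
  have hmul : ∀ s t : ℝ, γ (s + t) = γ s * γ t := by
    intro s
    have h1 : IsMIntegralCurve (I := 𝓘(ℝ, EG)) (fun t => γ s * γ t)
        (mulInvariantVectorField Z) := by
      intro t
      obtain ⟨hd, hd'⟩ := hasMFDerivAt_curve_iff.1 (hγ t)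
      refine hasMFDerivAt_curve_iff.2 ⟨?_, ?_⟩
      · exact ((contMDiff_mul_left' (γ s)).mdifferentiableAt (by simp)).comp t hd
      · have e1 := tderiv_comp (g := fun h : G => γ s * h) (f := γ) (x := t)
          ((contMDiff_mul_left' (γ s)).mdifferentiableAt (by simp)) hd
        have e4 := tderiv_comp (E := EG) (E' := EG) (E'' := EG) (g := fun h : G => γ s * h)
          (f := fun h : G => γ t * h) (x := (1 : G))
          ((contMDiff_mul_left' (γ s)).mdifferentiableAt (by simp))
          ((contMDiff_mul_left' (γ t)).mdifferentiableAt (by simp))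
        have e5 : (fun h : G => γ s * h) ∘ (fun h : G => γ t * h) =
            fun h : G => γ s * γ t * h := funext fun h => (mul_assoc _ _ _).symm
        rw [e5, mul_one] at e4
        refine (DFunLike.congr_fun e1 (1 : ℝ)).trans ?_
        rw [ContinuousLinearMap.comp_apply, hd']
        exact (DFunLike.congr_fun e4 _).symm
    have h2 := isMIntegralCurve_Ioo_eq_of_contMDiff_boundaryless (t₀ := 0) hv h1 (hγ.comp_add s)
      (by simp [hγ0])
    intro t
    have := congrFun h2 t
    simp only [Function.comp_apply] at this
    rw [add_comm, this]
  have hs0 : ContMDiffAt 𝓘(ℝ, ℝ) 𝓘(ℝ, EG) ∞ γ 0 := by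
    refine (hsmooth₀ 0 (by norm_num)).congr_of_eventuallyEq ?_
    filter_upwards [Ioo_mem_nhds (by norm_num : (-2 : ℝ) < 0) (by norm_num : (0 : ℝ) < 2)]
      with t ht using heq t ht
  refine ⟨γ, ⟨fun t => ?_, hγ0, hmul, ?_⟩, heq⟩
  · have e : γ = (fun h : G => γ t * h) ∘ γ ∘ fun u : ℝ => u - t := by
      funext u
      simp [← hmul]
    rw [e]
    refine ((contMDiff_mul_left' (γ t)).contMDiffAt).comp t (ContMDiffAt.comp t ?_
      (contDiff_id.sub contDiff_const).contMDiff.contMDiffAt)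
    simpa using hs0
  · have := (hasMFDerivAt_curve_iff.1 (hγ 0)).2
    refine this.trans ?_
    have e : (fun h : G => γ 0 * h) = fun h => h := by simp [hγ0]
    change tderiv EG EG (fun h : G => γ 0 * h) 1 Z = Z
    rw [e, tderiv_id]
    rfl

variable (EG G) in
theorem exists_isFrameOn_leftFrame : ∃ r K, IsFrameOn (leftFrame EG G) (oneChart EG G 1) r K ∧
    closedBall (oneChart EG G 1) r ⊆ (oneChart EG G).target :=
  exists_isFrameOn (contDiffAt_leftFrame (mem_extChartAt_target _)) leftFrame_one
    ((isOpen_extChartAt_target (1 : G)).mem_nhds (mem_extChartAt_target _))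

theorem exists_isOneParameterSubgroup (X : GroupLieAlgebra 𝓘(ℝ, EG) G) :
    ∃ γ : ℝ → G, IsOneParameterSubgroup γ X := by
  obtain ⟨r, K, hF, hr⟩ := exists_isFrameOn_leftFrame EG G
  set c := oneChart EG G
  set X' : EG := tderiv EG EG c 1 X with hX'
  obtain ⟨a, ha, haX⟩ : ∃ a : ℝ, 0 < a ∧ 4 * ‖a • X'‖ ≤ r := by
    refine ⟨r / (4 * (‖X'‖ + 1)), div_pos hF.pos (by positivity), ?_⟩
    rw [norm_smul, Real.norm_of_nonneg (div_nonneg hF.pos.le (by positivity))]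
    have h1 : ‖X'‖ / (‖X'‖ + 1) ≤ 1 := by
      rw [div_le_one (by positivity)]; linarith
    have e : 4 * (r / (4 * (‖X'‖ + 1)) * ‖X'‖) = r * (‖X'‖ / (‖X'‖ + 1)) := by
      field_simp
    rw [e]
    exact mul_le_of_le_one_right hF.pos.le h1
  obtain ⟨y, hy⟩ := hF.exists_isFlowLine le_rfl haX
  obtain ⟨γ, hγ, -⟩ := exists_isOneParameterSubgroup_of_flowLine hr hy
  have e : (tderiv EG EG c.symm (c 1) X' : EG) = X := by
    have h1 := tderiv_comp (E := EG) (E' := EG) (E'' := EG) (g := c.symm) (f := c) (x := (1 : G))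
      ((contMDiffAt_oneChart_symm (mem_extChartAt_target _)).mdifferentiableAt (by simp))
      ((contMDiffAt_oneChart (mem_extChartAt_source _)).mdifferentiableAt (by simp))
    have h2 : c.symm ∘ c =ᶠ[nhds (1 : G)] fun g => g := by
      filter_upwards [(isOpen_extChartAt_source (I := 𝓘(ℝ, EG)) (1 : G)).mem_nhds
        (mem_extChartAt_source _)] with g hg using c.left_inv hg
    rw [tderiv_congr h2, tderiv_id] at h1
    exact (DFunLike.congr_fun h1 X).symm
  rw [map_smul, e] at hγ
  have h := hγ.scale a⁻¹
  have e2 : a⁻¹ • a • X = X := inv_smul_smul₀ ha.ne' (X : EG)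
  exact ⟨_, e2 ▸ h⟩

variable (EG) in
/-- The exponential map is locally onto. -/
theorem eventually_exists_isOneParameterSubgroup {N : Set G} (hN : N ∈ nhds (1 : G)) :
    ∀ᶠ g in nhds (1 : G), ∃ (X : GroupLieAlgebra 𝓘(ℝ, EG) G) (γ : ℝ → G),
      IsOneParameterSubgroup γ X ∧ γ 1 = g ∧ ∀ t ∈ Icc (0 : ℝ) 1, γ t ∈ N := by
  obtain ⟨r, K, hF, hr⟩ := exists_isFrameOn_leftFrame EG G
  set c := oneChart EG G
  have hN' : c.symm ⁻¹' N ∈ nhds (c 1) :=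
    (continuousAt_extChartAt_symm (1 : G)).preimage_mem_nhds (by
      rw [oneChart_symm_one]; exact hN)
  obtain ⟨ε, hε, hεN⟩ := Metric.mem_nhds_iff.1 hN'
  have hρ : 0 < min r (ε / 2) := lt_min hF.pos (half_pos hε)
  have hsurj := hF.exists_flowLine_eq hρ (min_le_left _ _)
  have hs : c.source ∈ nhds (1 : G) :=
    (isOpen_extChartAt_source (1 : G)).mem_nhds (mem_extChartAt_source _)
  filter_upwards [(continuousAt_extChartAt (I := 𝓘(ℝ, EG)) (1 : G)).eventually hsurj, hs]
    with g ⟨X, y, hX, hy, hyg⟩ hgs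
  obtain ⟨γ, hγ, hγy⟩ := exists_isOneParameterSubgroup_of_flowLine
    ((closedBall_subset_closedBall (min_le_left _ _)).trans hr) hy
  refine ⟨_, γ, hγ, ?_, fun t ht => ?_⟩
  · rw [hγy 1 (by norm_num), hyg]
    exact c.left_inv hgs
  · rw [hγy t ⟨by linarith [ht.1], by linarith [ht.2]⟩]
    refine hεN (closedBall_subset_ball (half_lt_self hε) (closedBall_subset_closedBall
      (min_le_right r _) (hy.2 t ⟨by linarith [ht.1], by linarith [ht.2]⟩).1))

end OneParameter

end

section

lemma PiecewiseSmoothOn.induction₂ {E E' M M' : Type*} [NormedAddCommGroup E]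
    [NormedSpace ℝ E] [TopologicalSpace M] [ChartedSpace E M] [NormedAddCommGroup E']
    [NormedSpace ℝ E'] [TopologicalSpace M'] [ChartedSpace E' M'] {f : ℝ → M} {f' : ℝ → M'}
    {a b : ℝ} {P : ℝ → ℝ → Prop} (hf : PiecewiseSmoothOn E f a b)
    (hf' : PiecewiseSmoothOn E' f' a b) (hab : a < b)
    (hs : ∀ x y, a ≤ x → x < y → y ≤ b → SmoothOn E f x y → SmoothOn E' f' x y → P x y)
    (ht : ∀ x y z, a ≤ x → x < y → y < z → z ≤ b → P x y → P y z → P x z) : P a b := by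
  classical
  obtain ⟨S₁, hS₁⟩ := hf
  obtain ⟨S₂, hS₂⟩ := hf'
  suffices H : ∀ S : Finset ℝ, ∀ x y, a ≤ x → x < y → y ≤ b →
      (∀ x' y', x ≤ x' → x' < y' → y' ≤ y → Disjoint (Set.Ioo x' y') (S : Set ℝ) →
        SmoothOn E f x' y' ∧ SmoothOn E' f' x' y') → P x y by
    refine H (S₁ ∪ S₂) a b le_rfl hab le_rfl fun x' y' hx hxy hy hd => ?_
    rw [Finset.coe_union, Set.disjoint_union_right] at hd
    exact ⟨hS₁ x' y' hx hxy hy hd.1, hS₂ x' y' hx hxy hy hd.2⟩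
  intro S
  induction S using Finset.induction_on with
  | empty =>
    intro x y hx hxy hy h
    obtain ⟨h1, h2⟩ := h x y le_rfl hxy le_rfl (by simp)
    exact hs x y hx hxy hy h1 h2
  | insert s S _ ih =>
    intro x y hx hxy hy h
    have aux : ∀ x' y', x ≤ x' → x' < y' → y' ≤ y → s ∉ Set.Ioo x' y' → P x' y' :=
      fun x' y' hx' hxy' hy' hsn => ih x' y' (hx.trans hx') hxy' (hy'.trans hy)
        fun u v hu huv hv hd => h u v (hx'.trans hu) huv (hv.trans hy') (by
          rw [Finset.coe_insert, Set.disjoint_insert_right]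
          exact ⟨fun h => hsn ⟨hu.trans_lt h.1, h.2.trans_le hv⟩, hd⟩)
    by_cases hsm : s ∈ Set.Ioo x y
    · exact ht x s y hx hsm.1 hsm.2 hy (aux x s le_rfl hsm.1 hsm.2.le (by simp))
        (aux s y hsm.1.le hsm.2 le_rfl (by simp))
    · exact aux x y le_rfl hxy le_rfl hsm

lemma seg_self {M : Type*} (f : ℝ → M) (a : ℝ) : seg f a a = fun _ => f a := by
  funext s
  simp only [seg]
  congr 1
  ring

namespace HolonomyData

section Twist

variable {G E M : Type*} [Group G] [NormedAddCommGroup E] [NormedSpace ℝ E]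
    [TopologicalSpace M] [ChartedSpace E M] [MulAction G M]

/-- The change of a trivialization by a function on `M`. -/
def twist (T : HolonomyData G E M) (θ : M → UnitAddCircle) : HolonomyData G E M where
  hol γ := T.hol γ + θ (γ 1) - θ (γ 0)
  trans φ x := T.trans φ x + θ x - θ (φ • x)
  form := T.form
  hol_split f a b c hab hbc hac hf := by
    rw [T.hol_split f a b c hab hbc hac hf]
    simp only [seg_zero, seg_one]
    abel
  hol_const x := by simp [T.hol_const]
  hol_reverse γ hγ := by
    rw [T.hol_reverse γ hγ, reverse_zero, reverse_one]
    abel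
  hol_simplex σ hσ := by
    rw [← T.hol_simplex σ hσ]
    simp
    abel
  hol_smul φ γ hγ := by
    rw [T.hol_smul φ γ hγ]
    abel
  trans_mul φ' φ x := by
    rw [T.trans_mul φ' φ x, mul_smul]
    abel

/-- A trivialization can be changed to one with trivial transition functions for `H`. -/
lemma exists_twist_trans_eq_zero {EH H EB B : Type*}
    [NormedAddCommGroup EH] [NormedSpace ℝ EH] [TopologicalSpace H] [ChartedSpace EH H] [Group H]
    [NormedAddCommGroup EB] [NormedSpace ℝ EB] [TopologicalSpace B] [ChartedSpace EB B]
    {ι : H →* G} {π : M → B}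
    (hπ : IsPrincipalBundle (EH := EH) (E := E) (EB := EB) ι π) (T : HolonomyData G E M) :
    ∃ θ, ∀ h x, (T.twist θ).trans (ι h) x = 0 := by
  choose s hs using hπ.surjective
  choose k hk using fun x => hπ.exists_smul_eq (x := s (π x)) (x' := x) (by rw [hs])
  refine ⟨fun x => T.trans (ι (k x)) (s (π x)), fun h x => ?_⟩
  have e : k (ι h • x) = h * k x := by
    have h1 := hk (ι h • x)
    rw [hπ.invariant] at h1
    have h2 : ι ((h * k x)⁻¹ * k (ι h • x)) • s (π x) = s (π x) := by
      rw [map_mul, mul_smul, ← h1, map_inv, inv_smul_eq_iff, map_mul, mul_smul, ← hk x]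
    exact (inv_mul_eq_one.1 (hπ.eq_one_of_smul_eq h2)).symm
  simp only [twist]
  rw [hπ.invariant, e, map_mul, T.trans_mul, ← hk x]
  abel

end Twist

/-- A trivialization over a principal bundle that is invariant under the structure group, flat on
one-parameter orbits, and whose curvature form descends. -/
structure IsBasic {G EH H E M EB B : Type*} [Group G]
    [NormedAddCommGroup EH] [NormedSpace ℝ EH] [TopologicalSpace H] [ChartedSpace EH H] [Group H]
    [NormedAddCommGroup E] [NormedSpace ℝ E] [TopologicalSpace M] [ChartedSpace E M]
    [MulAction G M]
    [NormedAddCommGroup EB] [NormedSpace ℝ EB] [TopologicalSpace B] [ChartedSpace EB B]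
    (T : HolonomyData G E M) (ι : H →* G) (π : M → B) (β : TwoFormField EB B) : Prop where
  trans_eq_zero : ∀ (h : H) (x : M), T.trans (ι h) x = 0
  hol_exp : ∀ (Y : GroupLieAlgebra 𝓘(ℝ, EH) H) (c : ℝ → H) (x : M), IsOneParameterSubgroup c Y →
    T.hol (seg (fun s => ι (c s) • x) 0 1) = 0
  pullback : ∀ (x : M) (v w : E),
    T.form.val x ![v, w] = β.val (π x) ![tderiv E EB π x v, tderiv E EB π x w]

namespace IsBasic

set_option linter.unusedSectionVars false

variable {EG G EH H E M EB B : Type*}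
    [NormedAddCommGroup EG] [NormedSpace ℝ EG] [TopologicalSpace G] [ChartedSpace EG G] [Group G]
    [NormedAddCommGroup EH] [NormedSpace ℝ EH] [TopologicalSpace H] [ChartedSpace EH H] [Group H]
    [LieGroup 𝓘(ℝ, EH) ∞ H]
    [NormedAddCommGroup E] [NormedSpace ℝ E] [TopologicalSpace M] [ChartedSpace E M]
    [IsManifold 𝓘(ℝ, E) ∞ M]
    [MulAction G M] [ContMDiffSMul 𝓘(ℝ, EG) 𝓘(ℝ, E) ∞ G M]
    [NormedAddCommGroup EB] [NormedSpace ℝ EB] [TopologicalSpace B] [ChartedSpace EB B]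
    {ι : H →* G} {π : M → B} {T : HolonomyData G E M} {β : TwoFormField EB B}

lemma hol_smul (hT : T.IsBasic (EH := EH) ι π β) (h : H) {γ : unitInterval → M}
    (hγ : IsPiecewiseSmooth E γ) : T.hol (fun s => ι h • γ s) = T.hol γ := by
  rw [T.hol_smul _ _ hγ, hT.trans_eq_zero, hT.trans_eq_zero]
  simp

variable (hT : T.IsBasic (EH := EH) ι π β) (hι : ContMDiff 𝓘(ℝ, EH) 𝓘(ℝ, EG) ∞ ι)
  (hπ : IsPrincipalBundle (EH := EH) (E := E) (EB := EB) ι π)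

include hT hι hπ

/-- Vertical curves with the same end points and values in a chart have the same holonomy. -/
lemma hol_eq_of_chart {c : PartialEquiv H EH} {V : Set EH} (hV : Convex ℝ V)
    (hVc : V ⊆ c.target) (hc : ContMDiffOn 𝓘(ℝ, EH) 𝓘(ℝ, EH) ∞ c c.source)
    (hc' : ContMDiffOn 𝓘(ℝ, EH) 𝓘(ℝ, EH) ∞ c.symm c.target)
    {k₁ k₂ : ℝ → H} (h₁ : SmoothOn EH k₁ 0 1) (h₂ : SmoothOn EH k₂ 0 1)
    (m₁ : ∀ t ∈ Set.Icc (0 : ℝ) 1, k₁ t ∈ c.source ∧ c (k₁ t) ∈ V)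
    (m₂ : ∀ t ∈ Set.Icc (0 : ℝ) 1, k₂ t ∈ c.source ∧ c (k₂ t) ∈ V)
    (e0 : k₁ 0 = k₂ 0) (e1 : k₁ 1 = k₂ 1) (x : M) :
    T.hol (seg (fun s => ι (k₁ s) • x) 0 1) = T.hol (seg (fun s => ι (k₂ s) • x) 0 1) := by
  let R : ℝ × ℝ → EH := fun q => (1 - q.1) • c (k₁ q.2) + q.1 • c (k₂ q.2)
  let F : ℝ × ℝ → M := fun q => ι (c.symm (R q)) • x
  set S : Set (ℝ × ℝ) := Set.Icc 0 1 ×ˢ Set.Icc 0 1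
  have hc1 : SmoothOn EH (fun t => c (k₁ t)) 0 1 := hc.comp h₁ fun t ht => (m₁ t ht).1
  have hc2 : SmoothOn EH (fun t => c (k₂ t)) 0 1 := hc.comp h₂ fun t ht => (m₂ t ht).1
  have hR : ContDiffOn ℝ ∞ R S := by
    have d1 := (contMDiffOn_iff_contDiffOn.1 hc1).comp (s := S) contDiffOn_snd fun q hq => hq.2
    have d2 := (contMDiffOn_iff_contDiffOn.1 hc2).comp (s := S) contDiffOn_snd fun q hq => hq.2
    exact ((contDiffOn_const.sub contDiffOn_fst).smul d1).add (contDiffOn_fst.smul d2)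
  have hRV : ∀ q ∈ S, R q ∈ V := fun q hq =>
    hV (m₁ q.2 hq.2).2 (m₂ q.2 hq.2).2 (sub_nonneg.2 hq.1.2) hq.1.1 (by ring)
  have hF : ContMDiffOn 𝓘(ℝ, ℝ × ℝ) 𝓘(ℝ, E) ∞ F S :=
    (contMDiff_hom_smul_left (E := E) hι x).comp_contMDiffOn
      (hc'.comp hR.contMDiffOn fun q hq => hVc (hRV q hq))
  have hF0 : ∀ t ∈ Set.Icc (0 : ℝ) 1, F (0, t) = ι (k₁ t) • x := fun t ht => by
    simp [F, R, c.left_inv (m₁ t ht).1]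
  have hF1 : ∀ t ∈ Set.Icc (0 : ℝ) 1, F (1, t) = ι (k₂ t) • x := fun t ht => by
    simp [F, R, c.left_inv (m₂ t ht).1]
  have hFs0 : ∀ s, F (s, 0) = ι (k₁ 0) • x := fun s => by
    simp [F, R, ← e0, ← add_smul, c.left_inv (m₁ 0 (by simp)).1]
  have hFs1 : ∀ s, F (s, 1) = ι (k₁ 1) • x := fun s => by
    simp [F, R, ← e1, ← add_smul, c.left_inv (m₁ 1 (by simp)).1]
  have simp0 : ∀ τ : ℝ × ℝ → ℝ × ℝ, ContDiff ℝ ∞ τ → Set.MapsTo τ triangle S →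
      T.hol (fun s => F (τ (1 - (s : ℝ), (s : ℝ)))) - T.hol (fun s => F (τ (0, (s : ℝ))))
        + T.hol (fun s => F (τ ((s : ℝ), 0))) = 0 := by
    intro τ hτ hm
    have hσ : ContMDiffOn 𝓘(ℝ, ℝ × ℝ) 𝓘(ℝ, E) ∞ (F ∘ τ) triangle :=
      hF.comp hτ.contMDiff.contMDiffOn hm
    have := T.hol_simplex _ hσ
    have e : π ∘ F ∘ τ = fun _ => π x := funext fun p => hπ.invariant _ _
    rw [integralSimplex_pullback hπ.smooth hT.pullback hσ, e, integralSimplex_const,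
      AddCircle.coe_zero] at this
    exact this
  have t1 := simp0 (fun p => (p.1, p.1 + p.2)) (by fun_prop) (by
    rintro ⟨a, b⟩ ⟨ha, hb, hab⟩
    simp only at ha hb hab
    exact ⟨⟨ha, by simp only; linarith⟩, by simp only; linarith, hab⟩)
  have t2 := simp0 (fun p => (p.1 + p.2, p.2)) (by fun_prop) (by
    rintro ⟨a, b⟩ ⟨ha, hb, hab⟩
    simp only at ha hb hab
    exact ⟨⟨by simp only; linarith, hab⟩, hb, by simp only; linarith⟩)
  simp only [sub_add_cancel, hFs0, hFs1, zero_add, add_zero, T.hol_const] at t1 t2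
  have g1 : (fun s : unitInterval => F (0, (s : ℝ))) = seg (fun s => ι (k₁ s) • x) 0 1 := by
    funext s
    rw [hF0 _ s.2]
    simp [seg]
  have g2 : (fun s : unitInterval => F (1, (s : ℝ))) = seg (fun s => ι (k₂ s) • x) 0 1 := by
    funext s
    rw [hF1 _ s.2]
    simp [seg]
  rw [g1] at t1
  rw [g2] at t2
  rw [zero_sub, neg_add_eq_zero] at t1
  rw [t1, sub_eq_zero.1 t2]

variable [CompleteSpace EH] [T2Space H]

/-- Short vertical curves have trivial holonomy. -/
lemma exists_nhds_hol_eq_zero : ∃ N ∈ nhds (1 : H), ∀ (k : ℝ → H) (x : M), SmoothOn EH k 0 1 →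
    k 0 = 1 → (∀ t ∈ Set.Icc (0 : ℝ) 1, k t ∈ N) →
      T.hol (seg (fun s => ι (k s) • x) 0 1) = 0 := by
  set c := oneChart EH H
  obtain ⟨r, hr, hball⟩ := Metric.isOpen_iff.1 (isOpen_extChartAt_target (I := 𝓘(ℝ, EH)) (1 : H))
    (c 1) (mem_extChartAt_target 1)
  set N₀ : Set H := c.source ∩ c ⁻¹' Metric.ball (c 1) r
  have hN₀ : N₀ ∈ nhds (1 : H) := Filter.inter_mem (extChartAt_source_mem_nhds 1)
    ((continuousAt_extChartAt 1).preimage_mem_nhds (Metric.ball_mem_nhds _ hr))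
  refine ⟨_, Filter.inter_mem hN₀ (eventually_exists_isOneParameterSubgroup EH hN₀),
    fun k x hk hk0 hkN => ?_⟩
  obtain ⟨X, γ, hγ, hγ1, hγN⟩ := (hkN 1 (by simp)).2
  rw [← hT.hol_exp X γ x hγ]
  exact hT.hol_eq_of_chart hι hπ (convex_ball (c 1) r) hball
    (fun g hg => (contMDiffAt_oneChart hg).contMDiffWithinAt)
    (fun y hy => (contMDiffAt_oneChart_symm hy).contMDiffWithinAt) hk hγ.smooth.contMDiffOn
    (fun t ht => (hkN t ht).1) hγN (by rw [hk0, hγ.map_zero]) hγ1.symm x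

/-- Vertical curves have trivial holonomy. -/
lemma hol_vertical {h : ℝ → H} {a b : ℝ} (hab : a ≤ b) (hh : SmoothOn EH h a b) (x : M) :
    T.hol (seg (fun s => ι (h s) • x) a b) = 0 := by
  have : IsTopologicalGroup H := topologicalGroup_of_lieGroup 𝓘(ℝ, EH) ∞
  obtain ⟨N, hN, hloc⟩ := hT.exists_nhds_hol_eq_zero hι hπ
  obtain ⟨N', hN', hdiv⟩ := exists_nhds_split_inv hN
  have hcont := continuousOn_iff_continuous_domRestrict.1 hh.continuousOn
  obtain ⟨t, ht0, htm, ⟨n, hn⟩, hsub⟩ := exists_monotone_Icc_subset_open_cover_Icc hab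
    (c := fun i : Set.Icc a b => {t | (Set.Icc a b).domRestrict h t * (h i)⁻¹ ∈ interior N'})
    (fun i => isOpen_interior.preimage (hcont.mul continuous_const))
    (fun s _ => Set.mem_iUnion.2 ⟨s, by simpa [mem_interior_iff_mem_nhds] using hN'⟩)
  have hS : SmoothOn E (fun s => ι (h s) • x) a b :=
    (contMDiff_hom_smul_left (E := E) hι x).comp_contMDiffOn hh
  suffices H : ∀ m, T.hol (seg (fun s => ι (h s) • x) a (t m)) = 0 by
    have := H n
    rwa [hn n le_rfl] at this
  intro m
  induction m with
  | zero => rw [ht0, seg_self, T.hol_const]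
  | succ m ih =>
    have hle : (t m : ℝ) ≤ t (m + 1) := htm (Nat.le_succ m)
    have ha := (t m).2.1
    have hb := (t (m + 1)).2.2
    rcases (ha.trans hle).eq_or_lt with h0 | hlt
    · rw [← h0, seg_self, T.hol_const]
    rw [T.hol_split _ _ _ _ ha hle hlt (hS.piecewiseSmoothOn.mono le_rfl hb), ih, zero_add]
    obtain ⟨i, hi⟩ := hsub m
    have hmem : ∀ s ∈ Set.Icc (0 : ℝ) 1,
        (t (m + 1) - t m : ℝ) * s + t m ∈ Set.Icc (t m : ℝ) (t (m + 1)) := fun s hs =>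
      ⟨by nlinarith [hs.1], by nlinarith [hs.2]⟩
    have hmem' : ∀ u ∈ Set.Icc (t m : ℝ) (t (m + 1)), h u * (h i)⁻¹ ∈ N' := fun u hu =>
      interior_subset (hi (a := ⟨u, ha.trans hu.1, hu.2.trans hb⟩) ⟨hu.1, hu.2⟩)
    have key := hloc (fun s => h ((t (m + 1) - t m : ℝ) * s + t m) * (h (t m))⁻¹)
      (ι (h (t m)) • x)
      ((hh.comp_affine fun s hs => ⟨ha.trans (hmem s hs).1, (hmem s hs).2.trans hb⟩).mul
        contMDiffOn_const) (by simp) (fun s hs => by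
        have := hdiv _ (hmem' _ (hmem s hs)) _ (hmem' (t m) ⟨le_rfl, hle⟩)
        simpa [div_eq_mul_inv] using this)
    rw [← key]
    congr 1
    funext s
    simp only [seg, map_mul, map_inv, mul_smul, inv_smul_smul]
    congr 3
    ring

/-- The holonomy of a smooth curve only depends on its projection. -/
lemma hol_eq_of_smooth {f f' : ℝ → M} {a b : ℝ} (hab : a ≤ b) (hf : SmoothOn E f a b)
    (hf' : SmoothOn E f' a b) (h : ∀ t ∈ Set.Icc a b, π (f t) = π (f' t)) :
    T.hol (seg f a b) = T.hol (seg f' a b) := by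
  obtain ⟨g, hg, hgf⟩ := hπ.exists_smooth_smul_eq hf hf' h
  set σ : ℝ × ℝ → M := fun p =>
    ι (g (a + p.1 * (a - a) + p.2 * (b - a))) • f (a + p.1 * (b - a) + p.2 * (b - a)) with hσdef
  have ha : a ∈ Set.Icc a b := ⟨le_rfl, hab⟩
  have hb : b ∈ Set.Icc a b := ⟨hab, le_rfl⟩
  have hσ : ContMDiffOn 𝓘(ℝ, ℝ × ℝ) 𝓘(ℝ, E) ∞ σ triangle :=
    (contMDiff_hom_smul E M hι).comp_contMDiffOn
      ((contMDiffOn_thinSimplex hg ha ha hb).prodMk (contMDiffOn_thinSimplex hf ha hb hb))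
  have hI : integralSimplex T.form σ = 0 := by
    have e : π ∘ σ = thinSimplex (π ∘ f) a b b := funext fun p => hπ.invariant _ _
    rw [integralSimplex_pullback hπ.smooth hT.pullback hσ, e]
    exact integralSimplex_thinSimplex β (hπ.smooth.comp_contMDiffOn hf) ha hb hb
  have key := T.hol_simplex σ hσ
  have e1 : (fun s : unitInterval => σ (1 - (s : ℝ), (s : ℝ))) =
      seg (fun s => ι (g s) • f b) a b := by
    funext s
    simp only [hσdef, seg]
    congr 3 <;> ring
  have e2 : (fun s : unitInterval => σ (0, (s : ℝ))) = seg f' a b := by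
    funext s
    have hs : (1 - (s : ℝ)) * a + s * b ∈ Set.Icc a b := by
      have h0 := s.2.1
      have h1 := s.2.2
      constructor <;> nlinarith
    simp only [seg]
    rw [hgf _ hs]
    simp only [hσdef]
    congr 1
    · congr 2; ring
    · congr 1; ring
  have e3 : (fun s : unitInterval => σ ((s : ℝ), 0)) = fun s => ι (g a) • seg f a b s := by
    funext s
    simp only [hσdef, seg]
    congr 1
    · congr 2; ring
    · congr 1; ring
  rw [hI, e1, e2, e3, hT.hol_vertical hι hπ hab hg, hT.hol_smul _ (hf.piecewiseSmoothOn.seg ha hb),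
    AddCircle.coe_zero, zero_sub, neg_add_eq_zero] at key
  exact key.symm

/-- The holonomy of a piecewise smooth curve only depends on its projection. -/
lemma hol_eq_of_comp_eq {γ γ' : unitInterval → M} (hγ : IsPiecewiseSmooth E γ)
    (hγ' : IsPiecewiseSmooth E γ') (h : π ∘ γ = π ∘ γ') : T.hol γ = T.hol γ' := by
  rw [isPiecewiseSmooth_iff] at hγ hγ'
  rw [← seg_ext γ, ← seg_ext γ']
  have he : ∀ t, π (ext γ t) = π (ext γ' t) := fun t => congrFun h _
  refine hγ.induction₂ (P := fun x y => T.hol (seg (ext γ) x y) = T.hol (seg (ext γ') x y)) hγ'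
    zero_lt_one
    (fun x y _ hxy _ h1 h2 => hT.hol_eq_of_smooth hι hπ hxy.le h1 h2 fun t _ => he t) ?_
  intro x y z hx hxy hyz hz h1 h2
  rw [T.hol_split _ _ _ _ hxy.le hyz.le (hxy.trans hyz) (hγ.mono hx hz),
    T.hol_split _ _ _ _ hxy.le hyz.le (hxy.trans hyz) (hγ'.mono hx hz), h1, h2]

end IsBasic

end HolonomyData

end

section

namespace HolonomyData

/-! ### From trivializations to differential characters -/

section Construction

variable {G E M : Type*} [Group G] [NormedAddCommGroup E] [NormedSpace ℝ E]
    [TopologicalSpace M] [ChartedSpace E M] [MulAction G M] (T : HolonomyData G E M)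

lemma hol_concat {γ γ' : unitInterval → M} (hγ : IsPiecewiseSmooth E γ)
    (hγ' : IsPiecewiseSmooth E γ') (h : γ 1 = γ' 0) :
    T.hol (concat γ γ') = T.hol γ + T.hol γ' := by
  have := T.hol_split (ext (concat γ γ')) 0 (1 / 2) 1 (by norm_num) (by norm_num) one_pos
    (isPiecewiseSmooth_iff.1 (hγ.concat hγ' h))
  rwa [seg_ext, seg_zero_half_concat, seg_half_one_concat h] at this

/-- The linear extension of the holonomy to 1-chains. -/
def holChain : ((unitInterval → M) →₀ ℤ) →+ UnitAddCircle :=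
  Finsupp.liftAddHom fun γ => (zmultiplesHom UnitAddCircle) (T.hol γ)

lemma holChain_single (γ : unitInterval → M) : T.holChain (Finsupp.single γ 1) = T.hol γ := by
  simp [holChain]

lemma holChain_boundary (σ : Chain E M) :
    T.holChain (boundary σ) = ((integralChain T.form σ : ℝ) : UnitAddCircle) := by
  induction σ using Finsupp.induction_linear with
  | zero => simp [boundary, integralChain]
  | add σ τ hσ hτ => rw [boundary_add, map_add, hσ, hτ, integralChain_add, AddCircle.coe_add]
  | single s n =>
    have h : T.holChain (simplexBoundary s.1) =
        ((integralSimplex T.form s.1 : ℝ) : UnitAddCircle) := by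
      rw [simplexBoundary, map_add, map_sub, holChain_single, holChain_single, holChain_single]
      exact T.hol_simplex s.1 s.2
    have h1 : boundary (Finsupp.single s n) = n • simplexBoundary s.1 :=
      Finsupp.sum_single_index (zero_smul _ _)
    have h2 : integralChain T.form (Finsupp.single s n) = n * integralSimplex T.form s.1 :=
      Finsupp.sum_single_index (by simp)
    rw [h1, h2, map_zsmul, h, ← AddCircle.coe_zsmul, zsmul_eq_mul]

lemma hol_of_isBoundaryOf {γ : unitInterval → M} (hγ : IsPiecewiseSmooth E γ) {σ : Chain E M}
    (h : IsBoundaryOf γ σ) : T.hol γ = ((integralChain T.form σ : ℝ) : UnitAddCircle) := by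
  obtain ⟨n, t, ht, h0, h1, hσ⟩ := h
  rw [← holChain_boundary, hσ, map_sum]
  simp only [holChain_single, piece_eq_seg]
  have key : ∀ m : Fin (n + 1), T.hol (seg (ext γ) 0 (t m)) =
      ∑ i : Fin n, if i.castSucc < m then T.hol (seg (ext γ) (t i.castSucc) (t i.succ)) else 0 := by
    intro m
    induction m using Fin.induction with
    | zero =>
      have : ((t 0 : unitInterval) : ℝ) = 0 := by rw [h0]; rfl
      rw [this, seg_self, T.hol_const]
      simp
    | succ i ih =>
      have hlt : (t i.castSucc : ℝ) < t i.succ := ht i.castSucc_lt_succ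
      rw [T.hol_split _ 0 _ _ (t i.castSucc).2.1 hlt.le ((t i.castSucc).2.1.trans_lt hlt)
        ((isPiecewiseSmooth_iff.1 hγ).mono le_rfl (t i.succ).2.2), ih]
      have : ∀ j : Fin n, (if j.castSucc < i.succ then
            T.hol (seg (ext γ) (t j.castSucc) (t j.succ)) else 0) =
          (if j.castSucc < i.castSucc then
            T.hol (seg (ext γ) (t j.castSucc) (t j.succ)) else 0) +
          if j = i then T.hol (seg (ext γ) (t j.castSucc) (t j.succ)) else 0 := by
        intro j
        rcases lt_trichotomy j i with hj | rfl | hj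
        · rw [if_pos (Fin.castSucc_lt_succ_iff.2 hj.le), if_pos (Fin.castSucc_lt_castSucc_iff.2 hj),
            if_neg hj.ne, add_zero]
        · simp
        · rw [if_neg (by rw [Fin.castSucc_lt_succ_iff]; exact not_le.2 hj),
            if_neg (by rw [Fin.castSucc_lt_castSucc_iff]; exact hj.not_gt), if_neg hj.ne', add_zero]
      simp only [this, Finset.sum_add_distrib, Finset.sum_ite_eq', Finset.mem_univ, if_true]
  have := key (Fin.last n)
  have e : ((t (Fin.last n) : unitInterval) : ℝ) = 1 := by rw [h1]; rfl
  rw [e, seg_ext] at this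
  rw [this]
  exact Finset.sum_congr rfl fun i _ => if_pos i.castSucc_lt_last

/-- The differential character given by the holonomy around loops. -/
def toDifferentialCharacter (h : IsSmoothForm T.form) (h' : IsClosedForm T.form) :
    DifferentialCharacter E M where
  toFun γ := T.hol γ.1
  map_concat γ γ' δ h e := by rw [e, T.hol_concat γ.2.1 γ'.2.1 h]
  map_conj γ δ ζ hζ h e := by
    have h1 : reverse ζ 1 = γ.1 0 := by rw [reverse_one, h]
    rw [e, T.hol_concat (hζ.reverse.concat γ.2.1 h1) hζ (by rw [concat_one, γ.2.2, h]),
      T.hol_concat hζ.reverse γ.2.1 h1, T.hol_reverse ζ hζ]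
    abel
  exists_curv := ⟨T.form, h, h', fun γ _ hσ => T.hol_of_isBoundaryOf γ.2.1 hσ⟩

/-- The equivariant differential character `(φ, γ) ↦ hol(γ) + trans(φ, γ(0))`. -/
def toEquivariantDifferentialCharacter {EG : Type*} [NormedAddCommGroup EG] [NormedSpace ℝ EG]
    [TopologicalSpace G] [ChartedSpace EG G]
    (hφ : ∀ φ : G, ContMDiff 𝓘(ℝ, E) 𝓘(ℝ, E) ∞ (fun x : M => φ • x))
    (ϖ : EquivariantTwoForm EG G E M) (hϖ : ϖ.IsClosed) (hform : ϖ.form = T.form)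
    (hexp : ∀ (X : GroupLieAlgebra 𝓘(ℝ, EG) G) (c : ℝ → G) (x : M), IsOneParameterSubgroup c X →
      T.hol (fun s => c (s : ℝ) • x) + T.trans (c 1) x =
        ((ϖ.moment x X : ℝ) : UnitAddCircle)) :
    EquivariantDifferentialCharacter EG G E M where
  toFun p := T.hol p.1.2 + T.trans p.1.1 (p.1.2 0)
  map_concat p p' q h e := by
    simp only [e]
    rw [T.hol_concat p.2.1 p'.2.1 h, concat_zero, T.trans_mul, ← p.2.2, h]
    abel
  map_conj p q ζ hζ h e := by
    have h1 : reverse ζ 1 = p.1.2 0 := by rw [reverse_one, h]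
    simp only [e]
    rw [concat_zero, concat_zero, reverse_zero,
      T.hol_concat (hζ.reverse.concat p.2.1 h1) (γ' := fun t => p.1.1 • ζ t)
        (hζ.comp_left (hφ p.1.1))
        (by rw [concat_one, p.2.2, h]),
      T.hol_concat hζ.reverse p.2.1 h1, T.hol_reverse ζ hζ, T.hol_smul _ ζ hζ, h]
    abel
  exists_curv := ⟨ϖ, hϖ, fun p σ h1 hσ => by
    have : T.trans 1 (p.1.2 0) = 0 := by
      have := T.trans_mul 1 1 (p.1.2 0)
      rwa [one_mul, one_smul, right_eq_add] at this
    rw [h1, this, add_zero, hform]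
    exact T.hol_of_isBoundaryOf p.2.1 hσ, fun p X c x hc h1 h2 => by
    rw [h1, h2, ← hexp X c x hc]
    simp [hc.map_zero]⟩

end Construction

end HolonomyData

end

section

/-! ### Subdivision of simplices -/

section Subdivision

open MeasureTheory

variable {E M : Type*} [NormedAddCommGroup E] [NormedSpace ℝ E]
    [TopologicalSpace M] [ChartedSpace E M]

/-- The coefficient of the pull-back of a 2-form by a simplex. -/
def pullbackCoeff (α : TwoFormField E M) (σ : ℝ × ℝ → M) (p : ℝ × ℝ) : ℝ :=
  α.val (σ p)
    ![tderivWithin (ℝ × ℝ) E σ triangle p (1, 0), tderivWithin (ℝ × ℝ) E σ triangle p (0, 1)]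

lemma continuousOn_pullbackCoeff [IsManifold 𝓘(ℝ, E) ∞ M] {α : TwoFormField E M}
    (hα : IsSmoothForm α) {σ : ℝ × ℝ → M}
    (hσ : ContMDiffOn 𝓘(ℝ, ℝ × ℝ) 𝓘(ℝ, E) ∞ σ triangle) :
    ContinuousOn (pullbackCoeff α σ) triangle := by
  intro p₀ hp₀
  set c := extChartAt 𝓘(ℝ, E) (σ p₀) with hc
  have hsmooth : ContMDiffAt 𝓘(ℝ, E) 𝓘(ℝ, E) ∞ c (σ p₀) := contMDiffAt_extChartAt
  have hcσ : ContDiffWithinAt ℝ ∞ (c ∘ σ) triangle p₀ :=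
    contMDiffWithinAt_iff_contDiffWithinAt.1 (hsmooth.comp_contMDiffWithinAt p₀ (hσ p₀ hp₀))
  have hud : UniqueDiffOn ℝ triangle := uniqueMDiffOn_triangle.uniqueDiffOn
  have hd : ContinuousWithinAt (fderivWithin ℝ (c ∘ σ) triangle) triangle p₀ :=
    (hcσ.fderivWithin_right (m := 0) hud (by simp) hp₀).continuousWithinAt
  have hin : ContinuousWithinAt (fun p => inChart α (σ p₀) (c (σ p))) triangle p₀ := by
    have h1 : ContinuousAt (inChart α (σ p₀)) (c (σ p₀)) :=
      ((hα (σ p₀)).contDiffAt ((isOpen_extChartAt_target _).mem_nhds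
        (mem_extChartAt_target _))).continuousAt
    exact h1.comp_continuousWithinAt (f := c ∘ σ) hcσ.continuousWithinAt
  have hv : ∀ u, ContinuousWithinAt (fun p => fderivWithin ℝ (c ∘ σ) triangle p u) triangle p₀ :=
    fun u => hd.clm_apply continuousWithinAt_const
  have hb : ContinuousWithinAt (fun p => toBilin E (inChart α (σ p₀) (c (σ p)))
      (fderivWithin ℝ (c ∘ σ) triangle p (1, 0)) (fderivWithin ℝ (c ∘ σ) triangle p (0, 1)))
      triangle p₀ :=
    ((((toBilin E).continuous.continuousAt.comp_continuousWithinAt hin).clm_apply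
      (hv _)).clm_apply (hv _))
  have key : ∀ p ∈ triangle, σ p ∈ c.source → pullbackCoeff α σ p =
      toBilin E (inChart α (σ p₀) (c (σ p))) (fderivWithin ℝ (c ∘ σ) triangle p (1, 0))
        (fderivWithin ℝ (c ∘ σ) triangle p (0, 1)) := by
    intro p hp hps
    have hcp : MDifferentiableAt 𝓘(ℝ, E) 𝓘(ℝ, E) c (σ p) :=
      (contMDiffAt_extChartAt' (n := ∞) (by rwa [hc, extChartAt_source] at hps)).mdifferentiableAt (by simp)
    have hsymm : MDifferentiableAt 𝓘(ℝ, E) 𝓘(ℝ, E) c.symm (c (σ p)) :=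
      ((contMDiffOn_extChartAt_symm (n := ∞) (σ p₀)).contMDiffAt
        ((isOpen_extChartAt_target _).mem_nhds (c.map_source hps))).mdifferentiableAt (by simp)
    have e1 : (tderiv E E c.symm (c (σ p))).comp (tderiv E E c (σ p)) =
        ContinuousLinearMap.id ℝ E := by
      rw [← tderiv_comp hsymm hcp, ← tderiv_id (σ p)]
      refine tderiv_congr ?_
      filter_upwards [(isOpen_extChartAt_source (I := 𝓘(ℝ, E)) (σ p₀)).mem_nhds hps] with y hy
        using c.left_inv hy
    have e2 : ∀ u, tderiv E E c.symm (c (σ p)) (fderivWithin ℝ (c ∘ σ) triangle p u) =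
        tderivWithin (ℝ × ℝ) E σ triangle p u := fun u => by
      rw [← tderivWithin_eq_fderivWithin, tderiv_comp_tderivWithin hcp
        ((hσ p hp).mdifferentiableWithinAt (by simp)) (uniqueMDiffOn_triangle p hp)]
      exact DFunLike.congr_fun e1 _
    rw [toBilin_apply, inChart_eq]
    change _ = α.val (c.symm (c (σ p))) (tderiv E E c.symm (c (σ p)) ∘ _)
    rw [vec_two_eq (_ ∘ _)]
    simp only [Function.comp_apply, Matrix.cons_val_zero, Matrix.cons_val_one]
    rw [e2, e2, c.left_inv hps]
    rfl
  refine hb.congr_of_eventuallyEq ?_ (key p₀ hp₀ (mem_extChartAt_source _))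
  filter_upwards [self_mem_nhdsWithin, (hσ p₀ hp₀).continuousWithinAt.preimage_mem_nhdsWithin
    (extChartAt_source_mem_nhds (I := 𝓘(ℝ, E)) (σ p₀))] with p hp hps using key p hp hps

/-- The affine map of the plane with `(0,0) ↦ v`, `(1,0) ↦ v + a`, `(0,1) ↦ v + b`. -/
def planeMap (v a b : ℝ × ℝ) (p : ℝ × ℝ) : ℝ × ℝ := v + p.1 • a + p.2 • b

/-- The linear part of `planeMap`. -/
def planeLin (a b : ℝ × ℝ) : ℝ × ℝ →L[ℝ] ℝ × ℝ :=
  (ContinuousLinearMap.fst ℝ ℝ ℝ).smulRight a + (ContinuousLinearMap.snd ℝ ℝ ℝ).smulRight b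

lemma hasFDerivAt_planeMap (v a b p : ℝ × ℝ) : HasFDerivAt (planeMap v a b) (planeLin a b) p := by
  have : planeMap v a b = fun p => v + planeLin a b p := by
    funext p
    simp [planeMap, planeLin, add_assoc]
  rw [this]
  exact (planeLin a b).hasFDerivAt.const_add v

lemma contDiff_planeMap (v a b : ℝ × ℝ) : ContDiff ℝ ∞ (planeMap v a b) := by
  unfold planeMap
  fun_prop

lemma det_planeLin (a b : ℝ × ℝ) : (planeLin a b).det = a.1 * b.2 - a.2 * b.1 := by
  change LinearMap.det (planeLin a b : ℝ × ℝ →ₗ[ℝ] ℝ × ℝ) = _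
  rw [← LinearMap.det_toMatrix (Module.Basis.finTwoProd ℝ), Matrix.det_fin_two]
  simp [LinearMap.toMatrix_apply, planeLin]
  ring

lemma injective_planeMap (v : ℝ × ℝ) {a b : ℝ × ℝ} (h : a.1 * b.2 - a.2 * b.1 ≠ 0) :
    Function.Injective (planeMap v a b) := by
  rintro ⟨x, y⟩ ⟨x', y'⟩ hp
  simp only [planeMap, Prod.ext_iff, Prod.fst_add, Prod.snd_add, Prod.smul_fst, Prod.smul_snd,
    smul_eq_mul] at hp
  obtain ⟨h1, h2⟩ := hp
  have e1 : (x - x') * (a.1 * b.2 - a.2 * b.1) = 0 := by linear_combination b.2 * h1 - b.1 * h2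
  have e2 : (y - y') * (a.1 * b.2 - a.2 * b.1) = 0 := by linear_combination a.1 * h2 - a.2 * h1
  exact Prod.ext (sub_eq_zero.1 ((mul_eq_zero.1 e1).resolve_right h))
    (sub_eq_zero.1 ((mul_eq_zero.1 e2).resolve_right h))

lemma alternating_map_planeLin (α : E [⋀^Fin 2]→L[ℝ] ℝ) (S : ℝ × ℝ →L[ℝ] E) (a b : ℝ × ℝ) :
    α ![S a, S b] = (a.1 * b.2 - a.2 * b.1) * α ![S (1, 0), S (0, 1)] := by
  have h : ∀ u : ℝ × ℝ, S u = u.1 • S (1, 0) + u.2 • S (0, 1) := fun u => by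
    rw [← map_smul, ← map_smul, ← map_add]
    congr 1
    ext <;> simp
  rw [h a, h b]
  simp only [alternating_add_left, alternating_add_right, alternating_smul_left,
    alternating_smul_right, alternating_self]
  rw [alternating_swap α (S (0, 1))]
  ring

lemma integralSimplex_comp_planeMap (α : TwoFormField E M) {σ : ℝ × ℝ → M}
    (hσ : ContMDiffOn 𝓘(ℝ, ℝ × ℝ) 𝓘(ℝ, E) ∞ σ triangle) {v a b : ℝ × ℝ}
    (hm : Set.MapsTo (planeMap v a b) triangle triangle) (h : 0 < a.1 * b.2 - a.2 * b.1) :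
    integralSimplex α (σ ∘ planeMap v a b) =
      ∫ p in planeMap v a b '' triangle, pullbackCoeff α σ p := by
  rw [integral_image_eq_integral_abs_det_fderiv_smul volume isCompact_triangle.measurableSet
    (fun p _ => (hasFDerivAt_planeMap v a b p).hasFDerivWithinAt)
    (injective_planeMap v h.ne').injOn, integralSimplex_eq]
  refine setIntegral_congr_fun isCompact_triangle.measurableSet fun p hp => ?_
  have hd : tderivWithin (ℝ × ℝ) E (σ ∘ planeMap v a b) triangle p =
      (tderivWithin (ℝ × ℝ) E σ triangle (planeMap v a b p)).comp (planeLin a b) := by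
    have h1 := tderivWithin_comp (g := σ) (f := planeMap v a b) (s := triangle) (t := triangle)
      ((hσ _ (hm hp)).mdifferentiableWithinAt (by simp))
      ((contDiff_planeMap v a b).contMDiff.mdifferentiableAt (x := p)
        (by simp)).mdifferentiableWithinAt hm (uniqueMDiffOn_triangle p hp)
    rw [h1, tderivWithin_eq_fderivWithin (planeMap v a b),
      (hasFDerivAt_planeMap v a b p).hasFDerivWithinAt.fderivWithin
        (uniqueMDiffOn_triangle.uniqueDiffOn p hp)]
  have ea : planeLin a b (1, 0) = a := by simp [planeLin]
  have eb : planeLin a b (0, 1) = b := by simp [planeLin]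
  rw [hd, ContinuousLinearMap.comp_apply, ContinuousLinearMap.comp_apply, ea, eb,
    alternating_map_planeLin, det_planeLin, abs_of_pos h]
  rfl

/-- The half of the standard triangle where `p.2 ≤ p.1`, as an affine map. -/
def leftHalf : ℝ × ℝ → ℝ × ℝ := planeMap (1 / 2, 1 / 2) (-1 / 2, -1 / 2) (1 / 2, -1 / 2)

/-- The half of the standard triangle where `p.1 ≤ p.2`, as an affine map. -/
def rightHalf : ℝ × ℝ → ℝ × ℝ := planeMap (1 / 2, 1 / 2) (-1 / 2, 1 / 2) (-1 / 2, -1 / 2)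

lemma leftHalf_apply (p : ℝ × ℝ) :
    leftHalf p = (1 / 2 - p.1 / 2 + p.2 / 2, 1 / 2 - p.1 / 2 - p.2 / 2) := by
  ext <;> simp [leftHalf, planeMap] <;> ring

lemma rightHalf_apply (p : ℝ × ℝ) :
    rightHalf p = (1 / 2 - p.1 / 2 - p.2 / 2, 1 / 2 + p.1 / 2 - p.2 / 2) := by
  ext <;> simp [rightHalf, planeMap] <;> ring

lemma image_leftHalf : leftHalf '' triangle = triangle ∩ {p | p.2 ≤ p.1} := by
  ext ⟨x, y⟩
  constructor
  · rintro ⟨⟨u, w⟩, ⟨h1, h2, h3⟩, he⟩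
    rw [leftHalf_apply, Prod.mk.injEq] at he
    simp only at h1 h2 h3 he
    refine ⟨⟨?_, ?_, ?_⟩, ?_⟩ <;> simp only [Set.mem_ofPred_eq] <;> linarith [he.1, he.2]
  · rintro ⟨⟨h1, h2, h3⟩, h4⟩
    simp only [Set.mem_ofPred_eq] at h1 h2 h3 h4
    refine ⟨(1 - x - y, x - y), ⟨?_, ?_, ?_⟩, ?_⟩
    · simp only; linarith
    · simp only; linarith
    · simp only; linarith
    · rw [leftHalf_apply]; ext <;> simp only <;> ring

lemma image_rightHalf : rightHalf '' triangle = triangle ∩ {p | p.1 ≤ p.2} := by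
  ext ⟨x, y⟩
  constructor
  · rintro ⟨⟨u, w⟩, ⟨h1, h2, h3⟩, he⟩
    rw [rightHalf_apply, Prod.mk.injEq] at he
    simp only at h1 h2 h3 he
    refine ⟨⟨?_, ?_, ?_⟩, ?_⟩ <;> simp only [Set.mem_ofPred_eq] <;> linarith [he.1, he.2]
  · rintro ⟨⟨h1, h2, h3⟩, h4⟩
    simp only [Set.mem_ofPred_eq] at h1 h2 h3 h4
    refine ⟨(y - x, 1 - x - y), ⟨?_, ?_, ?_⟩, ?_⟩
    · simp only; linarith
    · simp only; linarith
    · simp only; linarith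
    · rw [rightHalf_apply]; ext <;> simp only <;> ring

lemma mapsTo_leftHalf : Set.MapsTo leftHalf triangle triangle := fun _ hp =>
  (image_leftHalf ▸ Set.mem_image_of_mem leftHalf hp).1

lemma mapsTo_rightHalf : Set.MapsTo rightHalf triangle triangle := fun _ hp =>
  (image_rightHalf ▸ Set.mem_image_of_mem rightHalf hp).1

lemma volume_diagonal : volume {p : ℝ × ℝ | p.1 = p.2} = 0 := by
  let S : Submodule ℝ (ℝ × ℝ) :=
    LinearMap.ker (LinearMap.fst ℝ ℝ ℝ - LinearMap.snd ℝ ℝ ℝ)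
  have hS : (S : Set (ℝ × ℝ)) = {p : ℝ × ℝ | p.1 = p.2} := by
    ext p
    simp [S, sub_eq_zero]
  rw [← hS]
  refine Measure.addHaar_submodule volume S fun h => ?_
  have : ((1 : ℝ), (0 : ℝ)) ∈ S := h ▸ Submodule.mem_top
  simp [S] at this

lemma integralSimplex_eq_add [IsManifold 𝓘(ℝ, E) ∞ M] {α : TwoFormField E M}
    (hα : IsSmoothForm α) {σ : ℝ × ℝ → M}
    (hσ : ContMDiffOn 𝓘(ℝ, ℝ × ℝ) 𝓘(ℝ, E) ∞ σ triangle) :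
    integralSimplex α σ = integralSimplex α (σ ∘ leftHalf) + integralSimplex α (σ ∘ rightHalf) := by
  have hl := integralSimplex_comp_planeMap α hσ mapsTo_leftHalf (by norm_num)
  have hr := integralSimplex_comp_planeMap α hσ mapsTo_rightHalf (by norm_num)
  change integralSimplex α (σ ∘ leftHalf) = ∫ p in leftHalf '' triangle, _ at hl
  change integralSimplex α (σ ∘ rightHalf) = ∫ p in rightHalf '' triangle, _ at hr
  have hint : IntegrableOn (pullbackCoeff α σ) triangle :=
    (continuousOn_pullbackCoeff hα hσ).integrableOn_compact isCompact_triangle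
  have hU : triangle = leftHalf '' triangle ∪ rightHalf '' triangle := by
    rw [image_leftHalf, image_rightHalf, ← Set.inter_union_distrib_left]
    refine (Set.inter_eq_left.2 fun p _ => ?_).symm
    exact le_total p.2 p.1
  have hcl : MeasurableSet (rightHalf '' triangle) := by
    rw [image_rightHalf]
    exact isCompact_triangle.measurableSet.inter
      (isClosed_le continuous_fst continuous_snd).measurableSet
  have hdisj : AEDisjoint volume (leftHalf '' triangle) (rightHalf '' triangle) := by
    refine measure_mono_null ?_ volume_diagonal
    rw [image_leftHalf, image_rightHalf]
    rintro p ⟨⟨_, h1⟩, _, h2⟩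
    exact le_antisymm h2 h1
  rw [hl, hr, ← setIntegral_union₀ hdisj hcl.nullMeasurableSet
    (hint.mono_set mapsTo_leftHalf.image_subset) (hint.mono_set mapsTo_rightHalf.image_subset), ← hU]
  rfl

/-- A function on curves that is additive under subdivision and odd under reversal, and computes
integrals over small simplices, computes all integrals over simplices. -/
theorem simplex_formula_of_local [IsManifold 𝓘(ℝ, E) ∞ M] {α : TwoFormField E M}
    (hα : IsSmoothForm α) {A : (unitInterval → M) → UnitAddCircle}
    (hsplit : ∀ (f : ℝ → M) (a b c : ℝ), a ≤ b → b ≤ c → a < c → PiecewiseSmoothOn E f a c →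
      A (seg f a c) = A (seg f a b) + A (seg f b c))
    (hrev : ∀ γ, IsPiecewiseSmooth E γ → A (reverse γ) = -A γ)
    {I : Type*} {U : I → Set M} (hU : ∀ i, IsOpen (U i)) (hcov : ∀ x, ∃ i, x ∈ U i)
    (hloc : ∀ σ : ℝ × ℝ → M, ContMDiffOn 𝓘(ℝ, ℝ × ℝ) 𝓘(ℝ, E) ∞ σ triangle →
      (∃ i, Set.MapsTo σ triangle (U i)) →
      A (fun s => σ (1 - (s : ℝ), (s : ℝ))) - A (fun s => σ (0, (s : ℝ)))
        + A (fun s => σ ((s : ℝ), 0)) = ((integralSimplex α σ : ℝ) : UnitAddCircle))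
    {σ : ℝ × ℝ → M} (hσ : ContMDiffOn 𝓘(ℝ, ℝ × ℝ) 𝓘(ℝ, E) ∞ σ triangle) :
    A (fun s => σ (1 - (s : ℝ), (s : ℝ))) - A (fun s => σ (0, (s : ℝ)))
      + A (fun s => σ ((s : ℝ), 0)) = ((integralSimplex α σ : ℝ) : UnitAddCircle) := by
  let Fine : ℝ → (ℝ × ℝ → M) → Prop := fun ε σ => ∀ S ⊆ triangle,
    (∀ p ∈ S, ∀ q ∈ S, (p.1 - q.1) ^ 2 + (p.2 - q.2) ^ 2 < ε) → ∃ i, Set.MapsTo σ S (U i)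
  have hhalf : ∀ {ε : ℝ} {σ : ℝ × ℝ → M} {L : ℝ × ℝ → ℝ × ℝ}, Fine ε σ →
      Set.MapsTo L triangle triangle →
      (∀ p q, ((L p).1 - (L q).1) ^ 2 + ((L p).2 - (L q).2) ^ 2 =
        ((p.1 - q.1) ^ 2 + (p.2 - q.2) ^ 2) / 2) → Fine (2 * ε) (σ ∘ L) := by
    intro ε σ L hF hm hL S hS hd
    obtain ⟨i, hi⟩ := hF (L '' S) ((Set.image_mono hS).trans hm.image_subset) (by
      rintro _ ⟨p, hp, rfl⟩ _ ⟨q, hq, rfl⟩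
      rw [hL]
      linarith [hd p hp q hq])
    exact ⟨i, fun p hp => hi (Set.mem_image_of_mem L hp)⟩
  suffices H : ∀ (n : ℕ) (ε : ℝ) (σ : ℝ × ℝ → M),
      ContMDiffOn 𝓘(ℝ, ℝ × ℝ) 𝓘(ℝ, E) ∞ σ triangle → Fine ε σ → 2 < 2 ^ n * ε →
      A (fun s => σ (1 - (s : ℝ), (s : ℝ))) - A (fun s => σ (0, (s : ℝ)))
        + A (fun s => σ ((s : ℝ), 0)) = ((integralSimplex α σ : ℝ) : UnitAddCircle) by
    have hc : ∀ i, ∃ O : Set (ℝ × ℝ), IsOpen O ∧ σ ⁻¹' U i ∩ triangle = O ∩ triangle := fun i =>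
      (continuousOn_iff'.1 hσ.continuousOn) (U i) (hU i)
    choose O hO hOU using hc
    obtain ⟨δ, hδ, hleb⟩ := lebesgue_number_lemma_of_metric isCompact_triangle hO (fun p hp => by
      obtain ⟨i, hi⟩ := hcov (σ p)
      exact Set.mem_iUnion.2 ⟨i, (hOU i ▸ (⟨hi, hp⟩ : p ∈ σ ⁻¹' U i ∩ triangle) :
        p ∈ O i ∩ triangle).1⟩)
    have hfine : Fine (δ ^ 2) σ := by
      intro S hS hd
      rcases S.eq_empty_or_nonempty with rfl | ⟨p, hp⟩
      · obtain ⟨i, -⟩ := hcov (σ 0)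
        exact ⟨i, Set.mapsTo_empty _ _⟩
      · obtain ⟨i, hi⟩ := hleb p (hS hp)
        refine ⟨i, fun q hq => ?_⟩
        have hb : q ∈ Metric.ball p δ := by
          rw [Metric.mem_ball, Prod.dist_eq, max_lt_iff, Real.dist_eq, Real.dist_eq]
          have := hd q hq p hp
          constructor <;> refine abs_lt_of_sq_lt_sq ?_ hδ.le <;>
            nlinarith [sq_nonneg (q.1 - p.1), sq_nonneg (q.2 - p.2)]
        exact (hOU i ▸ (⟨hi hb, hS hq⟩ : q ∈ O i ∩ triangle) : q ∈ σ ⁻¹' U i ∩ triangle).1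
    obtain ⟨n, hn⟩ := pow_unbounded_of_one_lt (2 / δ ^ 2) (one_lt_two (α := ℝ))
    exact H n (δ ^ 2) σ hσ hfine ((div_lt_iff₀ (by positivity)).1 hn)
  intro n
  induction n with
  | zero =>
    intro ε σ hσ hF hε
    refine hloc σ hσ (hF triangle subset_rfl ?_)
    rintro ⟨x, y⟩ ⟨h1, h2, h3⟩ ⟨x', y'⟩ ⟨h1', h2', h3'⟩
    simp only at h1 h2 h3 h1' h2' h3' ⊢
    nlinarith [mul_nonneg h1 h1', mul_nonneg h2 h2', mul_nonneg h1 h2, mul_nonneg h1' h2',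
      mul_nonneg h1 (sub_nonneg.2 h3), mul_nonneg h2 (sub_nonneg.2 h3),
      mul_nonneg h1' (sub_nonneg.2 h3'), mul_nonneg h2' (sub_nonneg.2 h3')]
  | succ n ih =>
    intro ε σ hσ hF hε
    have hsl : ContMDiffOn 𝓘(ℝ, ℝ × ℝ) 𝓘(ℝ, E) ∞ (σ ∘ leftHalf) triangle :=
      hσ.comp (contDiff_planeMap _ _ _).contMDiff.contMDiffOn mapsTo_leftHalf
    have hsr : ContMDiffOn 𝓘(ℝ, ℝ × ℝ) 𝓘(ℝ, E) ∞ (σ ∘ rightHalf) triangle :=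
      hσ.comp (contDiff_planeMap _ _ _).contMDiff.contMDiffOn mapsTo_rightHalf
    have hε' : 2 < 2 ^ n * (2 * ε) := by rw [pow_succ] at hε; linarith
    have hl := ih (2 * ε) _ hsl (hhalf hF mapsTo_leftHalf fun p q => by
      rw [leftHalf_apply, leftHalf_apply]; ring) hε'
    have hr := ih (2 * ε) _ hsr (hhalf hF mapsTo_rightHalf fun p q => by
      rw [rightHalf_apply, rightHalf_apply]; ring) hε'
    have edge : ∀ {u v w z : ℝ}, Set.MapsTo (fun s : ℝ => (u + s * v, w + s * z)) (Set.Icc 0 1)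
        triangle → SmoothOn E (fun s : ℝ => σ (u + s * v, w + s * z)) 0 1 := fun hm =>
      hσ.comp (ContDiff.contMDiff (𝕜 := ℝ) (n := ∞) (by fun_prop)).contMDiffOn hm
    have h12 := edge (u := 1) (v := -1) (w := 0) (z := 1) fun s hs => by
      refine ⟨?_, ?_, ?_⟩ <;> simp only <;> linarith [hs.1, hs.2]
    have h02 := edge (u := 0) (v := 0) (w := 0) (z := 1) fun s hs => by
      refine ⟨?_, ?_, ?_⟩ <;> simp only <;> linarith [hs.1, hs.2]
    have h12split := hsplit _ 0 (1 / 2) 1 (by norm_num) (by norm_num) one_pos h12.piecewiseSmoothOn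
    have hrev1 := hrev _ (h12.piecewiseSmoothOn.seg (a := 0) (b := 1 / 2) (by norm_num)
      (by norm_num))
    have hrev2 := hrev _ (h02.piecewiseSmoothOn.seg (a := 0) (b := 1) (by norm_num) (by norm_num))
    have c1 : (fun s : unitInterval => σ (1 - (s : ℝ), (s : ℝ))) =
        seg (fun s : ℝ => σ (1 + s * -1, 0 + s * 1)) 0 1 := by
      funext s; simp only [seg]; congr 2 <;> ring
    have c2 : (fun s : unitInterval => σ (0, (s : ℝ))) =
        seg (fun s : ℝ => σ (0 + s * 0, 0 + s * 1)) 0 1 := by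
      funext s; simp only [seg]; congr 2 <;> ring
    have l1 : (fun s : unitInterval => (σ ∘ leftHalf) (1 - (s : ℝ), (s : ℝ))) =
        fun s : unitInterval => σ ((s : ℝ), 0) := by
      funext s; simp only [Function.comp_apply, leftHalf_apply]; congr 2 <;> ring
    have l2 : (fun s : unitInterval => (σ ∘ leftHalf) (0, (s : ℝ))) =
        reverse (seg (fun s : ℝ => σ (1 + s * -1, 0 + s * 1)) 0 (1 / 2)) := by
      funext s
      simp only [Function.comp_apply, leftHalf_apply, reverse, seg, unitInterval.coe_symm_eq]
      congr 2 <;> ring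
    have l3 : (fun s : unitInterval => (σ ∘ leftHalf) ((s : ℝ), 0)) =
        fun s : unitInterval => (σ ∘ rightHalf) (0, (s : ℝ)) := by
      funext s
      simp only [Function.comp_apply, leftHalf_apply, rightHalf_apply]
      congr 2 <;> ring
    have r1 : (fun s : unitInterval => (σ ∘ rightHalf) (1 - (s : ℝ), (s : ℝ))) =
        reverse (seg (fun s : ℝ => σ (0 + s * 0, 0 + s * 1)) 0 1) := by
      funext s
      simp only [Function.comp_apply, rightHalf_apply, reverse, seg, unitInterval.coe_symm_eq]
      congr 2 <;> ring
    have r3 : (fun s : unitInterval => (σ ∘ rightHalf) ((s : ℝ), 0)) =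
        seg (fun s : ℝ => σ (1 + s * -1, 0 + s * 1)) (1 / 2) 1 := by
      funext s
      simp only [Function.comp_apply, rightHalf_apply, seg]
      congr 2 <;> ring
    rw [l1, l2, l3, hrev1] at hl
    rw [r1, r3, hrev2] at hr
    rw [integralSimplex_eq_add hα hσ, AddCircle.coe_add, ← hl, ← hr, c1, c2, h12split]
    abel

end Subdivision

end

section

lemma eq_zero_of_coe_mul_eq_zero {r : ℝ} (h : ∀ t : ℝ, ((t * r : ℝ) : UnitAddCircle) = 0) :
    r = 0 := by
  by_contra hr
  obtain ⟨n, hn⟩ := (AddCircle.coe_eq_zero_iff 1).1 (h (1 / (2 * r)))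
  have h1 : (n : ℝ) * 2 = 1 := by
    rw [zsmul_eq_mul, mul_one] at hn
    rw [hn]
    field_simp
  have h2 : n * 2 = 1 := by exact_mod_cast h1
  omega

variable {EG G EH H E M EB B : Type*}
    [NormedAddCommGroup EG] [NormedSpace ℝ EG] [TopologicalSpace G] [ChartedSpace EG G] [Group G]
    [NormedAddCommGroup EH] [NormedSpace ℝ EH] [TopologicalSpace H] [ChartedSpace EH H] [Group H]
    [NormedAddCommGroup E] [NormedSpace ℝ E] [TopologicalSpace M] [ChartedSpace E M]
    [MulAction G M]
    [NormedAddCommGroup EB] [NormedSpace ℝ EB] [TopologicalSpace B] [ChartedSpace EB B]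
    {ι : H →* G} {π : M → B}

namespace IsPrincipalBundle

set_option linter.unusedSectionVars false

variable (hπ : IsPrincipalBundle (EH := EH) (E := E) (EB := EB) ι π)

include hπ

/-! ### The action on the base -/

lemma proj_smul_eq (hN : ι.range.Normal) (φ : G) {x x' : M} (h : π x = π x') :
    π (φ • x) = π (φ • x') := by
  obtain ⟨k, rfl⟩ := hπ.exists_smul_eq h
  obtain ⟨k', hk'⟩ := hN.conj_mem (ι k) ⟨k, rfl⟩ φ
  rw [← mul_smul, show φ * ι k = ι k' * φ by rw [hk']; group, mul_smul, hπ.invariant]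

/-- If the structure group is normal in `G`, the action of `G` descends to the base. -/
abbrev mulAction (hN : ι.range.Normal) : MulAction G B where
  smul φ b := π (φ • Function.surjInv hπ.surjective b)
  one_smul b := by
    change π ((1 : G) • _) = b
    rw [one_smul]
    exact Function.surjInv_eq hπ.surjective b
  mul_smul φ' φ b := by
    change π ((φ' * φ) • _) = π (φ' • _)
    rw [mul_smul]
    exact hπ.proj_smul_eq hN φ' (Function.surjInv_eq hπ.surjective _).symm

lemma proj_smul (hN : ι.range.Normal) (φ : G) (x : M) :
    letI := hπ.mulAction hN
    π (φ • x) = φ • π x :=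
  hπ.proj_smul_eq hN φ (Function.surjInv_eq hπ.surjective _).symm

lemma contMDiffSMul [ContMDiffSMul 𝓘(ℝ, EG) 𝓘(ℝ, E) ∞ G M] [MulAction G B]
    (hG : ∀ (φ : G) (x : M), π (φ • x) = φ • π x) :
    ContMDiffSMul 𝓘(ℝ, EG) 𝓘(ℝ, EB) ∞ G B where
  contMDiff_smul := by
    rintro ⟨φ, b⟩
    obtain ⟨U, σ, k, hb, hs⟩ := hπ.exists_localSection b
    have h1 : ContMDiffAt (𝓘(ℝ, EG).prod 𝓘(ℝ, EB)) 𝓘(ℝ, E) ∞ (fun p : G × B => σ p.2) (φ, b) :=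
      ContMDiffAt.comp (g := σ) (φ, b) ((hs.smooth_section b hb).contMDiffAt (hs.isOpen.mem_nhds hb))
        contMDiffAt_snd
    have h2 : ContMDiffAt (𝓘(ℝ, EG).prod 𝓘(ℝ, EB)) 𝓘(ℝ, EB) ∞
        (fun p : G × B => π (p.1 • σ p.2)) (φ, b) :=
      hπ.smooth.contMDiffAt.comp (φ, b)
        ((contMDiff_smul (I := 𝓘(ℝ, EG)) (I' := 𝓘(ℝ, E)) (n := ∞)).contMDiffAt.comp (φ, b)
          (contMDiffAt_fst.prodMk h1))
    refine h2.congr_of_eventuallyEq ?_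
    filter_upwards [continuousAt_snd.preimage_mem_nhds (hs.isOpen.mem_nhds hb)] with p hp
    rw [hG, hs.proj_section _ hp]

/-- The projection has surjective differential. -/
lemma exists_tderiv_surjective (b : B) :
    ∃ x, π x = b ∧ Function.Surjective (tderiv E EB π x) := by
  obtain ⟨U, σ, k, hb, hs⟩ := hπ.exists_localSection b
  refine ⟨σ b, hs.proj_section b hb, fun v => ⟨tderiv EB E σ b v, ?_⟩⟩
  have hσ : MDifferentiableAt 𝓘(ℝ, EB) 𝓘(ℝ, E) σ b :=
    ((hs.smooth_section b hb).contMDiffAt (hs.isOpen.mem_nhds hb)).mdifferentiableAt (by simp)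
  have h1 := tderiv_comp (g := π) (f := σ) (x := b) (hπ.smooth.mdifferentiableAt (by simp)) hσ
  have h2 : π ∘ σ =ᶠ[nhds b] fun b => b := by
    filter_upwards [hs.isOpen.mem_nhds hb] with b' hb' using hs.proj_section b' hb'
  rw [tderiv_congr h2, tderiv_id] at h1
  exact (DFunLike.congr_fun h1 v).symm

lemma exists_isPiecewiseSmooth_lift
    (hφ : ∀ φ : G, ContMDiff 𝓘(ℝ, E) 𝓘(ℝ, E) ∞ (fun x : M => φ • x))
    {γ : unitInterval → B} (hγ : IsPiecewiseSmooth EB γ) :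
    ∃ δ : unitInterval → M, IsPiecewiseSmooth E δ ∧ π ∘ δ = γ := by
  obtain ⟨x, hx⟩ := hπ.surjective (ext γ 0)
  obtain ⟨f, hf, -, hfc⟩ := hπ.exists_lift hφ zero_lt_one (isPiecewiseSmooth_iff.1 hγ) hx
  refine ⟨seg f 0 1, hf.seg (by simp) (by simp), ?_⟩
  rw [← seg_comp, ← seg_ext γ]
  exact seg_congr zero_le_one hfc

end IsPrincipalBundle

namespace HolonomyData

namespace IsBasic

set_option linter.unusedSectionVars false

variable [LieGroup 𝓘(ℝ, EH) ∞ H] [IsManifold 𝓘(ℝ, E) ∞ M] [ContMDiffSMul 𝓘(ℝ, EG) 𝓘(ℝ, E) ∞ G M]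
    [CompleteSpace EH] [T2Space H] [IsManifold 𝓘(ℝ, EB) ∞ B]
    {T : HolonomyData G E M} {β : TwoFormField EB B}

lemma trans_hom_mul (hT : T.IsBasic (EH := EH) ι π β) (h : H) (φ : G) (x : M) :
    T.trans (ι h * φ) x = T.trans φ x := by
  rw [T.trans_mul, hT.trans_eq_zero, zero_add]

lemma trans_eq_of_proj_eq (hT : T.IsBasic (EH := EH) ι π β)
    (hπ : IsPrincipalBundle (EH := EH) (E := E) (EB := EB) ι π) (hN : ι.range.Normal) (φ : G)
    {x x' : M} (h : π x = π x') : T.trans φ x = T.trans φ x' := by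
  obtain ⟨k, rfl⟩ := hπ.exists_smul_eq h
  obtain ⟨k', hk'⟩ := hN.conj_mem (ι k) ⟨k, rfl⟩ φ
  have h1 := T.trans_mul φ (ι k) x
  rw [hT.trans_eq_zero, add_zero] at h1
  rw [← h1, show φ * ι k = ι k' * φ by rw [hk']; group, hT.trans_hom_mul]

/-- A basic trivialization descends to the base. -/
theorem exists_base (hT : T.IsBasic (EH := EH) ι π β) (hι : ContMDiff 𝓘(ℝ, EH) 𝓘(ℝ, EG) ∞ ι)
    (hπ : IsPrincipalBundle (EH := EH) (E := E) (EB := EB) ι π) (hN : ι.range.Normal)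
    (hβ : IsSmoothForm β) [MulAction G B] (hG : ∀ (φ : G) (x : M), π (φ • x) = φ • π x) :
    ∃ T' : HolonomyData G EB B, T'.form = β ∧
      (∀ γ : unitInterval → M, IsPiecewiseSmooth E γ → T'.hol (π ∘ γ) = T.hol γ) ∧
      ∀ (φ : G) (x : M), T'.trans φ (π x) = T.trans φ x := by
  classical
  have hφ : ∀ φ : G, ContMDiff 𝓘(ℝ, E) 𝓘(ℝ, E) ∞ (fun x : M => φ • x) :=
    fun φ => contMDiff_smul_right EG E φ
  obtain ⟨A, hA⟩ : ∃ A : (unitInterval → B) → UnitAddCircle,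
      ∀ γ : unitInterval → M, IsPiecewiseSmooth E γ → A (π ∘ γ) = T.hol γ := by
    refine ⟨fun c => if h : ∃ γ, IsPiecewiseSmooth E γ ∧ π ∘ γ = c then T.hol h.choose else 0,
      fun γ hγ => ?_⟩
    have h : ∃ γ', IsPiecewiseSmooth E γ' ∧ π ∘ γ' = π ∘ γ := ⟨γ, hγ, rfl⟩
    simp only [dif_pos h]
    exact hT.hol_eq_of_comp_eq hι hπ h.choose_spec.1 hγ h.choose_spec.2
  set s := Function.surjInv hπ.surjective with hs
  have hsπ : ∀ b, π (s b) = b := Function.surjInv_eq hπ.surjective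
  have htr : ∀ (φ : G) (x : M), T.trans φ (s (π x)) = T.trans φ x := fun φ x =>
    hT.trans_eq_of_proj_eq hπ hN φ (hsπ _)
  have hsplit : ∀ (f : ℝ → B) (a b c : ℝ), a ≤ b → b ≤ c → a < c → PiecewiseSmoothOn EB f a c →
      A (seg f a c) = A (seg f a b) + A (seg f b c) := by
    intro f a b c hab hbc hac hf
    obtain ⟨f', hf', -, hff⟩ := hπ.exists_lift hφ hac hf (hsπ (f a))
    have e : ∀ u v, u ≤ v → a ≤ u → v ≤ c → A (seg f u v) = T.hol (seg f' u v) := by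
      intro u v huv hu hv
      rw [← hA _ (hf'.seg ⟨hu, huv.trans hv⟩ ⟨hu.trans huv, hv⟩), ← seg_comp]
      exact congrArg A (seg_congr huv fun t ht => (hff t ⟨hu.trans ht.1, ht.2.trans hv⟩).symm)
    rw [e a c hac.le le_rfl le_rfl, e a b hab le_rfl hbc, e b c hbc hab le_rfl]
    exact T.hol_split f' a b c hab hbc hac hf'
  have hrev : ∀ γ, IsPiecewiseSmooth EB γ → A (reverse γ) = -A γ := by
    intro γ hγ
    obtain ⟨δ, hδ, rfl⟩ := hπ.exists_isPiecewiseSmooth_lift hφ hγ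
    rw [hA δ hδ, ← T.hol_reverse δ hδ]
    exact hA _ hδ.reverse
  refine ⟨{
    hol := A
    trans := fun φ b => T.trans φ (s b)
    form := β
    hol_split := hsplit
    hol_const := fun b => by
      have := hA (fun _ => s b) (IsPiecewiseSmooth.const _)
      rw [T.hol_const] at this
      rw [← this]
      congr 1
      funext t
      exact (hsπ b).symm
    hol_reverse := hrev
    hol_simplex := fun σ hσ => by
      choose U S k hb hS using hπ.exists_localSection
      refine simplex_formula_of_local hβ hsplit hrev (fun i => (hS i).isOpen)
        (fun b => ⟨b, hb b⟩) ?_ hσ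
      rintro σ hσ ⟨i, hi⟩
      have hSσ : ContMDiffOn 𝓘(ℝ, ℝ × ℝ) 𝓘(ℝ, E) ∞ (S i ∘ σ) triangle :=
        (hS i).smooth_section.comp hσ hi
      have hp : ∀ p ∈ triangle, π (S i (σ p)) = σ p := fun p hp =>
        (hS i).proj_section _ (hi hp)
      have edge : ∀ {u v w z : ℝ}, Set.MapsTo (fun s : ℝ => (u + s * v, w + s * z)) (Set.Icc 0 1)
          triangle → A (fun s : unitInterval => σ (u + (s : ℝ) * v, w + (s : ℝ) * z)) =
            T.hol (fun s : unitInterval => S i (σ (u + (s : ℝ) * v, w + (s : ℝ) * z))) := by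
        intro u v w z hm
        have h1 : SmoothOn E (fun s : ℝ => S i (σ (u + s * v, w + s * z))) 0 1 :=
          hSσ.comp (ContDiff.contMDiff (𝕜 := ℝ) (n := ∞)
            (f := fun s : ℝ => (u + s * v, w + s * z)) (by fun_prop)).contMDiffOn hm
        have h2 : (fun s : unitInterval => S i (σ (u + (s : ℝ) * v, w + (s : ℝ) * z))) =
            seg (fun s : ℝ => S i (σ (u + s * v, w + s * z))) 0 1 := by
          funext s; simp [seg]
        rw [h2, ← hA _ (h1.piecewiseSmoothOn.seg (by simp) (by simp)), ← h2]
        congr 1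
        funext s
        exact (hp _ (hm s.2)).symm
      have h12 := edge (u := 1) (v := -1) (w := 0) (z := 1) fun s hs => by
        refine ⟨?_, ?_, ?_⟩ <;> simp only <;> linarith [hs.1, hs.2]
      have h02 := edge (u := 0) (v := 0) (w := 0) (z := 1) fun s hs => by
        refine ⟨?_, ?_, ?_⟩ <;> simp only <;> linarith [hs.1, hs.2]
      have h01 := edge (u := 0) (v := 1) (w := 0) (z := 0) fun s hs => by
        refine ⟨?_, ?_, ?_⟩ <;> simp only <;> linarith [hs.1, hs.2]
      simp only [mul_neg, mul_one, ← sub_eq_add_neg, zero_add, mul_zero, add_zero] at h12 h02 h01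
      rw [h12, h02, h01]
      refine (T.hol_simplex _ hSσ).trans ?_
      rw [integralSimplex_pullback hπ.smooth hT.pullback hSσ]
      congr 1
      rw [integralSimplex_eq, integralSimplex_eq]
      refine MeasureTheory.setIntegral_congr_fun isCompact_triangle.measurableSet fun p hp' => ?_
      have hd : tderivWithin (ℝ × ℝ) EB (π ∘ S i ∘ σ) triangle p =
          tderivWithin (ℝ × ℝ) EB σ triangle p := by
        have he := hp p hp'
        have := mfderivWithin_congr (I := 𝓘(ℝ, ℝ × ℝ)) (I' := 𝓘(ℝ, EB)) (f := σ)
          (f₁ := π ∘ S i ∘ σ) (s := triangle) hp he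
        exact this
      simp only [hd, Function.comp_apply, hp p hp']
    hol_smul := fun φ γ hγ => by
      obtain ⟨δ, hδ, rfl⟩ := hπ.exists_isPiecewiseSmooth_lift hφ hγ
      have h1 : (fun t => φ • (π ∘ δ) t) = π ∘ fun t => φ • δ t := funext fun t => (hG φ _).symm
      rw [h1, hA (fun t => φ • δ t) (hδ.comp_left (hφ φ)), hA δ hδ]
      simp only [Function.comp_apply, htr]
      exact T.hol_smul φ δ hδ
    trans_mul := fun φ' φ b => by
      rw [T.trans_mul, ← htr φ' (φ • s b), hG, hsπ] }, rfl, hA, htr⟩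

end IsBasic

end HolonomyData

end

section

set_option linter.unusedSectionVars false

variable {EG G EH H E M EB B : Type*}
    [NormedAddCommGroup EG] [NormedSpace ℝ EG] [TopologicalSpace G] [ChartedSpace EG G] [Group G]
    [NormedAddCommGroup EH] [NormedSpace ℝ EH] [TopologicalSpace H] [ChartedSpace EH H] [Group H]
    [NormedAddCommGroup E] [NormedSpace ℝ E] [TopologicalSpace M] [ChartedSpace E M]
    [MulAction G M]
    [NormedAddCommGroup EB] [NormedSpace ℝ EB] [TopologicalSpace B] [ChartedSpace EB B]
    {ι : H →* G} {π : M → B}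

/-! ### One-parameter subgroups and homomorphisms -/

lemma lieMap_smul (ι : H →* G) (t : ℝ) (Y : GroupLieAlgebra 𝓘(ℝ, EH) H) :
    (lieMap ι (t • Y) : GroupLieAlgebra 𝓘(ℝ, EG) G) = t • lieMap ι Y :=
  (tderiv EH EG ι 1).map_smul t Y

lemma lieMap_id (X : GroupLieAlgebra 𝓘(ℝ, EG) G) : lieMap (MonoidHom.id G) X = X :=
  DFunLike.congr_fun (tderiv_id (E := EG) (1 : G)) (X : EG)

lemma IsOneParameterSubgroup.map {c : ℝ → H} {Y : GroupLieAlgebra 𝓘(ℝ, EH) H}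
    (hc : IsOneParameterSubgroup c Y) (hι : ContMDiff 𝓘(ℝ, EH) 𝓘(ℝ, EG) ∞ ι) :
    IsOneParameterSubgroup (fun t => ι (c t)) (lieMap ι Y : GroupLieAlgebra 𝓘(ℝ, EG) G) where
  smooth := hι.comp hc.smooth
  map_zero := by rw [hc.map_zero, map_one]
  map_add s t := by rw [hc.map_add, map_mul]
  velocity := by
    have h := tderiv_comp (g := ι) (f := c) (x := (0 : ℝ)) (hι.mdifferentiableAt (by simp))
      (hc.smooth.mdifferentiableAt (by simp))
    have h1 := DFunLike.congr_fun h (1 : ℝ)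
    rw [hc.map_zero] at h1
    refine h1.trans ?_
    exact congrArg (tderiv EH EG ι 1) hc.velocity

section

variable [ContMDiffSMul 𝓘(ℝ, EG) 𝓘(ℝ, E) ∞ G M]

lemma IsOneParameterSubgroup.mem_equivariantCurves {c : ℝ → G} {X : GroupLieAlgebra 𝓘(ℝ, EG) G}
    (hc : IsOneParameterSubgroup c X) (x : M) :
    (c 1, fun s : unitInterval => c (s : ℝ) • x) ∈ EquivariantCurves G E M := by
  have h : SmoothOn E (fun s => c s • x) 0 1 :=
    ((contMDiff_smul_left EG E x).comp hc.smooth).contMDiffOn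
  have e : (fun s : unitInterval => c (s : ℝ) • x) = seg (fun s => c s • x) 0 1 := by
    funext s; simp [seg]
  refine ⟨?_, ?_⟩
  · simp only [e]
    exact h.piecewiseSmoothOn.seg (by simp) (by simp)
  · simp [hc.map_zero]

namespace EquivariantDifferentialCharacter

variable (χ : EquivariantDifferentialCharacter EG G E M)

lemma ev_exp {c : ℝ → G} {X : GroupLieAlgebra 𝓘(ℝ, EG) G} (hc : IsOneParameterSubgroup c X)
    (x : M) : χ.ev (c 1) (fun s : unitInterval => c (s : ℝ) • x) =
      ((χ.curv.moment x X : ℝ) : UnitAddCircle) := by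
  rw [← χ.curv_spec.map_exp ⟨_, hc.mem_equivariantCurves x⟩ X c x hc rfl rfl, ← ev_eq]

lemma ev_one_const (x : M) : χ.ev 1 (fun _ => x) = 0 := by
  have h : IsPiecewiseSmooth E (fun _ : unitInterval => x) := IsPiecewiseSmooth.const x
  have := χ.ev_concat (φ := 1) (φ' := 1) h h (by simp) (by simp) rfl
  rw [one_mul, show concat (fun _ : unitInterval => x) (fun _ => x) = fun _ => x from
    funext fun t => by simp [concat]] at this
  simpa using this

/-- The moment vanishes on `𝔥` if `χ` is trivial on one-parameter orbits of `H`. -/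
lemma moment_lieMap_eq_zero [CompleteSpace EH] [T2Space H] [LieGroup 𝓘(ℝ, EH) ∞ H]
    (hι : ContMDiff 𝓘(ℝ, EH) 𝓘(ℝ, EG) ∞ ι)
    (h : ∀ (Y : GroupLieAlgebra 𝓘(ℝ, EH) H) (c : ℝ → H) (x : M), IsOneParameterSubgroup c Y →
      χ.ev (ι (c 1)) (fun s : unitInterval => ι (c (s : ℝ)) • x) = 0)
    (Y : GroupLieAlgebra 𝓘(ℝ, EH) H) (x : M) : χ.moment (lieMap ι Y) x = 0 := by
  refine eq_zero_of_coe_mul_eq_zero fun t => ?_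
  obtain ⟨c, hc⟩ := exists_isOneParameterSubgroup (t • Y)
  rw [← h _ c x hc, χ.ev_exp (hc.map hι), lieMap_smul, map_smul]
  rfl

/-- If the moment vanishes on `𝔥`, then `χ` is given by a basic trivialization. -/
theorem exists_isBasic [IsManifold 𝓘(ℝ, E) ∞ M] [IsManifold 𝓘(ℝ, EB) ∞ B] [ConnectedSpace M]
    [LieGroup 𝓘(ℝ, EH) ∞ H]
    (hι : ContMDiff 𝓘(ℝ, EH) 𝓘(ℝ, EG) ∞ ι)
    (hπ : IsPrincipalBundle (EH := EH) (E := E) (EB := EB) ι π)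
    (hμ : ∀ (Y : GroupLieAlgebra 𝓘(ℝ, EH) H) (x : M), χ.moment (lieMap ι Y) x = 0) :
    ∃ (T : HolonomyData G E M) (β : TwoFormField EB B), T.IsBasic (EH := EH) ι π β ∧
      IsSmoothForm β ∧ IsClosedForm β ∧ (∀ (x : M) (v w : E),
        χ.curv.form.val x ![v, w] = β.val (π x) ![tderiv E EB π x v, tderiv E EB π x w]) ∧
      ∀ φ γ, IsPiecewiseSmooth E γ → γ 1 = φ • γ 0 → χ.ev φ γ = T.hol γ + T.trans φ (γ 0) := by
  obtain ⟨x₀⟩ : Nonempty M := inferInstance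
  obtain ⟨β, hβ, hβ', hpull⟩ := exists_form_of_moment_eq_zero hι χ.curv_spec.isClosed hμ hπ
  obtain ⟨T₀, hform, hT₀⟩ := χ.exists_holonomyData (fun φ => contMDiff_smul_right EG E φ) x₀
    (exists_isPiecewiseSmooth x₀)
  obtain ⟨θ, hθ⟩ := HolonomyData.exists_twist_trans_eq_zero hπ T₀
  have hev : ∀ φ γ, IsPiecewiseSmooth E γ → γ 1 = φ • γ 0 →
      χ.ev φ γ = (T₀.twist θ).hol γ + (T₀.twist θ).trans φ (γ 0) := by
    intro φ γ hγ h
    rw [hT₀ φ γ hγ h]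
    simp only [HolonomyData.twist, h]
    abel
  refine ⟨T₀.twist θ, β, ⟨hθ, fun Y c x hc => ?_, ?_⟩, hβ, hβ', hpull, hev⟩
  · have hm := (hc.map (EG := EG) hι).mem_equivariantCurves (E := E) x
    have h1 := hev _ _ hm.1 hm.2
    rw [hθ, add_zero, χ.ev_exp (hc.map hι)] at h1
    rw [show χ.curv.moment x (lieMap ι Y) = 0 from hμ Y x, AddCircle.coe_zero] at h1
    rw [h1]
    congr 1
    funext s
    simp [seg]
  · change ∀ (x : M) (v w : E), T₀.form.val x ![v, w] = _
    rw [hform]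
    exact hpull

end EquivariantDifferentialCharacter

end

/-! ### The equivariant curvature on the base -/

/-- An equivariant form whose components descend gives an equivariant form on the base. -/
theorem exists_equivariantTwoForm_base [ContMDiffSMul 𝓘(ℝ, EG) 𝓘(ℝ, E) ∞ G M]
    [MulAction G B] [ContMDiffSMul 𝓘(ℝ, EG) 𝓘(ℝ, EB) ∞ G B]
    (hπ : IsPrincipalBundle (EH := EH) (E := E) (EB := EB) ι π)
    (hG : ∀ (φ : G) (x : M), π (φ • x) = φ • π x)
    {ϖ : EquivariantTwoForm EG G E M} (hϖ : ϖ.IsClosed)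
    {β : TwoFormField EB B} (hβ : IsSmoothForm β) (hβ' : IsClosedForm β)
    (hpull : ∀ (x : M) (v w : E),
      ϖ.form.val x ![v, w] = β.val (π x) ![tderiv E EB π x v, tderiv E EB π x w])
    (hmom : ∀ x x' : M, π x = π x' → ϖ.moment x = ϖ.moment x') :
    ∃ ϖ' : EquivariantTwoForm EG G EB B, ϖ'.form = β ∧ ϖ'.IsClosed ∧
      ∀ x : M, ϖ'.moment (π x) = ϖ.moment x := by
  set s := Function.surjInv hπ.surjective
  have hsπ : ∀ b, π (s b) = b := Function.surjInv_eq hπ.surjective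
  have hm : ∀ x, ϖ.moment (s (π x)) = ϖ.moment x := fun x => hmom _ _ (hsπ _)
  have hdπ : ∀ x, MDifferentiableAt 𝓘(ℝ, E) 𝓘(ℝ, EB) π x :=
    fun x => hπ.smooth.mdifferentiableAt (by simp)
  have hsmooth : ∀ X : GroupLieAlgebra 𝓘(ℝ, EG) G,
      ContMDiff 𝓘(ℝ, EB) 𝓘(ℝ, ℝ) ∞ (fun b : B => ϖ.moment (s b) X) := by
    intro X b
    obtain ⟨U, σ, k, hb, hs⟩ := hπ.exists_localSection b
    have h1 : ContMDiffAt 𝓘(ℝ, EB) 𝓘(ℝ, ℝ) ∞ (fun b => ϖ.moment (σ b) X) b :=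
      (ϖ.smooth_moment X).contMDiffAt.comp b
        ((hs.smooth_section b hb).contMDiffAt (hs.isOpen.mem_nhds hb))
    refine h1.congr_of_eventuallyEq ?_
    filter_upwards [hs.isOpen.mem_nhds hb] with b' hb'
    rw [← hm (σ b'), hs.proj_section b' hb']
  have hinv : ∀ (φ : G) (b : B) (v w : EB),
      β.val (φ • b) ![tderiv EB EB (fun y : B => φ • y) b v,
        tderiv EB EB (fun y : B => φ • y) b w] = β.val b ![v, w] := by
    intro φ b v w
    obtain ⟨x, rfl, hx⟩ := hπ.exists_tderiv_surjective b
    obtain ⟨v, rfl⟩ := hx v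
    obtain ⟨w, rfl⟩ := hx w
    have hd : ∀ u, tderiv EB EB (fun y : B => φ • y) (π x) (tderiv E EB π x u) =
        tderiv E EB π (φ • x) (tderiv E E (fun y : M => φ • y) x u) := by
      intro u
      have h1 := tderiv_comp (g := fun y : B => φ • y) (f := π) (x := x)
        ((contMDiff_smul_right EG EB φ).mdifferentiableAt (by simp)) (hdπ x)
      have h2 := tderiv_comp (g := π) (f := fun y : M => φ • y) (x := x) (hdπ _)
        ((contMDiff_smul_right EG E φ).mdifferentiableAt (by simp))
      rw [show (fun y : B => φ • y) ∘ π = π ∘ fun y : M => φ • y from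
        funext fun y => (hG φ y).symm, h2] at h1
      exact (DFunLike.congr_fun h1 u).symm
    rw [hd, hd, ← hG, ← hpull, ← hpull]
    exact ϖ.invariant_form φ x v w
  refine ⟨{
    form := β
    smooth_form := hβ
    invariant_form := hinv
    moment := fun b => ϖ.moment (s b)
    smooth_moment := hsmooth
    invariant_moment := fun φ X b => by
      rw [hmom (s (φ • b)) (φ • s b) (by rw [hG, hsπ, hsπ])]
      exact ϖ.invariant_moment φ X (s b) }, rfl, ⟨hβ', fun X b v => ?_⟩, hm⟩
  change β.val b ![(fundamentalField X b : EB), v] = tderiv EB ℝ (fun y => ϖ.moment (s y) X) b v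
  obtain ⟨x, rfl, hx⟩ := hπ.exists_tderiv_surjective b
  obtain ⟨v, rfl⟩ := hx v
  have hF : (fundamentalField X (π x) : EB) = tderiv E EB π x (fundamentalField X x : E) := by
    have h1 := tderiv_comp (g := π) (f := fun g : G => g • x) (x := (1 : G)) (hdπ _)
      ((contMDiff_smul_left EG E x).mdifferentiableAt (by simp))
    rw [show π ∘ (fun g : G => g • x) = fun g => g • π x from funext fun g => hG g x,
      one_smul] at h1
    refine (congrArg Neg.neg (DFunLike.congr_fun h1 X)).trans ?_
    exact ((tderiv E EB π x).map_neg _).symm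
  have hd := tderiv_comp (g := fun b => ϖ.moment (s b) X) (f := π) (x := x)
    ((hsmooth X).mdifferentiableAt (by simp)) (hdπ x)
  rw [show (fun b => ϖ.moment (s b) X) ∘ π = fun y => ϖ.moment y X from
    funext fun y => by simp only [Function.comp_apply, hm]] at hd
  rw [hF]
  refine (hpull x (fundamentalField X x : E) v).symm.trans ((hϖ.2 X x v).trans ?_)
  exact DFunLike.congr_fun hd v

namespace HolonomyData.IsBasic

variable [LieGroup 𝓘(ℝ, EH) ∞ H] [IsManifold 𝓘(ℝ, E) ∞ M] [ContMDiffSMul 𝓘(ℝ, EG) 𝓘(ℝ, E) ∞ G M]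
    [CompleteSpace EH] [T2Space H] [CompleteSpace EG] [T2Space G] [LieGroup 𝓘(ℝ, EG) ∞ G]
    [IsManifold 𝓘(ℝ, EB) ∞ B] {T : HolonomyData G E M} {β : TwoFormField EB B}

lemma moment_eq_of_proj_eq (hT : T.IsBasic (EH := EH) ι π β)
    (hι : ContMDiff 𝓘(ℝ, EH) 𝓘(ℝ, EG) ∞ ι)
    (hπ : IsPrincipalBundle (EH := EH) (E := E) (EB := EB) ι π) (hN : ι.range.Normal)
    {ϖ : EquivariantTwoForm EG G E M}
    (hexp : ∀ (X : GroupLieAlgebra 𝓘(ℝ, EG) G) (c : ℝ → G) (x : M), IsOneParameterSubgroup c X →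
      T.hol (fun s => c (s : ℝ) • x) + T.trans (c 1) x = ((ϖ.moment x X : ℝ) : UnitAddCircle))
    {x x' : M} (h : π x = π x') : ϖ.moment x = ϖ.moment x' := by
  ext X
  refine sub_eq_zero.1 (eq_zero_of_coe_mul_eq_zero fun t => ?_)
  obtain ⟨c, hc⟩ := exists_isOneParameterSubgroup (t • X)
  have h1 := hexp _ c x hc
  have h2 := hexp _ c x' hc
  rw [hT.hol_eq_of_comp_eq hι hπ (hc.mem_equivariantCurves x).1 (hc.mem_equivariantCurves x').1
    (funext fun s => hπ.proj_smul_eq hN _ h), hT.trans_eq_of_proj_eq hπ hN _ h, map_smul,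
    smul_eq_mul] at h1
  rw [map_smul, smul_eq_mul] at h2
  rw [mul_sub, AddCircle.coe_sub, ← h1, ← h2, sub_self]

end HolonomyData.IsBasic

/-! ### Characters that descend -/

namespace EquivariantDifferentialCharacter

variable [CompleteSpace EG] [T2Space G] [LieGroup 𝓘(ℝ, EG) ∞ G]
    [CompleteSpace EH] [T2Space H] [LieGroup 𝓘(ℝ, EH) ∞ H]
    [IsManifold 𝓘(ℝ, E) ∞ M] [ContMDiffSMul 𝓘(ℝ, EG) 𝓘(ℝ, E) ∞ G M]
    [IsManifold 𝓘(ℝ, EB) ∞ B] (χ : EquivariantDifferentialCharacter EG G E M)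

theorem exists_differentialCharacter_iff [ConnectedSpace M]
    (hπ : IsPrincipalBundle (EH := EG) (E := E) (EB := EB) (MonoidHom.id G) π)
    (hloop : ∀ p ∈ EquivariantCurves G E M, π ∘ p.2 ∈ Loops EB B) :
    (∃ χ' : DifferentialCharacter EB B, ∀ p : EquivariantCurves G E M,
      χ.toFun p = χ'.toFun ⟨π ∘ p.1.2, hloop p.1 p.2⟩) ↔
    ∀ (X : GroupLieAlgebra 𝓘(ℝ, EG) G) (x : M), χ.moment X x = 0 := by
  have hι : ContMDiff 𝓘(ℝ, EG) 𝓘(ℝ, EG) ∞ (MonoidHom.id G) := contMDiff_id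
  constructor
  · rintro ⟨χ', h⟩ X x
    rw [← lieMap_id X]
    refine χ.moment_lieMap_eq_zero hι (fun Y c x hc => ?_) X x
    have hm := hc.mem_equivariantCurves (E := E) x
    have hl : (fun _ => π x) ∈ Loops EB B := ⟨IsPiecewiseSmooth.const _, rfl⟩
    have h0 := χ'.map_concat ⟨_, hl⟩ ⟨_, hl⟩ ⟨_, hl⟩ rfl (funext fun t => by simp [concat])
    rw [right_eq_add] at h0
    refine (χ.ev_eq ⟨_, hm⟩).trans ((h ⟨_, hm⟩).trans ?_)
    rw [← h0]
    congr 2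
    exact funext fun s => hπ.invariant _ _
  · intro hμ
    obtain ⟨T, β, hT, hβ, hβ', -, hev⟩ := χ.exists_isBasic hι hπ fun Y x => hμ _ x
    have hN : (MonoidHom.id G).range.Normal := by
      rw [MonoidHom.range_eq_top.2 Function.surjective_id]
      infer_instance
    let := hπ.mulAction hN
    obtain ⟨T', hform, hhol, -⟩ := hT.exists_base hι hπ hN hβ fun φ x => hπ.proj_smul hN φ x
    refine ⟨T'.toDifferentialCharacter (hform ▸ hβ) (hform ▸ hβ'), fun p => ?_⟩
    rw [← ev_eq, hev _ _ p.2.1 p.2.2]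
    have h0 : T.trans p.1.1 (p.1.2 0) = 0 := hT.trans_eq_zero p.1.1 _
    rw [h0, add_zero]
    exact (hhol _ p.2.1).symm

theorem exists_equivariantDifferentialCharacter_iff [ConnectedSpace M]
    (hι : ContMDiff 𝓘(ℝ, EH) 𝓘(ℝ, EG) ∞ ι) (hN : ι.range.Normal)
    (hπ : IsPrincipalBundle (EH := EH) (E := E) (EB := EB) ι π)
    [MulAction G B] [ContMDiffSMul 𝓘(ℝ, EG) 𝓘(ℝ, EB) ∞ G B]
    (hG : ∀ (φ : G) (x : M), π (φ • x) = φ • π x)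
    (hcurve : ∀ p ∈ EquivariantCurves G E M, (p.1, π ∘ p.2) ∈ EquivariantCurves G EB B) :
    (∃ χ' : EquivariantDifferentialCharacter EG G EB B,
      (∀ (q q' : EquivariantCurves G EB B) (h : H),
        q'.1 = (ι h * q.1.1, q.1.2) → χ'.toFun q' = χ'.toFun q) ∧
      (∀ p : EquivariantCurves G E M,
        χ.toFun p = χ'.toFun ⟨(p.1.1, π ∘ p.1.2), hcurve p.1 p.2⟩)) ↔
    ∀ (Y : GroupLieAlgebra 𝓘(ℝ, EH) H) (x : M), χ.moment (lieMap ι Y) x = 0 := by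
  constructor
  · rintro ⟨χ', hH, h⟩
    refine χ.moment_lieMap_eq_zero hι fun Y c x hc => ?_
    have hm := (hc.map (EG := EG) hι).mem_equivariantCurves (E := E) x
    have h1 : ((1 : G), fun _ => π x) ∈ EquivariantCurves G EB B :=
      ⟨IsPiecewiseSmooth.const _, (one_smul G _).symm⟩
    refine (χ.ev_eq ⟨_, hm⟩).trans ((h ⟨_, hm⟩).trans ?_)
    rw [hH ⟨_, h1⟩ _ (c 1), ← χ'.ev_eq]
    · exact χ'.ev_one_const _
    · rw [mul_one]
      exact Prod.ext rfl (funext fun s => hπ.invariant _ _)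
  · intro hμ
    obtain ⟨T, β, hT, hβ, hβ', hpull, hev⟩ := χ.exists_isBasic hι hπ hμ
    obtain ⟨T', hform, hhol, htrans⟩ := hT.exists_base hι hπ hN hβ hG
    have hexp : ∀ (X : GroupLieAlgebra 𝓘(ℝ, EG) G) (c : ℝ → G) (x : M),
        IsOneParameterSubgroup c X → T.hol (fun s => c (s : ℝ) • x) + T.trans (c 1) x =
          ((χ.curv.moment x X : ℝ) : UnitAddCircle) := by
      intro X c x hc
      have hm := hc.mem_equivariantCurves (E := E) x
      have h1 := hev _ _ hm.1 hm.2
      rw [χ.ev_exp hc] at h1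
      rw [h1]
      simp [hc.map_zero]
    obtain ⟨ϖ, hϖβ, hϖ, hϖm⟩ := exists_equivariantTwoForm_base hπ hG χ.curv_spec.isClosed hβ hβ'
      hpull fun x x' h => hT.moment_eq_of_proj_eq hι hπ hN hexp h
    refine ⟨T'.toEquivariantDifferentialCharacter (fun φ => contMDiff_smul_right EG EB φ) ϖ hϖ
      (hϖβ.trans hform.symm) fun X c b hc => ?_, fun q q' h e => ?_, fun p => ?_⟩
    · obtain ⟨x, rfl⟩ := hπ.surjective b
      rw [hϖm, ← hexp X c x hc, htrans, ← hhol _ (hc.mem_equivariantCurves x).1]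
      congr 2
      exact funext fun s => (hG _ _).symm
    · change T'.hol q'.1.2 + T'.trans q'.1.1 (q'.1.2 0) = T'.hol q.1.2 + T'.trans q.1.1 (q.1.2 0)
      obtain ⟨x, hx⟩ := hπ.surjective (q.1.2 0)
      rw [e, ← hx, htrans, htrans, hT.trans_hom_mul]
    · rw [← ev_eq, hev _ _ p.2.1 p.2.2, ← hhol _ p.2.1, ← htrans]
      rfl

end EquivariantDifferentialCharacter

end

end EquivChar

end

theorem proposition4p6
    {EG G EH H E M EB B : Type*}
    -- the Lie group `G`
    [NormedAddCommGroup EG] [NormedSpace ℝ EG] [CompleteSpace EG]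
    [TopologicalSpace G] [T2Space G] [ChartedSpace EG G] [Group G] [LieGroup 𝓘(ℝ, EG) ∞ G]
    -- the Lie group `H`
    [NormedAddCommGroup EH] [NormedSpace ℝ EH] [CompleteSpace EH]
    [TopologicalSpace H] [T2Space H] [ChartedSpace EH H] [Group H] [LieGroup 𝓘(ℝ, EH) ∞ H]
    -- the contractible manifold `M`, with a smooth action of `G`
    [NormedAddCommGroup E] [NormedSpace ℝ E] [CompleteSpace E]
    [TopologicalSpace M] [T2Space M] [ChartedSpace E M] [IsManifold 𝓘(ℝ, E) ∞ M]
    [ContractibleSpace M]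
    [MulAction G M] [ContMDiffSMul 𝓘(ℝ, EG) 𝓘(ℝ, E) ∞ G M]
    -- the quotient manifold `B`
    [NormedAddCommGroup EB] [NormedSpace ℝ EB] [CompleteSpace EB]
    [TopologicalSpace B] [T2Space B] [ChartedSpace EB B] [IsManifold 𝓘(ℝ, EB) ∞ B] :
    -- the quotient by `G`: `χ = π_G^* χ'` for a differential character `χ'` on `B = M/G`
    (∀ π : M → B,
      EquivChar.IsPrincipalBundle (EH := EG) (E := E) (EB := EB) (MonoidHom.id G) π →
      ∃ hπ : ∀ p ∈ EquivChar.EquivariantCurves G E M, π ∘ p.2 ∈ EquivChar.Loops EB B,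
        ∀ χ : EquivChar.EquivariantDifferentialCharacter EG G E M,
          (∃ χ' : EquivChar.DifferentialCharacter EB B,
            ∀ p : EquivChar.EquivariantCurves G E M,
              χ.toFun p = χ'.toFun ⟨π ∘ p.1.2, hπ p.1 p.2⟩) ↔
          (∀ (X : GroupLieAlgebra 𝓘(ℝ, EG) G) (x : M), χ.moment X x = 0)) ∧
    -- the quotient by a normal Lie subgroup `ι : H → G`
    (∀ (ι : H →* G), ContMDiff 𝓘(ℝ, EH) 𝓘(ℝ, EG) ∞ ι → Function.Injective ι → ι.range.Normal →
      ∀ π : M → B, EquivChar.IsPrincipalBundle (EH := EH) (E := E) (EB := EB) ι π →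
      ∃ act : MulAction G B,
        ContMDiffSMul 𝓘(ℝ, EG) 𝓘(ℝ, EB) ∞ G B ∧
        (∀ (φ : G) (x : M), π (φ • x) = φ • π x) ∧
        ∃ hπ : ∀ p ∈ EquivChar.EquivariantCurves G E M,
            (p.1, π ∘ p.2) ∈ EquivChar.EquivariantCurves G EB B,
          ∀ χ : EquivChar.EquivariantDifferentialCharacter EG G E M,
            (∃ χ' : EquivChar.EquivariantDifferentialCharacter EG G EB B,
              -- `χ'` does not change when the group element is multiplied by an element of `H`
              (∀ (q q' : EquivChar.EquivariantCurves G EB B) (h : H),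
                q'.1 = (ι h * q.1.1, q.1.2) → χ'.toFun q' = χ'.toFun q) ∧
              (∀ p : EquivChar.EquivariantCurves G E M,
                χ.toFun p = χ'.toFun ⟨(p.1.1, π ∘ p.1.2), hπ p.1 p.2⟩)) ↔
            (∀ (Y : GroupLieAlgebra 𝓘(ℝ, EH) H) (x : M),
              χ.moment (EquivChar.lieMap ι Y) x = 0)) := by
  have : PathConnectedSpace M := inferInstance
  refine ⟨fun π hπ => ?_, fun ι hι _ hN π hπ => ?_⟩
  · have hloop : ∀ p ∈ EquivChar.EquivariantCurves G E M, π ∘ p.2 ∈ EquivChar.Loops EB B :=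
      fun p hp => ⟨hp.1.comp_left hπ.smooth, (congrArg π hp.2).trans (hπ.invariant p.1 _)⟩
    exact ⟨hloop, fun χ => χ.exists_differentialCharacter_iff hπ hloop⟩
  · let := hπ.mulAction hN
    have hG : ∀ (φ : G) (x : M), π (φ • x) = φ • π x := fun φ x => hπ.proj_smul hN φ x
    have hsmul : ContMDiffSMul 𝓘(ℝ, EG) 𝓘(ℝ, EB) ∞ G B := hπ.contMDiffSMul hG
    have hcurve : ∀ p ∈ EquivChar.EquivariantCurves G E M,
        (p.1, π ∘ p.2) ∈ EquivChar.EquivariantCurves G EB B :=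
      fun p hp => ⟨hp.1.comp_left hπ.smooth, (congrArg π hp.2).trans (hG _ _)⟩
    exact ⟨hπ.mulAction hN, hsmul, hG, hcurve, fun χ =>
      χ.exists_equivariantDifferentialCharacter_iff hι hN hπ hG hcurve⟩
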